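/- **Setting.** Let $b\ge 2$ be an integer, let $0\le\theta,\rho<1$ be real numbers with $\theta=[0;a_1,a_2,\dots]$ irrational, and let $p_k/q_k$ be the convergents of $\theta$ (so $q_0=1$, $q_1=a_1$, $q_{k+1}=a_{k+1}q_k+q_{k-1}$ and $p_0=0$, $p_1=1$, $p_{k+1}=a_{k+1}p_k+p_{k-1}$); put $\theta_k=q_k\theta-p_k$. Let $\xi$ be one of the two Sturmian numbers $$\xi_b(\theta,\rho)=(b-1)\sum_{n\ge1}\frac{\lfloor n\theta+\rho\rfloor-\lfloor (n-1)\theta+\rho\rfloor}{b^n},\qquad \xi'_b(\theta,\rho)=(b-1)\sum_{n\ge1}\frac{\lceil n\theta+\rho\rceil-\lceil (n-1)\theta+\rho\rceil}{b^n}.$$ Let $(b_k)_{k\ge1}$ be the following sequence of digits attached to $\xi$. * If $\rho-\theta$ is not of the form $-m\theta+p$ with integers $m\ge1$ and $p$, then $\rho-\theta=\sum_{k\ge1}b_k\theta_{k-1}$ is the Ostrowski expansion of $\rho-\theta$: $0\le b_1\le a_1-1$, $0\le b_k\le a_k$ for $k\ge2$, $b_k=0$ whenever $b_{k+1}=a_{k+1}$,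 and $b_k<a_k$ for infinitely many odd and infinitely many even $k$. * If $\rho-\theta=-m\theta+p$ with $m\ge2$, let $l\ge 0$ be such that $q_l<m\le q_{l+1}$ and let $q_{l+1}-m=\delta_1q_0+\cdots+\delta_{l+1}q_l$ be the Ostrowski expansion of this integer ($0\le\delta_1\le a_1-1$, $0\le\delta_j\le a_j$, and $\delta_j=0$ whenever $\delta_{j+1}=a_{j+1}$). For $\xi=\xi_b(\theta,\rho)$ with $l$ odd and for $\xi=\xi_b'(\theta,\rho)$ with $l$ even, $(b_k)$ is $\delta_1,\dots,\delta_{l+1},0,a_{l+3},0,a_{l+5},\dots$; in the two other cases it is $\delta_1,\dots,\delta_l,\delta_{l+1}+1,a_{l+2}-1,0,a_{l+4},0,a_{l+6},\dots$. * If $\rho=0$, then $(b_k)$ is $0,a_2,0,a_4,\dots$ for $\xi_b(\theta,0)$ and $a_1-1,0,a_3,0,a_5,\dots$ for $\xi'_b(\theta,0)$. Put $t_k=b_1q_0+b_2q_1+\cdots+b_kq_{k-1}$ and $r_k=q_k-t_k$. Over the alphabet $\{0,b-1\}$ define the words $M_0=V_0=0$, $M_1=0^{a_1-1}(b-1)$,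 $V_1=0^{a_1-b_1-1}(b-1)0^{b_1}$ and, for $k\ge1$, $$M_{k+1}=M_k^{a_{k+1}}M_{k-1},\qquad V_{k+1}=V_k^{a_{k+1}-b_{k+1}}V_{k-1}V_k^{b_{k+1}}.$$ Let $T_k$ (resp. $R_k$) be the prefix of length $t_k$ (resp. the suffix of length $r_k$) of $M_k$. A word is identified with the integer of which it is the base-$b$ expansion. For $k\ge0$ put $$(1)_k=\frac{R_{k+1}-R_k}{b^{r_k}(b^{r_{k+1}-r_k}-1)},\quad (2)_k=\frac{R_{k+1}T_k}{b^{r_{k+1}+t_k}-1},\quad (3)_k=\frac{R_{k+1}M_k-R_{k+1}}{b^{r_{k+1}}(b^{q_k}-1)},\quad (4)_k=\frac{V_{k+1}}{b^{q_{k+1}}-1},$$ where $(1)_k$ is considered only when $r_{k+1}>r_k$ (otherwise it is undefined, and not a convergent), together with $h_k(1)=r_{k+1}$, $h_k(2)=r_{k+1}+t_k$, $h_k(3)=r_{k+1}+q_k$, $h_k(4)=q_{k+1}$, and $$\nu_k(1)=1+\frac{r_{k+1}+t_k}{r_{k+1}},\quad \nu_k(2)=1+\frac{r_{k+1}+q_k}{r_{k+1}+t_k},\quad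 \nu_k(3)=1+\frac{q_{k+1}}{r_{k+1}+q_k},\quad \nu_k(4)=1+\frac{r_{k+2}}{q_{k+1}}.$$ Write $H(P/Q)=\max(|P|,Q)$ for the height of a rational number $P/Q$ in lowest terms. Below, "$\mu_k(j)=\mu$" means that $$c\,b^{h_k(j)}\le H((j)_k)\le C\,b^{h_k(j)}\qquad\text{and}\qquad c\,b^{-h_k(j)\mu}\le|\xi-(j)_k|\le C\,b^{-h_k(j)\mu},$$ where $c,C$ are positive constants that do not depend on $k$. **Proposition 6.1.** There are constants $c,C>0$, independent of $k$, such that for every integer $k\ge2$ with $t_{k-1}>0$ the following hold. * $(1)_k$ is a convergent to $\xi$ if and only if * $a_{k+1}-b_{k+1}\ge1$ and $a_{k+2}-b_{k+2}\ge1$, and then $\mu_k(1)=\nu_k(1)$; or * $b_k\ge1$, $a_{k+1}=1$, $b_{k+1}=0$ and $a_{k+2}=b_{k+2}$, and then $\mu_k(1)=\nu_{k-1}(3)$. * $(2)_k$ is a convergent to $\xi$ if and only if $a_{k+2}-b_{k+2}\ge1$, and then * $\mu_k(2)=\nu_k(2)$ if $b_{k+1}\ge1$; * $\mu_k(2)=\nu_k(4)$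 if $b_{k+1}=0$ and $a_{k+3}-b_{k+3}\ge1$; * $\mu_k(2)=\nu_{k+2}(2)$ if $b_{k+1}=0$ and $a_{k+3}=b_{k+3}$. * $(3)_k$ is a convergent to $\xi$ if and only if * $b_{k+1}\ge1$ and $a_{k+2}-b_{k+2}\ge2$, and then $\mu_k(3)=\nu_k(3)$; or * $a_{k+2}-b_{k+2}=1$ and $a_{k+3}-b_{k+3}\ge1$, and then $\mu_k(3)=\nu_{k+1}(1)$; or * $b_{k+1}\ge1$, $a_{k+2}=1$, $b_{k+2}=0$ and $a_{k+3}=b_{k+3}$, and then $\mu_k(3)=\nu_k(3)$. * $(4)_k$ is a convergent to $\xi$ if and only if * $a_{k+2}-b_{k+2}\ge2$ and $a_{k+3}-b_{k+3}\ge1$, and then $\mu_k(4)=\nu_k(4)$; or * $b_{k+1}=0$, $a_{k+2}-b_{k+2}=1$ and $a_{k+3}-b_{k+3}\ge1$, and then $\mu_k(4)=\nu_k(2)=\nu_k(4)$; or * $a_{k+3}=b_{k+3}$, and then $\mu_k(4)=\nu_{k+2}(2)=1+\nu_k(4)$. -/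

import Mathlib

namespace Sturmian

noncomputable section

/-! ### Slope: partial quotients and convergents -/

/-- The partial quotient `a_k` of `θ = [0; a_1, a_2, …]`, for `k ≥ 1` (the value at `0` is unused). -/
def partialQuotient (θ : ℝ) : ℕ → ℕ
  | 0 => 0
  | k + 1 => ⌊((GenContFract.of θ).partDens.get? k).getD 0⌋₊

/-- The denominators `q_k`: `q_0 = 1`, `q_1 = a_1`, `q_{k+2} = a_{k+2} q_{k+1} + q_k`. -/
def q (a : ℕ → ℕ) : ℕ → ℕ
  | 0 => 1
  | 1 => a 1
  | k + 2 => a (k + 2) * q a (k + 1) + q a k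

/-- The numerators `p_k`: `p_0 = 0`, `p_1 = 1`, `p_{k+2} = a_{k+2} p_{k+1} + p_k`. -/
def p (a : ℕ → ℕ) : ℕ → ℕ
  | 0 => 0
  | 1 => 1
  | k + 2 => a (k + 2) * p a (k + 1) + p a k

/-- `θ_k = q_k θ - p_k`. -/
def thetaDiff (a : ℕ → ℕ) (θ : ℝ) (k : ℕ) : ℝ := (q a k : ℝ) * θ - (p a k : ℝ)

/-! ### Sturmian words and Sturmian numbers -/

/-- Lower Sturmian words are built with the floor, upper ones with the ceiling. -/
inductive Side where
  | lower
  | upper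

/-- The rounding function attached to a side. -/
def Side.round : Side → ℝ → ℤ
  | .lower, x => ⌊x⌋
  | .upper, x => ⌈x⌉

/-- The `n`-th letter `s_n` (lower) or `s'_n` (upper) of the Sturmian word of slope `θ` and
intercept `ρ`, for `n ≥ 1`. -/
def letter (s : Side) (θ ρ : ℝ) (n : ℕ) : ℤ :=
  s.round ((n : ℝ) * θ + ρ) - s.round (((n : ℝ) - 1) * θ + ρ)

/-- `ξ_b(θ, ρ) = (b - 1) ∑_{n ≥ 1} s_n / b^n`, and its analogue for `s'_n`. -/
def sturmianNumber (b : ℕ) (s : Side) (θ ρ : ℝ) : ℝ :=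
  ((b : ℝ) - 1) * ∑' n : ℕ, (letter s θ ρ (n + 1) : ℝ) / (b : ℝ) ^ (n + 1)

/-! ### Ostrowski expansions -/

/-- The Ostrowski numeration rules for a sequence of digits `β_1, β_2, …`. -/
def OstrowskiRules (a β : ℕ → ℕ) : Prop :=
  β 1 < a 1 ∧ (∀ k, 2 ≤ k → β k ≤ a k) ∧ (∀ k, 1 ≤ k → β (k + 1) = a (k + 1) → β k = 0)

/-- `σ = ∑_{k ≥ 1} β_k θ_{k-1}` is the Ostrowski expansion of `σ` in base `θ`: the numeration rules
hold, and `β_k < a_k` for infinitely many odd and for infinitely many even `k`. -/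
def IsOstrowskiExpansion (a : ℕ → ℕ) (θ σ : ℝ) (β : ℕ → ℕ) : Prop :=
  OstrowskiRules a β ∧
  HasSum (fun k : ℕ => (β (k + 1) : ℝ) * thetaDiff a θ k) σ ∧
  (∀ N : ℕ, ∃ k, N ≤ k ∧ Odd k ∧ β k < a k) ∧
  (∀ N : ℕ, ∃ k, N ≤ k ∧ Even k ∧ β k < a k)

/-- `N = δ_1 q_0 + ⋯ + δ_{l+1} q_l` is the Ostrowski expansion of the natural number `N`
(with leading zeros allowed). -/
def IsOstrowskiNat (a : ℕ → ℕ) (l N : ℕ) (δ : ℕ → ℕ) : Prop :=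
  δ 1 < a 1 ∧ (∀ j, 2 ≤ j → j ≤ l + 1 → δ j ≤ a j) ∧
  (∀ j, 1 ≤ j → j ≤ l → δ (j + 1) = a (j + 1) → δ j = 0) ∧
  N = ∑ j ∈ Finset.range (l + 1), δ (j + 1) * q a j

/-- The digits `δ_1, …, δ_{l+1}, 0, a_{l+3}, 0, a_{l+5}, …`. -/
def tailDigits (a δ : ℕ → ℕ) (l k : ℕ) : ℕ :=
  if k ≤ l + 1 then δ k else if Odd (k - l) then a k else 0

/-- The digits `δ_1, …, δ_l, δ_{l+1} + 1, a_{l+2} - 1, 0, a_{l+4}, 0, a_{l+6}, …`. -/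
def tailDigits' (a δ : ℕ → ℕ) (l k : ℕ) : ℕ :=
  if k ≤ l then δ k
  else if k = l + 1 then δ (l + 1) + 1
  else if k = l + 2 then a (l + 2) - 1
  else if Even (k - l) then a k else 0

/-- The digits `a_1 - 1, 0, a_3, 0, a_5, …`. -/
def zeroDigits (a : ℕ → ℕ) (k : ℕ) : ℕ :=
  if k = 1 then a 1 - 1 else if Odd k then a k else 0

/-- The digits `0, a_2, 0, a_4, …`. -/
def zeroDigits' (a : ℕ → ℕ) (k : ℕ) : ℕ :=
  if Even k then a k else 0

/-- `β_1, β_2, …` is the sequence of digits attached to the lower or upper Sturmian word of slope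
`θ` and intercept `ρ`.

* If `ρ - θ` is not of the form `-mθ + p` with integers `m ≥ 1` and `p` (that is, `ρ ∉ ℤθ + ℤ` or
  `ρ ∈ ℤ_{≥1}θ + ℤ`), it is the Ostrowski expansion of `ρ - θ`.
* If `ρ - θ = -mθ + p` with `m ≥ 2`, let `q_l < m ≤ q_{l+1}` and let `δ` be the digits of the
  integer `q_{l+1} - m`; the first of the two sequences built on `δ` is used for the lower word when
  `l` is odd and for the upper word when `l` is even, and the second one otherwise.
* If `ρ = 0` (that is, `m = 1`), the lower word has digits `0, a_2, 0, a_4, …` and the upper word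
  has digits `a_1 - 1, 0, a_3, 0, …`. -/
def IsInterceptDigits (a : ℕ → ℕ) (s : Side) (θ ρ : ℝ) (β : ℕ → ℕ) : Prop :=
  ((¬ ∃ (m : ℕ) (z : ℤ), 1 ≤ m ∧ ρ - θ = -(m : ℝ) * θ + (z : ℝ)) ∧
    IsOstrowskiExpansion a θ (ρ - θ) β) ∨
  (∃ (m : ℕ) (z : ℤ) (l : ℕ) (δ : ℕ → ℕ), 2 ≤ m ∧ ρ - θ = -(m : ℝ) * θ + (z : ℝ) ∧
    q a l < m ∧ m ≤ q a (l + 1) ∧ IsOstrowskiNat a l (q a (l + 1) - m) δ ∧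
    ((((s = Side.lower ∧ Odd l) ∨ (s = Side.upper ∧ Even l)) ∧
        ∀ k, 1 ≤ k → β k = tailDigits a δ l k) ∨
     (((s = Side.lower ∧ Even l) ∨ (s = Side.upper ∧ Odd l)) ∧
        ∀ k, 1 ≤ k → β k = tailDigits' a δ l k))) ∨
  (ρ = 0 ∧
    ((s = Side.lower ∧ ∀ k, 1 ≤ k → β k = zeroDigits' a k) ∨
     (s = Side.upper ∧ ∀ k, 1 ≤ k → β k = zeroDigits a k)))

/-! ### The finite words, over the alphabet `{0, b - 1}` -/

/-- The concatenation of `n` copies of the word `W`. -/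
def wordPow (W : List ℕ) (n : ℕ) : List ℕ := (List.replicate n W).flatten

/-- `M_0 = 0`, `M_1 = 0^{a_1 - 1} (b-1)`, `M_{k+2} = M_{k+1}^{a_{k+2}} M_k`. -/
def M (b : ℕ) (a : ℕ → ℕ) : ℕ → List ℕ
  | 0 => [0]
  | 1 => List.replicate (a 1 - 1) 0 ++ [b - 1]
  | k + 2 => wordPow (M b a (k + 1)) (a (k + 2)) ++ M b a k

/-- `V_0 = 0`, `V_1 = 0^{a_1 - β_1 - 1} (b-1) 0^{β_1}`,
`V_{k+2} = V_{k+1}^{a_{k+2} - β_{k+2}} V_k V_{k+1}^{β_{k+2}}`. -/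
def V (b : ℕ) (a β : ℕ → ℕ) : ℕ → List ℕ
  | 0 => [0]
  | 1 => List.replicate (a 1 - β 1 - 1) 0 ++ [b - 1] ++ List.replicate (β 1) 0
  | k + 2 => wordPow (V b a β (k + 1)) (a (k + 2) - β (k + 2)) ++ V b a β k ++
      wordPow (V b a β (k + 1)) (β (k + 2))

/-- `t_k = β_1 q_0 + β_2 q_1 + ⋯ + β_k q_{k-1}` (so `t_0 = 0`). -/
def t (a β : ℕ → ℕ) (k : ℕ) : ℕ := ∑ j ∈ Finset.range k, β (j + 1) * q a j

/-- `r_k = q_k - t_k`; the Ostrowski rules ensure `t_k < q_k`. -/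
def r (a β : ℕ → ℕ) (k : ℕ) : ℕ := q a k - t a β k

/-- `T_k` is the prefix of length `t_k` of `M_k`. -/
def T (b : ℕ) (a β : ℕ → ℕ) (k : ℕ) : List ℕ := (M b a k).take (t a β k)

/-- `R_k` is the suffix of length `r_k` of `M_k`: `M_k = T_k R_k`. -/
def R (b : ℕ) (a β : ℕ → ℕ) (k : ℕ) : List ℕ := (M b a k).drop (t a β k)

/-- The natural number whose sequence of `b`-ary digits, most significant first, is `W`. -/
def wordValue (b : ℕ) (W : List ℕ) : ℕ := Nat.ofDigits b W.reverse

/-! ### The four families of rational numbers -/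

/-- `(1)_k = (R_{k+1} - R_k) / (b^{r_k} (b^{r_{k+1} - r_k} - 1))`, meaningful when
`r_k < r_{k+1}`. -/
def frac1 (b : ℕ) (a β : ℕ → ℕ) (k : ℕ) : ℚ :=
  ((wordValue b (R b a β (k + 1)) : ℚ) - (wordValue b (R b a β k) : ℚ)) /
    ((b : ℚ) ^ r a β k * ((b : ℚ) ^ (r a β (k + 1) - r a β k) - 1))

/-- `(2)_k = R_{k+1} T_k / (b^{r_{k+1} + t_k} - 1)`. -/
def frac2 (b : ℕ) (a β : ℕ → ℕ) (k : ℕ) : ℚ :=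
  (wordValue b (R b a β (k + 1) ++ T b a β k) : ℚ) /
    ((b : ℚ) ^ (r a β (k + 1) + t a β k) - 1)

/-- `(3)_k = (R_{k+1} M_k - R_{k+1}) / (b^{r_{k+1}} (b^{q_k} - 1))`. -/
def frac3 (b : ℕ) (a β : ℕ → ℕ) (k : ℕ) : ℚ :=
  ((wordValue b (R b a β (k + 1) ++ M b a k) : ℚ) - (wordValue b (R b a β (k + 1)) : ℚ)) /
    ((b : ℚ) ^ r a β (k + 1) * ((b : ℚ) ^ q a k - 1))

/-- `(4)_k = V_{k+1} / (b^{q_{k+1}} - 1)`. -/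
def frac4 (b : ℕ) (a β : ℕ → ℕ) (k : ℕ) : ℚ :=
  (wordValue b (V b a β (k + 1)) : ℚ) / ((b : ℚ) ^ q a (k + 1) - 1)

/-! ### The exponents -/

/-- `ν_k(1) = 1 + (r_{k+1} + t_k) / r_{k+1}`. -/
def nu1 (a β : ℕ → ℕ) (k : ℕ) : ℝ :=
  1 + ((r a β (k + 1) : ℝ) + (t a β k : ℝ)) / (r a β (k + 1) : ℝ)

/-- `ν_k(2) = 1 + (r_{k+1} + q_k) / (r_{k+1} + t_k)`. -/
def nu2 (a β : ℕ → ℕ) (k : ℕ) : ℝ :=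
  1 + ((r a β (k + 1) : ℝ) + (q a k : ℝ)) / ((r a β (k + 1) : ℝ) + (t a β k : ℝ))

/-- `ν_k(3) = 1 + q_{k+1} / (r_{k+1} + q_k)`. -/
def nu3 (a β : ℕ → ℕ) (k : ℕ) : ℝ :=
  1 + (q a (k + 1) : ℝ) / ((r a β (k + 1) : ℝ) + (q a k : ℝ))

/-- `ν_k(4) = 1 + r_{k+2} / q_{k+1}`. -/
def nu4 (a β : ℕ → ℕ) (k : ℕ) : ℝ :=
  1 + (r a β (k + 2) : ℝ) / (q a (k + 1) : ℝ)

/-- The rational `x` is a convergent of the (regular) continued fraction expansion of `ξ`. -/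
def IsConvergent (ξ : ℝ) (x : ℚ) : Prop := ∃ n : ℕ, x = ξ.convergent n

/-- The height `max(|P|, Q)` of a rational number `P/Q` written in lowest terms. -/
def height (x : ℚ) : ℕ := max x.num.natAbs x.den

/-- `x` has height of order `b^h`, and approximates `ξ` to the exact order `(b^h)^{-μ}`; both up to
the constants `c` and `C`. -/
def HasExponent (c C : ℝ) (b : ℕ) (ξ : ℝ) (x : ℚ) (h : ℕ) (μ : ℝ) : Prop :=
  (c * (b : ℝ) ^ h ≤ (height x : ℝ) ∧ (height x : ℝ) ≤ C * (b : ℝ) ^ h) ∧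
  (c * (b : ℝ) ^ (-((h : ℝ) * μ)) ≤ |ξ - (x : ℝ)| ∧
    |ξ - (x : ℝ)| ≤ C * (b : ℝ) ^ (-((h : ℝ) * μ)))

end

end Sturmian

/-!
A word `W` over `{0, b - 1}` is encoded by the integral vector `vec b W` whose coordinates are its
value divided by `b - 1` and the repunit `1 + b + ⋯ + b^(|W|-1)`. Since
`vec (U W) = b^|W| • vec U + vec W`, identities between words become linear relations between
vectors. The four families of rationals are quotients of the coordinates of such vectors, and
`V_k = R_k T_k`, `M_k = T_k R_k` together with the recursions for `T_k` and `R_k` express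
`(2)_{k+1}`, `(3)_{k+1}` and `(4)_{k+1}` as nonnegative combinations of `(4)_k` and `(1)_{k+1}`, and
`(1)_{k+1}` as a nonnegative combination of `(4)_k` and `(3)_k` when `b_{k+2} < a_{k+2}`
(`vec2_eq`, `vec3_eq`, `vec4_eq`, `vec1_succ_eq`). When `b_{k+3} = a_{k+3}`, the index jumps by two
(`vec2_of_eq`, `vec3_of_eq`). The vectors of `(4)_k` and `(3)_k` form a basis of `ℤ²`
(`det_vec4_vec3`).

The link with `ξ` is that `M_k` is a prefix of the characteristic word of slope `θ`
(`M_eq_map_charDigit`), so that `R_k` begins like the Sturmian word whose intercept is congruent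
modulo `1` to `(t_k + 1) θ`. The definition of the digits makes these intercepts tend to `ρ` along
suitable `k`, from the correct side in the case where some `n θ + ρ` is an integer, so that `ξ` is
the limit of the rationals `0.R_k`, hence of the rationals `(3)_k`, along these `k`. By the
relations above, these rationals all lie in the cone spanned by `(4)_k` and `(3)_k`, provided that
`b_{k+2} < a_{k+2}`. Therefore `ξ` lies between `(3)_k` and `(4)_k` (`position`).

From then on everything is linear algebra. With `L(P, Q) = Qξ - P`, the relations between the
vectors are relations between the values of `L`, whose signs are known from `position`; as the
determinants are `±1`, the sizes of the values are determined by the denominators up to bounded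
factors, which gives the exponents (`Setting.hasExponent`). Finally, a vector `v` is a convergent
when it belongs to a basis `v, w` of `ℤ²` with `L(v)` and `L(w)` of opposite signs and
`|L(v)| < |L(w)|` (`isConvergent_of_unimodular`), and it is not one when a vector of smaller
denominator does at least as well (`not_isConvergent_of_abs_lin_le`). In each case of the theorem
one of these criteria applies to two members of the four families.
-/

namespace Sturmian

noncomputable section

/-! ### Convergents and unimodular pairs -/

/-- If `ξ = (ζ P + P') / (ζ Q + Q')` with `ζ > 1`, a determinant `±1` and `0 ≤ Q' ≤ Q`, then `P / Q` is a
convergent to `ξ`. The induction on a bound `n` for `Q` is the Euclidean algorithm: removing the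
integer part of `ξ` and inverting exchanges numerators and denominators. -/
theorem exists_eq_convergent_of_unimodular_aux (n : ℕ) : ∀ (ξ : ℝ) (P Q P' Q' : ℤ) (ζ : ℝ),
    Q.toNat ≤ n → 1 ≤ Q → Q' ≤ Q → (1 ≤ Q' ∨ (Q' = 0 ∧ P' = 1)) →
    (P * Q' - P' * Q = 1 ∨ P * Q' - P' * Q = -1) → 1 < ζ →
    (ζ * Q + Q') * ξ = ζ * P + P' → ∃ m : ℕ, ((P : ℚ) / (Q : ℚ)) = ξ.convergent m := by
  induction n with
  | zero => intro ξ P Q P' Q' ζ h1 h2; omega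
  | succ n ih =>
    intro ξ P Q P' Q' ζ hn hQ hle hQ' hdet hζ heq
    rcases eq_or_lt_of_le hQ with hQ1 | hQ2
    · subst hQ1
      have hcase : (Q' = 0 ∧ P' = 1) ∨ (Q' = 1 ∧ P' = P + 1) ∨ (Q' = 1 ∧ P' = P - 1) := by
        rcases hQ' with h | h
        · have : Q' = 1 := le_antisymm hle h
          subst this
          rcases hdet with h | h
          · right; right; exact ⟨rfl, by linarith⟩
          · right; left; exact ⟨rfl, by linarith⟩
        · exact Or.inl h
      rcases hcase with ⟨rfl, rfl⟩ | ⟨rfl, rfl⟩ | ⟨rfl, rfl⟩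
      · refine ⟨0, ?_⟩
        have hfl : ⌊ξ⌋ = P := by
          rw [Int.floor_eq_iff]
          push_cast at heq
          have : ζ * (ξ - P) = 1 := by linarith
          constructor <;> nlinarith
        rw [Real.convergent_zero, hfl]; simp
      · refine ⟨0, ?_⟩
        have hfl : ⌊ξ⌋ = P := by
          rw [Int.floor_eq_iff]
          push_cast at heq
          have : (ζ + 1) * (ξ - P) = 1 := by linarith
          constructor <;> nlinarith
        rw [Real.convergent_zero, hfl]; simp
      · refine ⟨1, ?_⟩
        push_cast at heq
        have h1 : (ζ + 1) * (P - ξ) = 1 := by linarith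
        have hpos : 0 < ζ + 1 := by linarith
        have hfl : ⌊ξ⌋ = P - 1 := by
          rw [Int.floor_eq_iff]
          push_cast
          constructor <;> nlinarith
        have hfr : (Int.fract ξ)⁻¹ = (ζ + 1) / ζ := by
          have : Int.fract ξ = ζ / (ζ + 1) := by
            rw [Int.fract, hfl, eq_div_iff hpos.ne']; push_cast; linarith
          rw [this, inv_div]
        have hfl2 : ⌊(Int.fract ξ)⁻¹⌋ = 1 := by
          rw [hfr, Int.floor_eq_iff, le_div_iff₀ (by linarith), div_lt_iff₀ (by linarith)]
          push_cast
          constructor <;> linarith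
        rw [Real.convergent_succ, Real.convergent_zero, hfl, hfl2]; simp
    · have hQ'1 : 1 ≤ Q' := by
        rcases hQ' with h | ⟨rfl, rfl⟩
        · exact h
        · rcases hdet with h | h <;> linarith
      have hlt : Q' < Q := by
        rcases eq_or_lt_of_le hle with h | h
        · subst h
          have : Q' ∣ 1 := by
            rcases hdet with h | h
            · exact ⟨P - P', by linarith⟩
            · exact ⟨P' - P, by linarith⟩
          have := Int.le_of_dvd one_pos this
          omega
        · exact h
      obtain ⟨m, P1, hP, hP10, hP1Q⟩ : ∃ m P1 : ℤ, P = m * Q + P1 ∧ 0 ≤ P1 ∧ P1 < Q :=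
        ⟨P / Q, P % Q, by rw [mul_comm]; exact (Int.mul_ediv_add_emod P Q).symm,
          Int.emod_nonneg _ (by omega), Int.emod_lt_of_pos _ (by omega)⟩
      obtain ⟨P1', hP'⟩ : ∃ P1' : ℤ, P' = m * Q' + P1' := ⟨P' - m * Q', by ring⟩
      have hdet1 : P1 * Q' - P1' * Q = 1 ∨ P1 * Q' - P1' * Q = -1 := by
        have : P * Q' - P' * Q = P1 * Q' - P1' * Q := by rw [hP, hP']; ring
        rwa [this] at hdet
      have hP11 : 1 ≤ P1 := by
        by_contra h
        have h0 : P1 = 0 := by omega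
        rw [h0] at hdet1
        have : Q ∣ 1 := by
          rcases hdet1 with h | h
          · exact ⟨-P1', by linarith⟩
          · exact ⟨P1', by linarith⟩
        have := Int.le_of_dvd one_pos this
        omega
      have hb : -1 ≤ P1 * Q' - P1' * Q ∧ P1 * Q' - P1' * Q ≤ 1 := by
        rcases hdet1 with h | h <;> omega
      have hP1'0 : 0 ≤ P1' := by
        by_contra h
        have : P1' ≤ -1 := by omega
        nlinarith
      have hP1'P1 : P1' ≤ P1 := by
        by_contra h
        have h2 : P1 + 1 ≤ P1' := by omega
        have h3 : (P1 + 1) * Q ≤ P1' * Q := mul_le_mul_of_nonneg_right h2 (by omega)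
        have h4 : P1 * Q' ≤ P1 * (Q - 1) := mul_le_mul_of_nonneg_left (by omega) hP10
        nlinarith
      have hP1'Q' : P1' ≤ Q' := by
        by_contra h
        have h2 : Q' + 1 ≤ P1' := by omega
        have h3 : (Q' + 1) * Q ≤ P1' * Q := mul_le_mul_of_nonneg_right h2 (by omega)
        have h4 : P1 * Q' ≤ (Q - 1) * Q' := mul_le_mul_of_nonneg_right (by omega) (by omega)
        nlinarith
      have cQ' : (1 : ℝ) ≤ Q' := by exact_mod_cast hQ'1
      have cQ : (2 : ℝ) ≤ Q := by exact_mod_cast hQ2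
      have cP1 : (1 : ℝ) ≤ P1 := by exact_mod_cast hP11
      have cP1Q : (P1 : ℝ) < Q := by exact_mod_cast hP1Q
      have cP1' : (0 : ℝ) ≤ P1' := by exact_mod_cast hP1'0
      have cP1'Q' : (P1' : ℝ) ≤ Q' := by exact_mod_cast hP1'Q'
      have hD : 0 < ζ * Q + Q' := by nlinarith
      have hN : 0 < ζ * P1 + P1' := by nlinarith
      have hlin : (ζ * Q + Q') * (ξ - m) = ζ * P1 + P1' := by
        rw [hP, hP'] at heq; push_cast at heq; linarith
      have hNm : ξ - m = (ζ * P1 + P1') / (ζ * Q + Q') := by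
        rw [eq_div_iff hD.ne']; linarith
      have hfl : ⌊ξ⌋ = m := by
        rw [Int.floor_eq_iff]
        have h0 : 0 < ξ - m := by rw [hNm]; positivity
        have h1 : ξ - m < 1 := by rw [hNm, div_lt_one hD]; nlinarith
        constructor <;> linarith
      have hfr : (Int.fract ξ)⁻¹ = (ζ * Q + Q') / (ζ * P1 + P1') := by
        rw [Int.fract, hfl, hNm, inv_div]
      obtain ⟨j, hj⟩ := ih (Int.fract ξ)⁻¹ Q P1 Q' P1' ζ (by omega) hP11 hP1'P1
        (by
          rcases eq_or_lt_of_le hP1'0 with h | h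
          · right
            refine ⟨h.symm, ?_⟩
            rw [← h] at hb
            nlinarith
          · exact Or.inl h)
        (by rcases hdet1 with h | h
            · right; linarith
            · left; linarith) hζ
        (by rw [hfr]; field_simp)
      refine ⟨j + 1, ?_⟩
      rw [Real.convergent_succ, ← hj, hfl, hP, inv_div]
      have : (Q : ℚ) ≠ 0 := by exact_mod_cast (by omega : Q ≠ 0)
      push_cast
      field_simp

/-- The linear form `(P, Q) ↦ Q ξ - P`, whose size measures how well `P / Q` approximates `ξ`. -/
def lin (ξ : ℝ) (v : ℤ × ℤ) : ℝ := (v.2 : ℝ) * ξ - (v.1 : ℝ)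

theorem lin_add (ξ : ℝ) (v w : ℤ × ℤ) : lin ξ (v + w) = lin ξ v + lin ξ w := by
  simp only [lin, Prod.fst_add, Prod.snd_add]; push_cast; ring

theorem lin_sub (ξ : ℝ) (v w : ℤ × ℤ) : lin ξ (v - w) = lin ξ v - lin ξ w := by
  simp only [lin, Prod.fst_sub, Prod.snd_sub]; push_cast; ring

theorem lin_smul (ξ : ℝ) (n : ℤ) (v : ℤ × ℤ) : lin ξ (n • v) = n * lin ξ v := by
  simp only [lin, Prod.smul_fst, Prod.smul_snd, smul_eq_mul]; push_cast; ring

/-- The determinant of two integral vectors. -/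
def det (v w : ℤ × ℤ) : ℤ := v.1 * w.2 - v.2 * w.1

/-- The elimination of `ξ` between two linear forms. -/
theorem det_smul_eq (ξ : ℝ) (v w : ℤ × ℤ) :
    (w.2 : ℝ) * lin ξ v - v.2 * lin ξ w = -(det v w : ℝ) := by
  simp only [lin, det]; push_cast; ring

/-- The rational number with numerator `v.1` and denominator `v.2`. -/
def toRat (v : ℤ × ℤ) : ℚ := (v.1 : ℚ) / (v.2 : ℚ)

/-- A converse of the classical description of convergents: if `v, w` is a basis of `ℤ²` for which
`lin ξ v` and `lin ξ w` have opposite signs and `lin ξ v` is the smaller one, then `v` is a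
convergent. No order between the denominators is needed, because subtracting multiples of `v` from
`w` only increases `|lin ξ w|`. -/
theorem isConvergent_of_unimodular {ξ : ℝ} {v w : ℤ × ℤ} (hv : 2 ≤ v.2) (hw : 0 ≤ w.2)
    (hdet : |det v w| = 1) (hneg : lin ξ v * lin ξ w < 0) (hlt : |lin ξ v| < |lin ξ w|) :
    IsConvergent ξ (toRat v) := by
  obtain ⟨P, Q⟩ := v
  obtain ⟨P', Q'⟩ := w
  simp only at hv hw
  obtain ⟨j, Q0, hQ', hj, hQ0, hQ0Q⟩ : ∃ j Q0 : ℤ, Q' = j * Q + Q0 ∧ 0 ≤ j ∧ 0 ≤ Q0 ∧ Q0 < Q :=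
    ⟨Q' / Q, Q' % Q, by rw [mul_comm]; exact (Int.mul_ediv_add_emod Q' Q).symm,
      Int.ediv_nonneg hw (by omega), Int.emod_nonneg _ (by omega), Int.emod_lt_of_pos _ (by omega)⟩
  obtain ⟨P0, hP'⟩ : ∃ P0 : ℤ, P' = j * P + P0 := ⟨P' - j * P, by ring⟩
  have hdet0 : P * Q0 - P0 * Q = 1 ∨ P * Q0 - P0 * Q = -1 := by
    have : det (P, Q) (P', Q') = P * Q0 - P0 * Q := by simp only [det]; rw [hQ', hP']; ring
    rw [this] at hdet
    exact (abs_eq (by norm_num)).1 hdet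
  have hQ01 : 1 ≤ Q0 := by
    by_contra h
    have h0 : Q0 = 0 := by omega
    rw [h0] at hdet0
    have : Q ∣ 1 := by
      rcases hdet0 with h | h
      · exact ⟨-P0, by linarith⟩
      · exact ⟨P0, by linarith⟩
    have := Int.le_of_dvd one_pos this
    omega
  have hL : lin ξ (P', Q') = j * lin ξ (P, Q) + lin ξ (P0, Q0) := by
    simp only [lin]; rw [hQ', hP']; push_cast; ring
  have cj : (0 : ℝ) ≤ j := by exact_mod_cast hj
  set x := lin ξ (P, Q) with hx
  set y := lin ξ (P', Q') with hy
  set z := lin ξ (P0, Q0) with hz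
  have hx0 : x ≠ 0 := by rintro h; rw [h] at hneg; simp at hneg
  have hζ : 1 < -z / x := by
    rcases lt_or_gt_of_ne hx0 with h | h
    · have hy0 : 0 < y := by nlinarith
      rw [abs_of_neg h, abs_of_pos hy0] at hlt
      rw [lt_div_iff_of_neg h]; nlinarith
    · have hy0 : y < 0 := by nlinarith
      rw [abs_of_pos h, abs_of_neg hy0] at hlt
      rw [lt_div_iff₀ h]; nlinarith
  obtain ⟨m, hm⟩ := exists_eq_convergent_of_unimodular_aux Q.toNat ξ P Q P0 Q0 (-z / x) le_rfl
    (by omega) hQ0Q.le (Or.inl hQ01) hdet0 hζ (by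
      have h1 : -z / x * x = -z := div_mul_cancel₀ _ hx0
      have h2 : (Q : ℝ) * ξ = x + P := by rw [hx]; simp [lin]
      have h3 : (Q0 : ℝ) * ξ = z + P0 := by rw [hz]; simp [lin]
      calc (-z / x * Q + Q0) * ξ = -z / x * (Q * ξ) + Q0 * ξ := by ring
        _ = -z / x * x + -z / x * P + (z + P0) := by rw [h2, h3]; ring
        _ = _ := by rw [h1]; ring)
  exact ⟨m, hm⟩

/-- A vector whose denominator is smaller than that of one member of a basis of `ℤ²` is no better
an approximation than the other member, when the two members lie on opposite sides of `ξ`. -/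
theorem abs_lin_le_of_unimodular {ξ : ℝ} {v w x : ℤ × ℤ} (hv : 0 ≤ v.2) (hw : 0 ≤ w.2)
    (hdet : |det v w| = 1) (hneg : lin ξ v * lin ξ w ≤ 0) (hx : 0 < x.2) (hxv : x.2 < v.2) :
    |lin ξ w| ≤ |lin ξ x| := by
  obtain ⟨i, j, rfl⟩ : ∃ i j : ℤ, x = i • v + j • w := by
    rcases (abs_eq (by norm_num)).1 hdet with h | h
    · refine ⟨det x w, det v x, ?_⟩
      simp only [det] at h ⊢
      ext
      · simp; linear_combination (-x.1) * h
      · simp; linear_combination (-x.2) * h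
    · refine ⟨-det x w, -det v x, ?_⟩
      simp only [det] at h ⊢
      ext
      · simp; linear_combination (x.1) * h
      · simp; linear_combination (x.2) * h
  simp only [Prod.snd_add, Prod.smul_snd, smul_eq_mul] at hx hxv
  rw [lin_add, lin_smul, lin_smul]
  have hj0 : j ≠ 0 := by
    rintro rfl
    rcases le_or_gt i 0 with h | h <;> nlinarith
  have hij : i * j ≤ 0 := by
    by_contra h
    push Not at h
    rcases lt_or_gt_of_ne hj0 with hj | hj
    · have : i < 0 := by nlinarith
      nlinarith
    · have : 1 ≤ i := by nlinarith
      nlinarith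
  have h1 : (1 : ℝ) ≤ |(j : ℝ)| := by exact_mod_cast Int.one_le_abs hj0
  have cij : (i : ℝ) * j ≤ 0 := by exact_mod_cast hij
  have h2 : |(j : ℝ) * lin ξ w| ≤ |(i : ℝ) * lin ξ v + j * lin ξ w| := by
    apply sq_le_sq.1
    nlinarith [mul_nonneg_of_nonpos_of_nonpos cij hneg, sq_nonneg ((i : ℝ) * lin ξ v)]
  refine le_trans ?_ h2
  rw [abs_mul]
  nlinarith [abs_nonneg (lin ξ w)]

/-- A convergent of a number `ξ ≥ 1` is part of a basis of `ℤ²` as in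
`isConvergent_of_unimodular`. The bound on the first coordinates is what makes the
induction work: passing to `1 / (ξ - ⌊ξ⌋)` exchanges the coordinates. -/
theorem exists_unimodular_of_one_le (n : ℕ) : ∀ (ξ : ℝ), 1 ≤ ξ → ∃ v w : ℤ × ℤ,
    toRat v = ξ.convergent n ∧ 1 ≤ v.2 ∧ 0 ≤ w.2 ∧ w.2 ≤ v.2 ∧ 0 ≤ w.1 ∧ w.1 ≤ v.1 ∧
      |det v w| = 1 ∧ lin ξ v * lin ξ w ≤ 0 ∧ |lin ξ v| < |lin ξ w| := by
  induction n with
  | zero =>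
    intro ξ hξ
    refine ⟨(⌊ξ⌋, 1), (1, 0), ?_, by simp, by simp, by simp, by simp, ?_, by simp [det], ?_, ?_⟩
    · simp [toRat, Real.convergent_zero]
    · exact Int.le_floor.2 (by simpa using hξ)
    · have := Int.floor_le ξ
      simp only [lin]; push_cast; linarith
    · have := Int.floor_le ξ
      have := Int.lt_floor_add_one ξ
      simp only [lin]; push_cast
      rw [abs_of_nonneg (by linarith)]; norm_num
      exact Int.fract_lt_one ξ
  | succ n ih =>
    intro ξ hξ
    have hfl : 1 ≤ ⌊ξ⌋ := Int.le_floor.2 (by simpa using hξ)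
    rcases eq_or_lt_of_le (Int.fract_nonneg ξ) with h0 | h0
    · -- all the convergents of an integer coincide
      have hc : ∀ m, (0 : ℝ).convergent m = 0 := fun m => by
        simp
      have hξ' : ξ = ⌊ξ⌋ := by have := Int.floor_add_fract ξ; rw [← h0] at this; linarith
      refine ⟨(⌊ξ⌋, 1), (1, 0), ?_, by simp, by simp, by simp, by simp, hfl, by simp [det], ?_, ?_⟩
      · rw [Real.convergent_succ, ← h0, inv_zero, hc]; simp [toRat]
      · simp only [lin]; push_cast; linarith
      · simp only [lin]; push_cast; rw [← hξ']; norm_num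
    · have h1 : 1 ≤ (Int.fract ξ)⁻¹ := (one_le_inv₀ h0).2 (Int.fract_lt_one ξ).le
      obtain ⟨v, w, hvr, hv2, hw2, hwv2, hw1, hwv1, hd, hneg, hlt⟩ := ih _ h1
      have hv1 : 1 ≤ v.1 := by
        by_contra h
        have h1 : v.1 = 0 := by omega
        have h2 : w.1 = 0 := by omega
        simp [det, h1, h2] at hd
      have key : ∀ x : ℤ × ℤ, lin ξ (⌊ξ⌋ * x.1 + x.2, x.1) =
          -(Int.fract ξ * lin (Int.fract ξ)⁻¹ x) := by
        intro x
        have : ξ = ⌊ξ⌋ + Int.fract ξ := (Int.floor_add_fract ξ).symm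
        simp only [lin]; push_cast
        rw [mul_sub, mul_left_comm, mul_inv_cancel₀ h0.ne']
        nth_rewrite 1 [this]; ring
      refine ⟨(⌊ξ⌋ * v.1 + v.2, v.1), (⌊ξ⌋ * w.1 + w.2, w.1), ?_, hv1, hw1, hwv1, ?_, ?_, ?_, ?_, ?_⟩
      · rw [Real.convergent_succ, ← hvr]
        have : (v.1 : ℚ) ≠ 0 := by exact_mod_cast (by omega : v.1 ≠ 0)
        simp only [toRat]; push_cast
        rw [inv_div]; field_simp
      · simp only; nlinarith
      · simp only; nlinarith
      · have : det (⌊ξ⌋ * v.1 + v.2, v.1) (⌊ξ⌋ * w.1 + w.2, w.1) = -det v w := by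
          simp only [det]; ring
        rw [this, abs_neg, hd]
      · rw [key, key]; nlinarith [mul_pos h0 h0]
      · rw [key, key, abs_neg, abs_neg, abs_mul, abs_mul]
        exact mul_lt_mul_of_pos_left hlt (abs_pos.2 h0.ne')

theorem toRat_num_den {v w : ℤ × ℤ} (hv : 0 < v.2) (hdet : |det v w| = 1) :
    (toRat v).num = v.1 ∧ ((toRat v).den : ℤ) = v.2 := by
  have hc : IsCoprime v.1 v.2 := by
    rcases (abs_eq (by norm_num)).1 hdet with h | h
    · exact ⟨w.2, -w.1, by simp only [det] at h; linarith⟩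
    · exact ⟨-w.2, w.1, by simp only [det] at h; linarith⟩
  have hc' := Int.isCoprime_iff_nat_coprime.1 hc
  exact ⟨Rat.num_div_eq_of_coprime hv hc', Rat.den_div_eq_of_coprime hv hc'⟩

/-- A vector is not a convergent if some vector of smaller denominator is at least as good. -/
theorem not_isConvergent_of_abs_lin_le {ξ : ℝ} {v w x : ℤ × ℤ} (hξ : 0 ≤ ξ)
    (hdet : |det v w| = 1) (hx : 0 < x.2) (hxv : x.2 < v.2) (hle : |lin ξ x| ≤ |lin ξ v|) :
    ¬ IsConvergent ξ (toRat v) := by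
  rintro ⟨n, hn⟩
  have hshift : (ξ + 1).convergent n = ξ.convergent n + 1 := by
    cases n with
    | zero => simp [Real.convergent_zero]
    | succ n => simp [Real.convergent_succ, Int.fract_add_one]; ring
  obtain ⟨v', w', hvr, hv2, hw2, hwv2, -, -, hd, hneg, hlt⟩ :=
    exists_unimodular_of_one_le n (ξ + 1) (by linarith)
  have key : ∀ x : ℤ × ℤ, lin ξ (x.1 - x.2, x.2) = lin (ξ + 1) x := by
    intro x; simp only [lin]; push_cast; ring
  have hd' : |det (v'.1 - v'.2, v'.2) (w'.1 - w'.2, w'.2)| = 1 := by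
    rw [← hd]; congr 1; simp only [det]; ring
  have hrat : toRat v = toRat (v'.1 - v'.2, v'.2) := by
    rw [hn]
    have h1 : ξ.convergent n = toRat v' - 1 := by rw [hvr, hshift]; ring
    have : (v'.2 : ℚ) ≠ 0 := by exact_mod_cast (by omega : v'.2 ≠ 0)
    rw [h1]; simp only [toRat]; push_cast; field_simp
  obtain ⟨hn1, hd1⟩ := toRat_num_den (hx.trans hxv) hdet
  obtain ⟨hn2, hd2⟩ := toRat_num_den (v := (v'.1 - v'.2, v'.2)) (zero_lt_one.trans_le hv2) hd'
  have hveq : v = (v'.1 - v'.2, v'.2) := by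
    ext
    · rw [← hn1, ← hn2, hrat]
    · rw [← hd1, ← hd2, hrat]
  rw [← key, ← key] at hneg hlt
  rw [← hveq] at hneg hlt hd'
  have := abs_lin_le_of_unimodular (x := x) (by omega) (by simpa using hw2) hd' hneg hx hxv
  linarith

/-! ### Combinatorics of the words `M`, `T`, `R` and `V` -/

section

theorem wordPow_zero (W : List ℕ) : wordPow W 0 = [] := by simp [wordPow]

theorem wordPow_succ (W : List ℕ) (n : ℕ) : wordPow W (n + 1) = W ++ wordPow W n := by
  simp [wordPow, List.replicate_succ]

theorem wordPow_add (W : List ℕ) (m n : ℕ) :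
    wordPow W (m + n) = wordPow W m ++ wordPow W n := by
  rw [wordPow, List.replicate_add, List.flatten_append]; rfl

theorem length_wordPow (W : List ℕ) (n : ℕ) : (wordPow W n).length = n * W.length := by
  simp [wordPow]

theorem wordPow_append_comm (X Y : List ℕ) (n : ℕ) :
    wordPow (X ++ Y) n ++ X = X ++ wordPow (Y ++ X) n := by
  induction n with
  | zero => simp [wordPow_zero]
  | succ n ih => rw [wordPow_succ, wordPow_succ, List.append_assoc, ih]; simp

theorem wordPow_append_comm_assoc (X Y Z : List ℕ) (n : ℕ) :
    wordPow (X ++ Y) n ++ (X ++ Z) = X ++ (wordPow (Y ++ X) n ++ Z) := by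
  rw [← List.append_assoc, wordPow_append_comm, List.append_assoc]

variable {b : ℕ} {a β : ℕ → ℕ}

theorem t_zero : t a β 0 = 0 := by simp [t]

theorem t_succ (k : ℕ) : t a β (k + 1) = t a β k + β (k + 1) * q a k := by
  simp [t, Finset.sum_range_succ]

theorem t_mono {j k : ℕ} (h : j ≤ k) : t a β j ≤ t a β k := by
  induction k, h using Nat.le_induction with
  | base => exact le_rfl
  | succ k _ ih => exact ih.trans (by rw [t_succ]; omega)

/-- A digit that is maximal forces the preceding one to vanish. -/
theorem OstrowskiRules.eq_zero (hβ : OstrowskiRules a β) {k : ℕ}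
    (h : β (k + 2) = a (k + 2)) : β (k + 1) = 0 := hβ.2.2 (k + 1) (by omega) h

theorem OstrowskiRules.le (hβ : OstrowskiRules a β) (k : ℕ) : β (k + 1) ≤ a (k + 1) := by
  cases k with
  | zero => exact hβ.1.le
  | succ k => exact hβ.2.1 _ (by omega)

theorem t_lt_q (hβ : OstrowskiRules a β) (k : ℕ) : t a β k < q a k := by
  induction k using Nat.twoStepInduction with
  | zero => simp [t_zero, q]
  | one => rw [t_succ, t_zero]; simpa [q] using hβ.1
  | more k ih1 ih2 =>
    rw [t_succ]
    simp only [q]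
    rcases eq_or_lt_of_le (hβ.le (k + 1)) with h | h
    · rw [t_succ, hβ.eq_zero h, h]; simp only [show k + 1 + 1 = k + 2 from rfl]; omega
    · have : (β (k + 2) + 1) * q a (k + 1) ≤ a (k + 2) * q a (k + 1) := Nat.mul_le_mul_right _ h
      simp only [show k + 1 + 1 = k + 2 from rfl]
      linarith

theorem r_pos (hβ : OstrowskiRules a β) (k : ℕ) : 0 < r a β k := by
  have := t_lt_q hβ k
  simp only [r]; omega

theorem t_add_r (hβ : OstrowskiRules a β) (k : ℕ) : t a β k + r a β k = q a k := by
  have := t_lt_q hβ k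
  simp only [r]; omega

theorem length_M (h1 : 1 ≤ a 1) (k : ℕ) : (M b a k).length = q a k := by
  induction k using Nat.twoStepInduction with
  | zero => simp [M, q]
  | one => simp [M, q]; omega
  | more k ih1 ih2 => simp only [M, q, List.length_append, length_wordPow, ih1, ih2]

theorem length_T (hβ : OstrowskiRules a β) (k : ℕ) : (T b a β k).length = t a β k := by
  rw [T, List.length_take, length_M (by have := hβ.1; omega)]
  exact min_eq_left (t_lt_q hβ k).le

theorem length_R (hβ : OstrowskiRules a β) (k : ℕ) : (R b a β k).length = r a β k := by
  rw [R, List.length_drop, length_M (by have := hβ.1; omega), r]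

theorem T_append_R (k : ℕ) : T b a β k ++ R b a β k = M b a k := List.take_append_drop _ _

theorem T_zero : T b a β 0 = [] := by simp [T, t_zero]

theorem T_succ (hβ : OstrowskiRules a β) (k : ℕ) :
    T b a β (k + 1) = wordPow (M b a k) (β (k + 1)) ++ T b a β k := by
  have h1 : 1 ≤ a 1 := by have := hβ.1; omega
  induction k with
  | zero =>
    have h : β 1 ≤ a 1 - 1 := by have := hβ.1; omega
    rw [T_zero, T, t_succ, t_zero]
    simp only [M, q, zero_add, mul_one, List.append_nil]
    rw [List.take_append_of_le_length (by simpa using h), List.take_replicate, min_eq_left h]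
    simp [wordPow]
  | succ k ih =>
    rw [T, t_succ]
    simp only [M, show k + 1 + 1 = k + 2 from rfl]
    rcases eq_or_lt_of_le (hβ.le (k + 1)) with h | h
    · have h0 := hβ.eq_zero h
      rw [show k + 1 + 1 = k + 2 from rfl] at h
      rw [ih, t_succ, h0, wordPow_zero, List.nil_append, h, zero_mul, add_zero, add_comm,
        ← length_M (b := b) h1 (k + 1), ← length_wordPow, List.take_length_add_append, T]
    · obtain ⟨d, hd⟩ : ∃ d, a (k + 2) = β (k + 2) + (d + 1) :=
        ⟨a (k + 2) - β (k + 2) - 1, by simp only [show k + 1 + 1 = k + 2 from rfl] at h; omega⟩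
      rw [hd, wordPow_add, wordPow_succ, add_comm, ← length_M (b := b) h1 (k + 1),
        ← length_wordPow, List.append_assoc, List.take_length_add_append, List.append_assoc,
        List.take_append_of_le_length, T]
      rw [length_M h1]; exact (t_lt_q hβ _).le

/-- The recursion for the suffixes when the digit is not maximal. -/
theorem R_add_two (hβ : OstrowskiRules a β) {k : ℕ} (h : β (k + 2) < a (k + 2)) :
    R b a β (k + 2) =
      R b a β (k + 1) ++ (wordPow (M b a (k + 1)) (a (k + 2) - β (k + 2) - 1) ++ M b a k) := by
  obtain ⟨d, hd⟩ : ∃ d, a (k + 2) = β (k + 2) + (d + 1) := ⟨a (k + 2) - β (k + 2) - 1, by omega⟩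
  have h1 := T_append_R (b := b) (a := a) (β := β) (k + 2)
  rw [T_succ hβ (k + 1)] at h1
  simp only [M, show k + 1 + 1 = k + 2 from rfl] at h1
  rw [hd, wordPow_add, wordPow_succ, List.append_assoc, List.append_assoc, List.append_cancel_left_eq] at h1
  rw [List.append_assoc] at h1
  have h2 := T_append_R (b := b) (a := a) (β := β) (k + 1)
  generalize hX : wordPow (M b a (k + 1)) d ++ M b a k = X at h1
  rw [← h2, List.append_assoc, List.append_cancel_left_eq, ← hX] at h1
  rw [h1, hd, show β (k + 2) + (d + 1) - β (k + 2) - 1 = d by omega]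

theorem T_eq_of_eq_zero (hβ : OstrowskiRules a β) {k : ℕ} (h : β (k + 1) = 0) :
    T b a β (k + 1) = T b a β k := by
  rw [T_succ hβ, h, wordPow_zero, List.nil_append]

theorem t_eq_of_eq_zero {k : ℕ} (h : β (k + 1) = 0) : t a β (k + 1) = t a β k := by
  rw [t_succ, h]; simp

/-- The recursion for the suffixes when the digit is maximal. -/
theorem R_add_two_of_eq (hβ : OstrowskiRules a β) {k : ℕ} (h : β (k + 2) = a (k + 2)) :
    R b a β (k + 2) = R b a β k := by
  have h1 := T_append_R (b := b) (a := a) (β := β) (k + 2)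
  rw [T_succ hβ (k + 1), T_eq_of_eq_zero hβ (hβ.eq_zero h)] at h1
  simp only [M, show k + 1 + 1 = k + 2 from rfl] at h1
  rw [h, List.append_assoc, List.append_cancel_left_eq, ← T_append_R (β := β) k,
    List.append_cancel_left_eq] at h1
  exact h1

/-- `V` is the conjugate of `M` that exchanges the two factors of `M = T R`. -/
theorem V_eq (hβ : OstrowskiRules a β) (k : ℕ) : V b a β k = R b a β k ++ T b a β k := by
  induction k using Nat.twoStepInduction with
  | zero => simp [V, R, T, t_zero, M]
  | one =>
    have h : β 1 ≤ a 1 - 1 := by have := hβ.1; omega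
    have h1 := T_append_R (b := b) (a := a) (β := β) 1
    have hT : T b a β 1 = List.replicate (β 1) 0 := by
      rw [T_succ hβ 0, T_zero]; simp [M, wordPow]
    rw [hT] at h1 ⊢
    simp only [M] at h1
    rw [show a 1 - 1 = β 1 + (a 1 - β 1 - 1) by omega, List.replicate_add, List.append_assoc,
      List.append_cancel_left_eq] at h1
    rw [h1, V]
  | more k ih1 ih2 =>
    simp only [V]
    rcases eq_or_lt_of_le (hβ.le (k + 1)) with h | h
    · simp only [show k + 1 + 1 = k + 2 from rfl] at h
      have h0 := hβ.eq_zero h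
      rw [R_add_two_of_eq hβ h, T_succ hβ (k + 1), ih1, ih2, h, Nat.sub_self, wordPow_zero,
        List.nil_append, ← T_append_R (β := β) (k + 1), wordPow_append_comm,
        T_eq_of_eq_zero hβ h0, List.append_assoc]
    · simp only [show k + 1 + 1 = k + 2 from rfl] at h
      obtain ⟨d, hd⟩ : ∃ d, a (k + 2) - β (k + 2) = d + 1 := ⟨a (k + 2) - β (k + 2) - 1, by omega⟩
      rw [R_add_two hβ h, hd, Nat.add_sub_cancel, T_succ hβ (k + 1), ih1, ih2,
        ← T_append_R (β := β) (k + 1), wordPow_append_comm]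
      -- both sides reduce to the commutation rule for `M_{k}` and `T_{k+1} = M_k^β T_k`
      have hc : M b a k ++ T b a β (k + 1) =
          T b a β (k + 1) ++ (R b a β k ++ T b a β k) := by
        rw [T_succ hβ k, List.append_assoc, ← List.append_assoc (T b a β k), T_append_R,
          ← List.append_assoc, ← List.append_assoc, ← wordPow_succ, wordPow_add]
        simp [wordPow_succ, wordPow_zero]
      rw [wordPow_add, wordPow_succ, wordPow_zero, List.append_nil]
      simp only [List.append_assoc]
      rw [← wordPow_append_comm_assoc]
      rw [← List.append_assoc (M b a k), hc]
      simp only [List.append_assoc]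

theorem r_add_two (hβ : OstrowskiRules a β) {k : ℕ} (h : β (k + 2) < a (k + 2)) :
    r a β (k + 2) = r a β (k + 1) + (a (k + 2) - β (k + 2) - 1) * q a (k + 1) + q a k := by
  have h1 : 1 ≤ a 1 := by have := hβ.1; omega
  have := congrArg List.length (R_add_two (b := 2) hβ h)
  simpa [length_R hβ, length_wordPow, length_M h1, add_assoc] using this

theorem r_add_two_of_eq (hβ : OstrowskiRules a β) {k : ℕ} (h : β (k + 2) = a (k + 2)) :
    r a β (k + 2) = r a β k := by
  have := congrArg List.length (R_add_two_of_eq (b := 2) hβ h)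
  simpa [length_R hβ] using this

theorem one_le_q (h1 : ∀ k, 1 ≤ k → 1 ≤ a k) (k : ℕ) : 1 ≤ q a k := by
  induction k using Nat.twoStepInduction with
  | zero => simp [q]
  | one => simpa [q] using h1 1 le_rfl
  | more k ih1 ih2 => simp only [q]; omega

theorem q_add_two_ge (h1 : ∀ k, 1 ≤ k → 1 ≤ a k) (k : ℕ) :
    q a (k + 1) + q a k ≤ q a (k + 2) := by
  have := h1 (k + 2) (by omega)
  simp only [q]; nlinarith

theorem q_le_succ (h1 : ∀ k, 1 ≤ k → 1 ≤ a k) (k : ℕ) : q a k ≤ q a (k + 1) := by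
  cases k with
  | zero => simpa [q] using h1 1 le_rfl
  | succ k => exact (Nat.le_add_right _ _).trans (q_add_two_ge h1 k)

theorem le_q (h1 : ∀ k, 1 ≤ k → 1 ≤ a k) (k : ℕ) : k ≤ q a k := by
  induction k using Nat.twoStepInduction with
  | zero => simp
  | one => exact one_le_q h1 1
  | more k ih1 ih2 =>
    have := q_add_two_ge h1 k
    have := one_le_q h1 k
    omega

end

/-! ### Words as integral vectors -/

section

variable {b : ℕ} {a β : ℕ → ℕ}

/-- The repunit `1 + b + ⋯ + b^(n-1)`. -/
def repunit (b n : ℕ) : ℤ := ∑ i ∈ Finset.range n, (b : ℤ) ^ i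

/-- The sum `1 + b^m + ⋯ + b^((n-1)m)`. -/
def geom (b n m : ℕ) : ℤ := ∑ i ∈ Finset.range n, ((b : ℤ) ^ m) ^ i

/-- The vector attached to a word `W` over `{0, b - 1}`: its value divided by `b - 1`, and the
repunit of the same length. It is the same combination of `U` and `W` that computes both
coordinates at the concatenation `U W`; this turns identities between words into identities
between vectors. -/
def vec (b : ℕ) (W : List ℕ) : ℤ × ℤ :=
  ((wordValue b (W.map (· / (b - 1))) : ℤ), repunit b W.length)

theorem repunit_zero (b : ℕ) : repunit b 0 = 0 := by simp [repunit]

theorem repunit_add (b m n : ℕ) : repunit b (m + n) = (b : ℤ) ^ n * repunit b m + repunit b n := by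
  rw [add_comm m n, repunit, Finset.sum_range_add, repunit, repunit, Finset.mul_sum, add_comm]
  simp [pow_add]

theorem mul_repunit (b n : ℕ) : ((b : ℤ) - 1) * repunit b n = (b : ℤ) ^ n - 1 :=
  mul_geom_sum _ _

theorem mul_geom (b n m : ℕ) : ((b : ℤ) ^ m - 1) * geom b n m = ((b : ℤ) ^ m) ^ n - 1 :=
  mul_geom_sum _ _

theorem geom_zero (b m : ℕ) : geom b 0 m = 0 := by simp [geom]

theorem geom_succ (b n m : ℕ) : geom b (n + 1) m = geom b n m + ((b : ℤ) ^ m) ^ n := by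
  simp [geom, Finset.sum_range_succ]

theorem geom_nonneg (b n m : ℕ) : 0 ≤ geom b n m := by unfold geom; positivity

theorem one_le_geom (b : ℕ) {n : ℕ} (m : ℕ) (hn : 1 ≤ n) : 1 ≤ geom b n m := by
  obtain ⟨n, rfl⟩ := Nat.exists_eq_add_of_le' hn
  rw [geom, Finset.sum_range_succ']
  have : (0 : ℤ) ≤ ∑ k ∈ Finset.range n, ((b : ℤ) ^ m) ^ (k + 1) := by positivity
  simp only [pow_zero]; linarith

theorem vec_append (U W : List ℕ) : vec b (U ++ W) = ((b : ℤ) ^ W.length) • vec b U + vec b W := by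
  ext
  · simp [vec, wordValue, Nat.ofDigits_append]; ring
  · simp [vec, repunit_add]

theorem vec_nil : vec b [] = 0 := by ext <;> simp [vec, wordValue, repunit]

theorem vec_wordPow (W : List ℕ) (n : ℕ) : vec b (wordPow W n) = geom b n W.length • vec b W := by
  induction n with
  | zero => simp [wordPow_zero, vec_nil, geom_zero]
  | succ n ih =>
    rw [wordPow_succ, vec_append, ih, length_wordPow, geom_succ, mul_comm n, pow_mul]; module

theorem vec_append_wordPow (U W : List ℕ) (n : ℕ) :
    vec b (U ++ wordPow W n) = vec b U + geom b n W.length • (vec b (U ++ W) - vec b U) := by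
  have h : (((b : ℤ) ^ W.length) ^ n) = (((b : ℤ) ^ W.length) - 1) * geom b n W.length + 1 := by
    rw [mul_geom]; ring
  rw [vec_append, vec_append, vec_wordPow, length_wordPow, mul_comm n, pow_mul, h]; module

/-- The vector of `(1)_k` (with a negative denominator when `r_{k+1} < r_k`). -/
def vec1 (b : ℕ) (a β : ℕ → ℕ) (k : ℕ) : ℤ × ℤ := vec b (R b a β (k + 1)) - vec b (R b a β k)

/-- The vector of `(2)_k`. -/
def vec2 (b : ℕ) (a β : ℕ → ℕ) (k : ℕ) : ℤ × ℤ := vec b (R b a β (k + 1) ++ T b a β k)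

/-- The vector of `(3)_k`. -/
def vec3 (b : ℕ) (a β : ℕ → ℕ) (k : ℕ) : ℤ × ℤ :=
  vec b (R b a β (k + 1) ++ M b a k) - vec b (R b a β (k + 1))

/-- The vector of `(4)_k`. -/
def vec4 (b : ℕ) (a β : ℕ → ℕ) (k : ℕ) : ℤ × ℤ := vec b (V b a β (k + 1))

/-! ### Linear relations between the four families -/

theorem vec2_eq (hβ : OstrowskiRules a β) (k : ℕ) :
    vec2 b a β (k + 1) = ((b : ℤ) ^ t a β (k + 1)) • vec1 b a β (k + 1) + vec4 b a β k := by
  simp only [vec1, vec2, vec4, V_eq hβ, vec_append, length_T hβ]; module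

theorem vec3_eq (hβ : OstrowskiRules a β) (k : ℕ) :
    vec3 b a β (k + 1) = ((b : ℤ) ^ q a (k + 1) - 1) • vec1 b a β (k + 1) +
      ((b : ℤ) ^ r a β (k + 1)) • vec4 b a β k := by
  have hM : vec b (M b a (k + 1)) = vec b (T b a β (k + 1) ++ R b a β (k + 1)) := by
    rw [T_append_R]
  have hq : (b : ℤ) ^ q a (k + 1) = (b : ℤ) ^ r a β (k + 1) * (b : ℤ) ^ t a β (k + 1) := by
    rw [← t_add_r hβ, pow_add, mul_comm]
  have h1 : 1 ≤ a 1 := by have := hβ.1; omega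
  simp only [vec1, vec3, vec4, V_eq hβ]
  rw [vec_append, hM, vec_append, vec_append, length_T hβ, length_R hβ, length_M h1, hq]; module

theorem vec4_eq (hβ : OstrowskiRules a β) (k : ℕ) :
    vec4 b a β k = ((b : ℤ) ^ t a β k * geom b (β (k + 1)) (q a k)) • vec3 b a β k +
      vec2 b a β k := by
  have h1 : 1 ≤ a 1 := by have := hβ.1; omega
  simp only [vec2, vec3, vec4, V_eq hβ]
  rw [T_succ hβ, ← List.append_assoc, vec_append, vec_append_wordPow, length_M h1, length_T hβ,
    vec_append _ (T b a β k), length_T hβ]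
  module

theorem vec1_succ_eq (hβ : OstrowskiRules a β) {k : ℕ} (h : β (k + 2) < a (k + 2)) :
    vec1 b a β (k + 1) = ((b : ℤ) ^ (r a β (k + 1) + q a k) *
      geom b (a (k + 2) - β (k + 2) - 1) (q a (k + 1))) • vec4 b a β k + vec3 b a β k := by
  have h1 : 1 ≤ a 1 := by have := hβ.1; omega
  have hV : (V b a β (k + 1)).length = q a (k + 1) := by
    rw [V_eq hβ, List.length_append, length_R hβ, length_T hβ, add_comm, t_add_r hβ]
  simp only [vec1, vec3, vec4]
  rw [R_add_two hβ h, ← T_append_R (β := β) (k + 1), ← wordPow_append_comm_assoc, ← V_eq hβ,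
    vec_append, vec_wordPow, List.length_append, length_R hβ, length_M h1, hV]
  module

theorem vec2_of_eq (hβ : OstrowskiRules a β) {k : ℕ} (h : β (k + 3) = a (k + 3)) :
    vec2 b a β (k + 2) = vec4 b a β k := by
  simp only [vec2, vec4]
  rw [R_add_two_of_eq hβ h, T_eq_of_eq_zero hβ (hβ.eq_zero h), V_eq hβ]

theorem vec3_of_eq (hβ : OstrowskiRules a β) {k : ℕ} (h : β (k + 3) = a (k + 3)) :
    vec3 b a β (k + 2) = ((b : ℤ) ^ (r a β (k + 1) + q a k) *
      geom b (a (k + 2)) (q a (k + 1))) • vec4 b a β k + vec3 b a β k := by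
  have h1 : 1 ≤ a 1 := by have := hβ.1; omega
  have hV : (V b a β (k + 1)).length = q a (k + 1) := by
    rw [V_eq hβ, List.length_append, length_R hβ, length_T hβ, add_comm, t_add_r hβ]
  simp only [vec3, vec4]
  rw [R_add_two_of_eq hβ h]
  simp only [M]
  rw [← T_append_R (β := β) (k + 1), ← wordPow_append_comm_assoc, ← V_eq hβ,
    vec_append, vec_wordPow, List.length_append, length_R hβ, length_M h1, hV]
  module

theorem det_vec_M (h1 : 1 ≤ a 1) (hb : 2 ≤ b) (k : ℕ) :
    det (vec b (M b a (k + 1))) (vec b (M b a k)) = (-1) ^ k := by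
  induction k with
  | zero =>
    have h2 : (b - 1) / (b - 1) = 1 := Nat.div_self (by omega)
    simp [M, vec, det, wordValue, repunit, Nat.ofDigits_cons,
      Nat.ofDigits_replicate_zero, h2]
  | succ k ih =>
    simp only [M]
    rw [vec_append, vec_wordPow, length_M h1, length_M h1, pow_succ, ← ih]
    simp only [det, Prod.fst_add, Prod.snd_add, Prod.smul_fst, Prod.smul_snd, smul_eq_mul]
    ring

/-- The vectors of `(4)_k` and `(3)_k` form a basis of `ℤ²`, of orientation `(-1)^k`. -/
theorem det_vec4_vec3 (hβ : OstrowskiRules a β) (hb : 2 ≤ b) (k : ℕ) :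
    det (vec4 b a β k) (vec3 b a β k) = (-1) ^ k := by
  have h1 : 1 ≤ a 1 := by have := hβ.1; omega
  rw [← det_vec_M h1 hb]
  have hM : vec b (M b a (k + 1)) = vec b (T b a β (k + 1) ++ R b a β (k + 1)) := by
    rw [T_append_R]
  have hpos : (b : ℤ) ^ r a β (k + 1) ≠ 0 := pow_ne_zero _ (by exact_mod_cast (by omega : b ≠ 0))
  apply mul_left_cancel₀ hpos
  simp only [vec4, vec3, V_eq hβ]
  rw [vec_append, vec_append, hM, vec_append, length_T hβ, length_R hβ, length_M h1]
  have e1 : (vec b (R b a β (k + 1))).2 = repunit b (r a β (k + 1)) := by simp [vec, length_R hβ]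
  have e2 : (vec b (T b a β (k + 1))).2 = repunit b (t a β (k + 1)) := by simp [vec, length_T hβ]
  have e3 : (vec b (M b a k)).2 = repunit b (q a k) := by simp [vec, length_M h1]
  have f1 := mul_repunit b (r a β (k + 1))
  have f2 := mul_repunit b (t a β (k + 1))
  have f3 := mul_repunit b (q a k)
  simp only [det, Prod.fst_add, Prod.snd_add, Prod.smul_fst, Prod.smul_snd, smul_eq_mul,
    Prod.fst_sub, Prod.snd_sub, e1, e2, e3]
  generalize (vec b (R b a β (k + 1))).1 = x
  generalize (vec b (T b a β (k + 1))).1 = y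
  generalize (vec b (M b a k)).1 = z
  generalize repunit b (r a β (k + 1)) = gr at *
  generalize repunit b (t a β (k + 1)) = gt at *
  generalize repunit b (q a k) = gq at *
  rw [show (b : ℤ) ^ r a β (k + 1) = (b - 1) * gr + 1 by linarith,
    show (b : ℤ) ^ t a β (k + 1) = (b - 1) * gt + 1 by linarith,
    show (b : ℤ) ^ q a k = (b - 1) * gq + 1 by linarith]
  ring

theorem det_vec2_vec3 (hβ : OstrowskiRules a β) (hb : 2 ≤ b) (k : ℕ) :
    det (vec2 b a β k) (vec3 b a β k) = (-1) ^ k := by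
  rw [← det_vec4_vec3 hβ hb, vec4_eq hβ]
  simp only [det, Prod.fst_add, Prod.snd_add, Prod.smul_fst, Prod.smul_snd, smul_eq_mul]
  ring

theorem det_vec4_vec1 (hβ : OstrowskiRules a β) (hb : 2 ≤ b) {k : ℕ}
    (h : β (k + 2) < a (k + 2)) : det (vec4 b a β k) (vec1 b a β (k + 1)) = (-1) ^ k := by
  rw [← det_vec4_vec3 hβ hb, vec1_succ_eq hβ h]
  simp only [det, Prod.fst_add, Prod.snd_add, Prod.smul_fst, Prod.smul_snd, smul_eq_mul]
  ring

/-! ### Denominators -/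

theorem vec1_snd (hβ : OstrowskiRules a β) (k : ℕ) :
    (vec1 b a β k).2 = repunit b (r a β (k + 1)) - repunit b (r a β k) := by
  simp [vec1, vec, length_R hβ]

theorem vec2_snd (hβ : OstrowskiRules a β) (k : ℕ) :
    (vec2 b a β k).2 = repunit b (r a β (k + 1) + t a β k) := by
  simp [vec2, vec, length_R hβ, length_T hβ]

theorem vec3_snd (hβ : OstrowskiRules a β) (k : ℕ) :
    (vec3 b a β k).2 = (b : ℤ) ^ r a β (k + 1) * repunit b (q a k) := by
  have h1 : 1 ≤ a 1 := by have := hβ.1; omega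
  simp only [vec3, vec, Prod.snd_sub, List.length_append, length_R hβ, length_M h1]
  rw [add_comm, repunit_add]; ring

theorem vec4_snd (hβ : OstrowskiRules a β) (k : ℕ) :
    (vec4 b a β k).2 = repunit b (q a (k + 1)) := by
  simp only [vec4, vec]
  rw [V_eq hβ, List.length_append, length_R hβ, length_T hβ, add_comm, t_add_r hβ]

theorem repunit_le (hb : 2 ≤ b) (n : ℕ) : repunit b n ≤ (b : ℤ) ^ n - 1 := by
  rw [← mul_repunit]
  have h0 : 0 ≤ repunit b n := by unfold repunit; positivity
  have : (1 : ℤ) ≤ b - 1 := by have : (2 : ℤ) ≤ b := by exact_mod_cast hb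
                               linarith
  nlinarith

theorem le_repunit_succ (b n : ℕ) : (b : ℤ) ^ n ≤ repunit b (n + 1) := by
  rw [repunit, Finset.sum_range_succ]
  have : (0 : ℤ) ≤ ∑ i ∈ Finset.range n, (b : ℤ) ^ i := by positivity
  linarith

theorem repunit_lt (hb : 2 ≤ b) {m n : ℕ} (h : m < n) : repunit b m < repunit b n := by
  obtain ⟨d, rfl⟩ := Nat.exists_eq_add_of_lt h
  have h1 := repunit_le hb m
  have h2 := le_repunit_succ b (m + d)
  have h3 : (b : ℤ) ^ m ≤ (b : ℤ) ^ (m + d) :=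
    pow_le_pow_right₀ (by exact_mod_cast (by omega : 1 ≤ b)) (by omega)
  linarith

theorem repunit_pos (hb : 2 ≤ b) {n : ℕ} (h : 0 < n) : 0 < repunit b n := by
  simpa [repunit_zero] using repunit_lt hb h

/-! ### The four families of rational numbers as vectors -/

theorem dvd_of_mem_wordPow {W : List ℕ} {n c : ℕ} (h : ∀ d ∈ W, c ∣ d) :
    ∀ d ∈ wordPow W n, c ∣ d := by
  intro d hd
  simp only [wordPow, List.mem_flatten, List.mem_replicate] at hd
  obtain ⟨l, ⟨-, rfl⟩, hd⟩ := hd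
  exact h d hd

theorem dvd_of_mem_M (k : ℕ) : ∀ d ∈ M b a k, b - 1 ∣ d := by
  induction k using Nat.twoStepInduction with
  | zero => simp [M]
  | one =>
    intro d hd
    simp only [M, List.mem_append, List.mem_replicate, List.mem_singleton] at hd
    rcases hd with ⟨-, rfl⟩ | rfl <;> simp
  | more k ih1 ih2 =>
    intro d hd
    simp only [M, List.mem_append] at hd
    rcases hd with hd | hd
    · exact dvd_of_mem_wordPow ih2 d hd
    · exact ih1 d hd

theorem dvd_of_mem_R (k : ℕ) : ∀ d ∈ R b a β k, b - 1 ∣ d :=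
  fun d hd => dvd_of_mem_M k d (List.mem_of_mem_drop hd)

theorem dvd_of_mem_T (k : ℕ) : ∀ d ∈ T b a β k, b - 1 ∣ d :=
  fun d hd => dvd_of_mem_M k d (List.mem_of_mem_take hd)

theorem wordValue_eq (hb : 2 ≤ b) {W : List ℕ} (h : ∀ d ∈ W, b - 1 ∣ d) :
    (wordValue b W : ℤ) = (b - 1) * (vec b W).1 := by
  induction W with
  | nil => simp [wordValue, vec]
  | cons d W ih =>
    have h1 : (d : ℤ) = (b - 1) * ((d / (b - 1) : ℕ) : ℤ) := by
      have := Nat.mul_div_cancel' (h d (by simp))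
      have h2 : ((b - 1 : ℕ) : ℤ) = b - 1 := by push_cast [show 1 ≤ b by omega]; ring
      rw [← h2]; exact_mod_cast this.symm
    have ih' := ih (fun d hd => h d (by simp [hd]))
    simp only [vec, wordValue] at ih' ⊢
    simp only [List.map_cons, List.reverse_cons, Nat.ofDigits_append, List.length_reverse,
      List.length_map, Nat.ofDigits_singleton]
    push_cast at ih' ⊢
    rw [mul_add, ← ih']
    nth_rewrite 1 [h1]; push_cast; ring

theorem cast_pow_sub_one (b n : ℕ) : (b : ℚ) ^ n - 1 = (b - 1) * (repunit b n : ℚ) := by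
  have := mul_repunit b n
  exact_mod_cast this.symm

theorem wordValue_eq_cast (hb : 2 ≤ b) {W : List ℕ} (h : ∀ d ∈ W, b - 1 ∣ d) :
    (wordValue b W : ℚ) = (b - 1) * ((vec b W).1 : ℚ) := by
  have := wordValue_eq hb h
  exact_mod_cast this

theorem frac1_eq (hβ : OstrowskiRules a β) (hb : 2 ≤ b) {k : ℕ} (h : r a β k < r a β (k + 1)) :
    frac1 b a β k = toRat (vec1 b a β k) := by
  have hb' : (b : ℚ) - 1 ≠ 0 := by
    have : (2 : ℚ) ≤ b := by exact_mod_cast hb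
    linarith
  have h2 : (b : ℚ) ^ r a β k * ((b : ℚ) ^ (r a β (k + 1) - r a β k) - 1) =
      (b - 1) * ((vec1 b a β k).2 : ℚ) := by
    rw [mul_sub, ← pow_add, Nat.add_sub_cancel' h.le, vec1_snd hβ]
    have h3 := cast_pow_sub_one b (r a β (k + 1))
    have h4 := cast_pow_sub_one b (r a β k)
    push_cast; linarith
  rw [frac1, wordValue_eq_cast hb (dvd_of_mem_R _), wordValue_eq_cast hb (dvd_of_mem_R _), h2,
    ← mul_sub, mul_div_mul_left _ _ hb', toRat]
  simp [vec1]

theorem frac2_eq (hβ : OstrowskiRules a β) (hb : 2 ≤ b) (k : ℕ) :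
    frac2 b a β k = toRat (vec2 b a β k) := by
  have hb' : (b : ℚ) - 1 ≠ 0 := by
    have : (2 : ℚ) ≤ b := by exact_mod_cast hb
    linarith
  rw [frac2, wordValue_eq_cast hb, cast_pow_sub_one, mul_div_mul_left _ _ hb', toRat, vec2_snd hβ,
    vec2]
  intro d hd
  rcases List.mem_append.1 hd with hd | hd
  · exact dvd_of_mem_R _ d hd
  · exact dvd_of_mem_T _ d hd

theorem frac3_eq (hβ : OstrowskiRules a β) (hb : 2 ≤ b) (k : ℕ) :
    frac3 b a β k = toRat (vec3 b a β k) := by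
  have hb' : (b : ℚ) - 1 ≠ 0 := by
    have : (2 : ℚ) ≤ b := by exact_mod_cast hb
    linarith
  rw [frac3, wordValue_eq_cast hb, wordValue_eq_cast hb (dvd_of_mem_R _), cast_pow_sub_one,
    mul_left_comm, ← mul_sub, mul_div_mul_left _ _ hb', toRat, vec3_snd hβ, vec3]
  · simp
  intro d hd
  rcases List.mem_append.1 hd with hd | hd
  · exact dvd_of_mem_R _ d hd
  · exact dvd_of_mem_M _ d hd

theorem frac4_eq (hβ : OstrowskiRules a β) (hb : 2 ≤ b) (k : ℕ) :
    frac4 b a β k = toRat (vec4 b a β k) := by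
  have hb' : (b : ℚ) - 1 ≠ 0 := by
    have : (2 : ℚ) ≤ b := by exact_mod_cast hb
    linarith
  rw [frac4, wordValue_eq_cast hb, cast_pow_sub_one, mul_div_mul_left _ _ hb', toRat, vec4_snd hβ,
    vec4]
  rw [V_eq hβ]
  intro d hd
  rcases List.mem_append.1 hd with hd | hd
  · exact dvd_of_mem_R _ d hd
  · exact dvd_of_mem_T _ d hd

end

/-! ### The continued fraction of the slope -/

/-- The complete quotients of `v`, from the first one `1 / (v - ⌊v⌋)` on. -/
def completeQuotient (v : ℝ) : ℕ → ℝ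
  | 0 => (Int.fract v)⁻¹
  | k + 1 => (Int.fract (completeQuotient v k))⁻¹

theorem completeQuotient_inv_fract (v : ℝ) (k : ℕ) :
    completeQuotient (Int.fract v)⁻¹ k = completeQuotient v (k + 1) := by
  induction k with
  | zero => rfl
  | succ k ih => rw [completeQuotient, ih]; rfl

theorem irrational_inv_fract {v : ℝ} (hv : Irrational v) : Irrational (Int.fract v)⁻¹ := by
  rw [irrational_inv_iff, Int.fract]
  exact hv.sub_intCast _

theorem irrational_completeQuotient {v : ℝ} (hv : Irrational v) (k : ℕ) :
    Irrational (completeQuotient v k) := by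
  induction k with
  | zero => exact irrational_inv_fract hv
  | succ k ih => exact irrational_inv_fract ih

theorem one_lt_inv_fract {v : ℝ} (hv : Irrational v) : 1 < (Int.fract v)⁻¹ := by
  have h0 : 0 < Int.fract v := Int.fract_pos.2 (hv.ne_int _)
  exact (one_lt_inv₀ h0).2 (Int.fract_lt_one v)

theorem one_lt_completeQuotient {v : ℝ} (hv : Irrational v) (k : ℕ) :
    1 < completeQuotient v k := by
  cases k with
  | zero => exact one_lt_inv_fract hv
  | succ k => exact one_lt_inv_fract (irrational_completeQuotient hv k)

theorem partDens_get?_eq (k : ℕ) : ∀ {v : ℝ}, Irrational v →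
    (GenContFract.of v).partDens.get? k = some (⌊completeQuotient v k⌋ : ℝ) := by
  induction k with
  | zero =>
    intro v hv
    have h0 : Int.fract v ≠ 0 := (Int.fract_pos.2 (hv.ne_int _)).ne'
    have := GenContFract.of_s_head h0
    rw [GenContFract.partDens, Stream'.Seq.map_get?]
    rw [Stream'.Seq.head] at this
    rw [this]; rfl
  | succ k ih =>
    intro v hv
    have := ih (irrational_inv_fract hv)
    rw [GenContFract.partDens, Stream'.Seq.map_get?] at this ⊢
    rw [GenContFract.of_s_succ, this, completeQuotient_inv_fract]

theorem partialQuotient_succ {θ : ℝ} (hθ : Irrational θ) (k : ℕ) :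
    (partialQuotient θ (k + 1) : ℤ) = ⌊completeQuotient θ k⌋ := by
  rw [partialQuotient, partDens_get?_eq k hθ]
  simp only [Option.getD_some]
  rw [Int.natCast_floor_eq_floor, Int.floor_intCast]
  exact_mod_cast Int.floor_nonneg.2 (zero_le_one.trans (one_lt_completeQuotient hθ k).le)

theorem one_le_partialQuotient {θ : ℝ} (hθ : Irrational θ) (k : ℕ) (hk : 1 ≤ k) :
    1 ≤ partialQuotient θ k := by
  obtain ⟨k, rfl⟩ := Nat.exists_eq_add_of_le' hk
  have h : (1 : ℤ) ≤ partialQuotient θ (k + 1) := by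
    rw [partialQuotient_succ hθ]
    exact Int.le_floor.2 (by simpa using (one_lt_completeQuotient hθ k).le)
  exact_mod_cast h

theorem thetaDiff_add_two (a : ℕ → ℕ) (θ : ℝ) (k : ℕ) :
    thetaDiff a θ (k + 2) = a (k + 2) * thetaDiff a θ (k + 1) + thetaDiff a θ k := by
  simp only [thetaDiff, q, p]; push_cast; ring

theorem thetaDiff_zero (a : ℕ → ℕ) (θ : ℝ) : thetaDiff a θ 0 = θ := by simp [thetaDiff, q, p]

theorem thetaDiff_one (a : ℕ → ℕ) (θ : ℝ) : thetaDiff a θ 1 = a 1 * θ - 1 := by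
  simp [thetaDiff, q, p]

section Slope

variable {θ : ℝ} {a : ℕ → ℕ}

theorem fract_completeQuotient (hθ : Irrational θ) (ha : a = partialQuotient θ) (k : ℕ) :
    completeQuotient θ k - a (k + 1) = (completeQuotient θ (k + 1))⁻¹ := by
  have h : ((a (k + 1) : ℤ) : ℝ) = (⌊completeQuotient θ k⌋ : ℝ) := by
    rw [ha, partialQuotient_succ hθ]
  rw [completeQuotient, inv_inv, Int.fract, ← h]; simp

/-- The complete quotients are the ratios of consecutive `|θ_k|`. -/
theorem thetaDiff_succ_mul (hθ : Irrational θ) (h0 : 0 ≤ θ) (h1 : θ < 1)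
    (ha : a = partialQuotient θ) (k : ℕ) :
    thetaDiff a θ (k + 1) * completeQuotient θ (k + 1) = -thetaDiff a θ k := by
  have hne : ∀ k, completeQuotient θ k ≠ 0 := fun k =>
    (zero_lt_one.trans (one_lt_completeQuotient hθ k)).ne'
  induction k with
  | zero =>
    have h := fract_completeQuotient hθ ha 0
    have hc0 : completeQuotient θ 0 * θ = 1 := by
      rw [completeQuotient, Int.fract_eq_self.2 ⟨h0, h1⟩]
      exact inv_mul_cancel₀ hθ.ne_zero
    rw [thetaDiff_zero, thetaDiff_one]
    have h2 : a 1 * θ - 1 = -θ * (completeQuotient θ 1)⁻¹ := by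
      rw [← h]; rw [zero_add]; linarith
    rw [h2, mul_assoc, inv_mul_cancel₀ (hne 1), mul_one]
  | succ k ih =>
    have h := fract_completeQuotient hθ ha (k + 1)
    have h2 : thetaDiff a θ (k + 2) =
        -thetaDiff a θ (k + 1) * (completeQuotient θ (k + 2))⁻¹ := by
      rw [thetaDiff_add_two, ← h]
      linear_combination ih
    rw [show k + 1 + 1 = k + 2 from rfl, h2, mul_assoc, inv_mul_cancel₀ (hne _), mul_one]

theorem thetaDiff_sign (hθ : Irrational θ) (h0 : 0 ≤ θ) (h1 : θ < 1)
    (ha : a = partialQuotient θ) (k : ℕ) : 0 < (-1) ^ k * thetaDiff a θ k := by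
  induction k with
  | zero => rw [thetaDiff_zero]; simpa using lt_of_le_of_ne h0 (Ne.symm hθ.ne_zero)
  | succ k ih =>
    have h := thetaDiff_succ_mul hθ h0 h1 ha k
    have hc := one_lt_completeQuotient hθ (k + 1)
    rw [show thetaDiff a θ k = -(thetaDiff a θ (k + 1) * completeQuotient θ (k + 1)) by linarith]
      at ih
    rw [pow_succ]
    have : 0 < (-1) ^ k * -1 * thetaDiff a θ (k + 1) * completeQuotient θ (k + 1) := by linarith
    exact pos_of_mul_pos_left this (by linarith)

theorem abs_thetaDiff_succ_lt (hθ : Irrational θ) (h0 : 0 ≤ θ) (h1 : θ < 1)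
    (ha : a = partialQuotient θ) (k : ℕ) : |thetaDiff a θ (k + 1)| < |thetaDiff a θ k| := by
  have h := congrArg abs (thetaDiff_succ_mul hθ h0 h1 ha k)
  have hc := one_lt_completeQuotient hθ (k + 1)
  have hp : 0 < |thetaDiff a θ (k + 1)| := abs_pos.2 (by
    have := thetaDiff_sign hθ h0 h1 ha (k + 1)
    rintro h; rw [h] at this; simp at this)
  rw [abs_neg, abs_mul, abs_of_pos (by linarith : 0 < completeQuotient θ (k + 1))] at h
  rw [← h]
  exact lt_mul_of_one_lt_right hp hc

theorem det_pq (a : ℕ → ℕ) (k : ℕ) :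
    |det ((p a (k + 1) : ℤ), (q a (k + 1) : ℤ)) ((p a k : ℤ), (q a k : ℤ))| = 1 := by
  have : det ((p a (k + 1) : ℤ), (q a (k + 1) : ℤ)) ((p a k : ℤ), (q a k : ℤ)) = (-1) ^ k := by
    induction k with
    | zero => simp [det, p, q]
    | succ k ih =>
      rw [pow_succ, ← ih]
      simp only [det, p, q]; push_cast; ring
  rw [this, abs_pow]; simp

theorem thetaDiff_mul_succ_neg (hθ : Irrational θ) (h0 : 0 ≤ θ) (h1 : θ < 1)
    (ha : a = partialQuotient θ) (k : ℕ) : thetaDiff a θ (k + 1) * thetaDiff a θ k < 0 := by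
  have e1 := thetaDiff_sign hθ h0 h1 ha k
  have e2 := thetaDiff_sign hθ h0 h1 ha (k + 1)
  rcases neg_one_pow_eq_or ℝ k with h | h <;> rw [pow_succ, h] at e2 <;> rw [h] at e1 <;> nlinarith

theorem lin_pq (a : ℕ → ℕ) (θ : ℝ) (k : ℕ) :
    lin θ ((p a k : ℤ), (q a k : ℤ)) = thetaDiff a θ k := by simp [lin, thetaDiff]

/-- The convergents of the slope are best approximations. -/
theorem abs_thetaDiff_le (hθ : Irrational θ) (h0 : 0 ≤ θ) (h1 : θ < 1)
    (ha : a = partialQuotient θ) {k n : ℕ} (hn : 1 ≤ n) (hnk : n < q a (k + 1)) (z : ℤ) :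
    |thetaDiff a θ k| ≤ |n * θ - z| := by
  have := abs_lin_le_of_unimodular (ξ := θ) (v := ((p a (k + 1) : ℤ), (q a (k + 1) : ℤ)))
    (w := ((p a k : ℤ), (q a k : ℤ))) (x := (z, (n : ℤ))) (by simp) (by simp) (det_pq a k)
    (by rw [lin_pq, lin_pq]; exact (thetaDiff_mul_succ_neg hθ h0 h1 ha k).le)
    (by simpa using Nat.lt_of_lt_of_le zero_lt_one hn) (by simpa using hnk)
  rw [lin_pq] at this
  simpa [lin] using this

theorem q_mul_abs_thetaDiff_le (hθ : Irrational θ) (h0 : 0 ≤ θ) (h1 : θ < 1)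
    (ha : a = partialQuotient θ) (k : ℕ) : q a (k + 1) * |thetaDiff a θ k| ≤ 1 := by
  have e := det_smul_eq θ ((p a (k + 1) : ℤ), (q a (k + 1) : ℤ)) ((p a k : ℤ), (q a k : ℤ))
  rw [lin_pq, lin_pq] at e
  have hd := det_pq a k
  have hneg := thetaDiff_mul_succ_neg hθ h0 h1 ha k
  have hd' : |(det ((p a (k + 1) : ℤ), (q a (k + 1) : ℤ)) ((p a k : ℤ), (q a k : ℤ)) : ℝ)| = 1 := by
    exact_mod_cast hd
  rw [← abs_neg, ← e] at hd'
  simp only [Int.cast_natCast] at hd'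
  have hq : (0 : ℝ) ≤ q a k := by positivity
  have hq' : (0 : ℝ) ≤ q a (k + 1) := by positivity
  rw [← hd', ← abs_of_nonneg hq', ← abs_mul, abs_of_nonneg hq']
  apply sq_le_sq.1
  nlinarith [mul_nonneg hq hq', sq_nonneg (q a k * thetaDiff a θ (k + 1))]

theorem mul_ne_intCast (hθ : Irrational θ) {n : ℕ} (hn : 1 ≤ n) (z : ℤ) : n * θ ≠ z := by
  have := hθ.natCast_mul (m := n) (by omega)
  exact this.ne_int z

/-- Adding `q_k θ`, which is close to `p_k`, to `n θ` does not cross an integer, because `n θ` is at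
distance at least `|θ_k|` from all of them. -/
theorem floor_add_q_mul (hθ : Irrational θ) (h0 : 0 ≤ θ) (h1 : θ < 1)
    (ha : a = partialQuotient θ) {k n : ℕ} (hn : 1 ≤ n) (hnk : n < q a (k + 1)) :
    ⌊((n + q a k : ℕ) : ℝ) * θ⌋ = ⌊(n : ℝ) * θ⌋ + p a k := by
  have e : ((n + q a k : ℕ) : ℝ) * θ = n * θ + thetaDiff a θ k + p a k := by
    simp only [thetaDiff]; push_cast; ring
  have hfl := Int.floor_le ((n : ℝ) * θ)
  have hfl' := Int.lt_floor_add_one ((n : ℝ) * θ)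
  have hz : thetaDiff a θ k ≠ 0 := by
    have := thetaDiff_sign hθ h0 h1 ha k
    rintro h; rw [h] at this; simp at this
  rw [Int.floor_eq_iff]
  rw [e]; push_cast
  rcases lt_or_gt_of_ne hz with h | h
  · have h2 := abs_thetaDiff_le hθ h0 h1 ha hn hnk ⌊(n : ℝ) * θ⌋
    rw [abs_of_neg h, abs_of_nonneg (by linarith)] at h2
    constructor <;> linarith
  · have h2 := abs_thetaDiff_le hθ h0 h1 ha hn hnk (⌊(n : ℝ) * θ⌋ + 1)
    push_cast at h2
    rw [abs_of_pos h, abs_of_nonpos (by linarith)] at h2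
    have h3 := mul_ne_intCast hθ (n := n + q a k) (by omega) (⌊(n : ℝ) * θ⌋ + 1 + p a k)
    rw [e] at h3; push_cast at h3
    refine ⟨by linarith, lt_of_le_of_ne (by linarith) ?_⟩
    intro h4; apply h3; linarith

/-! ### The characteristic word -/

/-- The letters of the characteristic Sturmian word of slope `θ`, as integers in `{0, 1}`. -/
def charLetter (θ : ℝ) (n : ℕ) : ℤ := ⌊((n + 1 : ℕ) : ℝ) * θ⌋ - ⌊(n : ℝ) * θ⌋

/-- The characteristic word has period `q_k` on its letters of index between `1` and
`q_{k+1} + q_k - 2`. -/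
theorem charLetter_add_q (hθ : Irrational θ) (h0 : 0 ≤ θ) (h1 : θ < 1)
    (ha : a = partialQuotient θ) {k n : ℕ} (hn : 1 ≤ n) (hnk : n + 1 < q a (k + 1)) :
    charLetter θ (n + q a k) = charLetter θ n := by
  rw [charLetter, charLetter, floor_add_q_mul hθ h0 h1 ha hn (by omega),
    show n + q a k + 1 = (n + 1) + q a k by ring,
    floor_add_q_mul hθ h0 h1 ha (by omega) hnk]
  ring

/-- A word of length `n l + m` with period `l` is the `n`-th power of its prefix of length `l`, followed
by its prefix of length `m`. -/
theorem map_range_of_periodic (f : ℕ → ℕ) (l m : ℕ) : ∀ n : ℕ,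
    (∀ i, i + l < n * l + m → f (i + l) = f i) →
    (List.range (n * l + m)).map f =
      wordPow ((List.range l).map f) n ++ (List.range m).map f := by
  intro n
  induction n with
  | zero => intro _; simp [wordPow_zero]
  | succ n ih =>
    intro h
    have ih' := ih (fun i hi => h i (by rw [add_mul]; omega))
    rw [show (n + 1) * l + m = l + (n * l + m) by ring, List.range_add, List.map_append,
      wordPow_succ, List.append_assoc, ← ih', List.map_map]
    congr 1
    apply List.map_congr_left
    intro i hi
    rw [List.mem_range] at hi
    simp only [Function.comp]
    rw [add_comm l i]
    exact h i (by rw [add_mul]; omega)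

theorem a_one_mul_lt (hθ : Irrational θ) (h0 : 0 ≤ θ) (h1 : θ < 1)
    (ha : a = partialQuotient θ) : a 1 * θ < 1 ∧ 1 < (a 1 + 1) * θ := by
  have e := thetaDiff_sign hθ h0 h1 ha 1
  have e' := abs_thetaDiff_succ_lt hθ h0 h1 ha 0
  rw [thetaDiff_one] at e
  rw [zero_add, thetaDiff_one, thetaDiff_zero, abs_of_nonneg h0, abs_of_neg (by linarith)] at e'
  constructor <;> linarith

/-- The letter `n` of the characteristic word over the alphabet `{0, b - 1}`. -/
def charDigit (b : ℕ) (θ : ℝ) (n : ℕ) : ℕ := (b - 1) * (charLetter θ n).toNat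

theorem M_one_eq (hθ : Irrational θ) (h0 : 0 ≤ θ) (h1 : θ < 1)
    (ha : a = partialQuotient θ) (b : ℕ) :
    M b a 1 = (List.range (q a 1)).map (fun i => charDigit b θ (i + 1)) := by
  have ha1 : 1 ≤ a 1 := by rw [ha]; exact one_le_partialQuotient hθ 1 le_rfl
  obtain ⟨hl, hu⟩ := a_one_mul_lt hθ h0 h1 ha
  have hfl : ∀ n : ℕ, n ≤ a 1 → ⌊(n : ℝ) * θ⌋ = 0 := by
    intro n hn
    rw [Int.floor_eq_zero_iff]
    have : (n : ℝ) ≤ a 1 := by exact_mod_cast hn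
    exact ⟨by positivity, by nlinarith⟩
  simp only [q]
  obtain ⟨d, hd⟩ := Nat.exists_eq_add_of_le' ha1
  have hlast : charLetter θ (a 1) = 1 := by
    rw [charLetter, hfl _ le_rfl, sub_zero, Int.floor_eq_iff]
    push_cast
    constructor <;> linarith
  simp only [M, hd, Nat.add_sub_cancel, List.range_succ, List.map_append, List.map_cons,
    List.map_nil]
  congr 1
  · symm
    rw [List.eq_replicate_iff]
    refine ⟨by simp, ?_⟩
    intro c hc
    simp only [List.mem_map, List.mem_range] at hc
    obtain ⟨i, hi, rfl⟩ := hc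
    rw [charDigit, charLetter, hfl _ (by omega), hfl _ (by omega)]; simp
  · rw [charDigit, ← hd, hlast]; simp

theorem M_two_eq (hθ : Irrational θ) (h0 : 0 ≤ θ) (h1 : θ < 1)
    (ha : a = partialQuotient θ) (b : ℕ) :
    M b a 2 = (List.range (q a 2)).map (fun i => charDigit b θ (i + 1)) := by
  have ha1 : 1 ≤ a 1 := by rw [ha]; exact one_le_partialQuotient hθ 1 le_rfl
  have hlast : charLetter θ (q a 2) = 0 := by
    have e2 := thetaDiff_sign hθ h0 h1 ha 2
    have e2' := abs_thetaDiff_succ_lt hθ h0 h1 ha 1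
    obtain ⟨hl, hu⟩ := a_one_mul_lt hθ h0 h1 ha
    have h1' : (1 : ℝ) ≤ a 1 := by exact_mod_cast ha1
    have e2p : 0 < thetaDiff a θ 2 := by simpa using e2
    rw [show 1 + 1 = 2 from rfl, abs_of_pos e2p, thetaDiff_one, abs_of_neg (by linarith)] at e2'
    have e : (q a 2 : ℝ) * θ = p a 2 + thetaDiff a θ 2 := by rw [thetaDiff]; ring
    have f1 : ⌊(q a 2 : ℝ) * θ⌋ = p a 2 := by
      rw [Int.floor_eq_iff, e]; push_cast
      constructor <;> nlinarith
    have f2 : ⌊((q a 2 + 1 : ℕ) : ℝ) * θ⌋ = p a 2 := by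
      rw [Int.floor_eq_iff]; push_cast
      rw [add_mul, e]
      constructor <;> nlinarith
    rw [charLetter, f1, f2, sub_self]
  have hq : q a 2 = a 2 * q a 1 + 1 := by simp [q]
  have hM : M b a 2 = wordPow (M b a 1) (a 2) ++ [0] := by simp [M]
  rw [hM, hq, List.range_succ, List.map_append, ← add_zero (a 2 * q a 1),
    map_range_of_periodic _ _ _ _ (fun i hi => ?_), ← M_one_eq hθ h0 h1 ha]
  · simp only [add_zero, List.map_cons, List.map_nil, List.range_zero, List.append_nil]
    rw [← hq, charDigit, hlast]; simp
  · have := charLetter_add_q hθ h0 h1 ha (k := 1) (n := i + 1) (by omega)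
      (by have : 1 ≤ q a 1 := by simpa [q] using ha1
          show i + 1 + 1 < q a 2
          omega)
    rw [charDigit, charDigit, ← this]; congr 3; ring

/-- The words `M_k`, `k ≥ 1`, are prefixes of the characteristic word. -/
theorem M_eq_map_charDigit (hθ : Irrational θ) (h0 : 0 ≤ θ) (h1 : θ < 1)
    (ha : a = partialQuotient θ) (b k : ℕ) :
    M b a (k + 1) = (List.range (q a (k + 1))).map (fun i => charDigit b θ (i + 1)) := by
  have ha1 : ∀ k, 1 ≤ k → 1 ≤ a k := fun k hk => by rw [ha]; exact one_le_partialQuotient hθ k hk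
  induction k using Nat.twoStepInduction with
  | zero => exact M_one_eq hθ h0 h1 ha b
  | one => exact M_two_eq hθ h0 h1 ha b
  | more k ih1 ih2 =>
    have hq : q a (k + 1 + 2) = a (k + 1 + 2) * q a (k + 1 + 1) + q a (k + 1) := rfl
    have hM : M b a (k + 1 + 2) =
      wordPow (M b a (k + 1 + 1)) (a (k + 1 + 2)) ++ M b a (k + 1) := rfl
    rw [show k + 2 + 1 = k + 1 + 2 from rfl, hM, hq, map_range_of_periodic _ _ _ _ (fun i hi => ?_),
      ih1, ih2]
    have h2 : 2 ≤ q a (k + 1 + 1) := by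
      have : q a (k + 1) + q a k ≤ q a (k + 1 + 1) := q_add_two_ge ha1 k
      have := one_le_q ha1 k
      have := one_le_q ha1 (k + 1)
      omega
    rw [← hq] at hi
    have := charLetter_add_q hθ h0 h1 ha (k := k + 1 + 1) (n := i + 1) (by omega)
      (by show i + 1 + 1 < q a (k + 1 + 2)
          omega)
    rw [charDigit, charDigit, ← this]; congr 3; ring

end Slope

/-! ### The digits of the intercept -/

section

variable {θ ρ : ℝ} {a β : ℕ → ℕ} {s : Side} {b : ℕ}

theorem ostrowskiRules_tailDigits (h1 : ∀ k, 1 ≤ k → 1 ≤ a k) {δ : ℕ → ℕ} {l N : ℕ}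
    (hδ : IsOstrowskiNat a l N δ) : OstrowskiRules a (tailDigits a δ l) := by
  obtain ⟨hd1, hd2, hd3, -⟩ := hδ
  refine ⟨by simpa [tailDigits] using hd1, ?_, ?_⟩
  · intro k hk
    simp only [tailDigits]
    split_ifs with h h'
    · exact hd2 k hk h
    · exact le_rfl
    · exact Nat.zero_le _
  · intro k hk h
    have ha := h1 (k + 1) (by omega)
    simp only [tailDigits] at h ⊢
    rcases lt_trichotomy k (l + 1) with hlt | rfl | hgt
    · rw [if_pos (by omega)] at h
      rw [if_pos (by omega)]
      exact hd3 k hk (by omega) h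
    · rw [if_neg (by omega), if_neg (by rw [show l + 1 + 1 - l = 2 by omega]; decide)] at h
      omega
    · rw [if_neg (by omega)] at h
      rw [if_neg (by omega)]
      split_ifs at h with h'
      · rw [if_neg]
        rw [show k + 1 - l = (k - l) + 1 by omega, Nat.odd_add_one] at h'
        exact h'
      · omega

theorem ostrowskiRules_tailDigits' (h1 : ∀ k, 1 ≤ k → 1 ≤ a k) {δ : ℕ → ℕ} {l m : ℕ}
    (hm2 : 2 ≤ m) (hm : q a l < m) (hm' : m ≤ q a (l + 1))
    (hδ : IsOstrowskiNat a l (q a (l + 1) - m) δ) : OstrowskiRules a (tailDigits' a δ l) := by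
  obtain ⟨hd1, hd2, hd3, hsum⟩ := hδ
  rw [Finset.sum_range_succ] at hsum
  refine ⟨?_, ?_, ?_⟩
  · simp only [tailDigits']
    cases l with
    | zero =>
      simp only [q, zero_add, Finset.range_zero, Finset.sum_empty, mul_one] at hsum hm'
      simp; omega
    | succ l => rw [if_pos (by omega)]; exact hd1
  · intro k hk
    simp only [tailDigits']
    split_ifs with h h' h'' h'''
    · exact hd2 k hk (by omega)
    · obtain ⟨l, rfl⟩ : ∃ l', l = l' + 1 := ⟨l - 1, by omega⟩
      subst h'
      by_contra hcon
      have h2 : a (l + 2) ≤ δ (l + 1 + 1) := by simp only [show l + 1 + 1 = l + 2 from rfl] at *; omega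
      have h3 : a (l + 2) * q a (l + 1) ≤ δ (l + 1 + 1) * q a (l + 1) := Nat.mul_le_mul_right _ h2
      have h4 := q_le_succ h1 l
      have h5 : q a (l + 1 + 1) = a (l + 2) * q a (l + 1) + q a l := rfl
      omega
    · subst h''; omega
    · exact le_rfl
    · exact Nat.zero_le _
  · intro k hk h
    have ha := h1 (k + 1) (by omega)
    simp only [tailDigits'] at h ⊢
    rcases lt_or_ge k l with hlt | hge
    · rw [if_pos (by omega)] at h
      rw [if_pos (by omega)]
      exact hd3 k hk (by omega) h
    rcases eq_or_lt_of_le hge with rfl | hgt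
    · rw [if_neg (by omega), if_pos rfl] at h
      rw [if_pos le_rfl]
      obtain ⟨l, rfl⟩ := Nat.exists_eq_add_of_le' hk
      rw [Finset.sum_range_succ] at hsum
      have h5 : q a (l + 1 + 1) = a (l + 1 + 1) * q a (l + 1) + q a l := rfl
      rw [← h] at h5
      have h6 : (δ (l + 1 + 1) + 1) * q a (l + 1) = δ (l + 1 + 1) * q a (l + 1) + q a (l + 1) := by
        ring
      by_contra hcon
      have h7 : 1 * q a l ≤ δ (l + 1) * q a l := Nat.mul_le_mul_right _ (by omega)
      omega
    rcases eq_or_lt_of_le (Nat.succ_le_of_lt hgt) with rfl | hgt2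
    · rw [if_neg (by omega), if_neg (by omega), if_pos rfl] at h
      simp only [Nat.succ_eq_add_one, show l + 1 + 1 = l + 2 from rfl] at *
      omega
    rcases eq_or_lt_of_le (Nat.succ_le_of_lt hgt2) with rfl | hgt3
    · rw [if_neg (by omega), if_neg (by omega), if_neg (by omega),
        if_neg (by rw [show l.succ.succ + 1 - l = 3 by omega]; decide)] at h
      omega
    · simp only [Nat.succ_eq_add_one] at hgt3
      rw [if_neg (by omega), if_neg (by omega), if_neg (by omega)] at h
      rw [if_neg (by omega), if_neg (by omega), if_neg (by omega)]
      split_ifs at h with h'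
      · rw [if_neg]
        rw [show k + 1 - l = (k - l) + 1 by omega, Nat.even_add_one] at h'
        exact h'
      · omega

theorem ostrowskiRules_zeroDigits (h1 : ∀ k, 1 ≤ k → 1 ≤ a k) :
    OstrowskiRules a (zeroDigits a) := by
  refine ⟨by have := h1 1 le_rfl; simp [zeroDigits]; omega, ?_, ?_⟩
  · intro k hk
    simp only [zeroDigits]
    split_ifs with h h'
    · omega
    · exact le_rfl
    · exact Nat.zero_le _
  · intro k hk h
    have ha := h1 (k + 1) (by omega)
    simp only [zeroDigits] at h ⊢
    rw [if_neg (by omega)] at h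
    split_ifs at h with h'
    · rw [Nat.odd_add_one] at h'
      rw [if_neg (by rintro rfl; exact h' odd_one), if_neg h']
    · omega

theorem ostrowskiRules_zeroDigits' (h1 : ∀ k, 1 ≤ k → 1 ≤ a k) :
    OstrowskiRules a (zeroDigits' a) := by
  refine ⟨by have := h1 1 le_rfl; simp [zeroDigits']; omega, ?_, ?_⟩
  · intro k hk
    simp only [zeroDigits']
    split_ifs <;> simp
  · intro k hk h
    have ha := h1 (k + 1) (by omega)
    simp only [zeroDigits'] at h ⊢
    split_ifs at h with h'
    · rw [Nat.even_add_one] at h'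
      rw [if_neg h']
    · omega

theorem ostrowskiRules_congr {β' : ℕ → ℕ} (h : ∀ k, 1 ≤ k → β k = β' k)
    (hβ : OstrowskiRules a β') : OstrowskiRules a β := by
  refine ⟨by rw [h 1 le_rfl]; exact hβ.1, fun k hk => by rw [h k (by omega)]; exact hβ.2.1 k hk,
    fun k hk => ?_⟩
  rw [h k hk, h (k + 1) (by omega)]; exact hβ.2.2 k hk

theorem IsInterceptDigits.ostrowskiRules (h1 : ∀ k, 1 ≤ k → 1 ≤ a k)
    (h : IsInterceptDigits a s θ ρ β) : OstrowskiRules a β := by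
  rcases h with ⟨-, h, -⟩ | ⟨m, z, l, δ, hm2, -, hm, hm', hδ, h⟩ | ⟨-, h⟩
  · exact h
  · rcases h with ⟨-, h⟩ | ⟨-, h⟩
    · exact ostrowskiRules_congr h (ostrowskiRules_tailDigits h1 hδ)
    · exact ostrowskiRules_congr h (ostrowskiRules_tailDigits' h1 hm2 hm hm' hδ)
  · rcases h with ⟨-, h⟩ | ⟨-, h⟩
    · exact ostrowskiRules_congr h (ostrowskiRules_zeroDigits' h1)
    · exact ostrowskiRules_congr h (ostrowskiRules_zeroDigits h1)

/-- If `ρ - θ = -mθ + z` with `m ≥ 1`, then `t_k = q_k - m` for infinitely many `k`: even ones for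
the lower word and odd ones for the upper word; moreover the digit that follows is `0`. -/
theorem IsInterceptDigits.dichotomy (h1 : ∀ k, 1 ≤ k → 1 ≤ a k)
    (h : IsInterceptDigits a s θ ρ β) :
    ((¬ ∃ (m : ℕ) (z : ℤ), 1 ≤ m ∧ ρ - θ = -(m : ℝ) * θ + (z : ℝ)) ∧
      HasSum (fun k : ℕ => (β (k + 1) : ℝ) * thetaDiff a θ k) (ρ - θ)) ∨
    ∃ (m : ℕ) (z : ℤ), ρ - θ = -(m : ℝ) * θ + (z : ℝ) ∧ ∀ K, ∃ k, K ≤ k ∧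
      t a β k + m = q a k ∧ β (k + 1) = 0 ∧ ((s = Side.lower ∧ Even k) ∨ (s = Side.upper ∧ Odd k)) := by
  -- the pattern `0, a_{j+2}, 0, a_{j+4}, …` propagates the relation `t_j = q_j - m`
  have key : ∀ (m j : ℕ), t a β j + m = q a j →
      (∀ i, β (j + 2 * i + 1) = 0 ∧ β (j + 2 * i + 2) = a (j + 2 * i + 2)) →
      ((s = Side.lower ∧ Even j) ∨ (s = Side.upper ∧ Odd j)) → ∀ K, ∃ k, K ≤ k ∧
      t a β k + m = q a k ∧ β (k + 1) = 0 ∧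
        ((s = Side.lower ∧ Even k) ∨ (s = Side.upper ∧ Odd k)) := by
    intro m j hj hi hs K
    refine ⟨j + 2 * K, by omega, ?_, (hi K).1, ?_⟩
    · induction K with
      | zero => exact hj
      | succ K ih =>
        rw [show j + 2 * (K + 1) = j + 2 * K + 1 + 1 by ring, t_succ, t_succ, (hi K).1,
          show j + 2 * K + 1 + 1 = j + 2 * K + 2 from rfl, (hi K).2]
        simp only [q]; omega
    · rcases hs with ⟨h, h'⟩ | ⟨h, h'⟩
      · exact Or.inl ⟨h, h'.add (even_two_mul K)⟩
      · exact Or.inr ⟨h, h'.add_even (even_two_mul K)⟩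
  rcases h with ⟨h, -, h', -⟩ | ⟨m, z, l, δ, hm2, hz, hm, hm', hδ, h⟩ | ⟨hρ, h⟩
  · exact Or.inl ⟨h, h'⟩
  · right
    refine ⟨m, z, hz, ?_⟩
    have hsum := hδ.2.2.2
    rcases h with ⟨hs, h⟩ | ⟨hs, h⟩
    · apply key m (l + 1)
      · have : t a β (l + 1) = q a (l + 1) - m := by
          rw [hsum, t]
          apply Finset.sum_congr rfl
          intro j hj
          rw [Finset.mem_range] at hj
          rw [h _ (by omega), tailDigits, if_pos (by omega)]
        omega
      · intro i
        constructor
        · rw [h _ (by omega), tailDigits, if_neg (by omega), if_neg]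
          rw [show l + 1 + 2 * i + 1 - l = 2 * (i + 1) by omega, Nat.not_odd_iff_even]
          exact even_two_mul _
        · rw [h _ (by omega), tailDigits, if_neg (by omega), if_pos]
          rw [show l + 1 + 2 * i + 2 - l = 2 * (i + 1) + 1 by omega]
          exact odd_two_mul_add_one _
      · rcases hs with ⟨h, h'⟩ | ⟨h, h'⟩
        · exact Or.inl ⟨h, h'.add_one⟩
        · exact Or.inr ⟨h, h'.add_one⟩
    · apply key m (l + 2)
      · rw [Finset.sum_range_succ] at hsum
        have h2 : t a β l = ∑ j ∈ Finset.range l, δ (j + 1) * q a j := by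
          rw [t]
          apply Finset.sum_congr rfl
          intro j hj
          rw [Finset.mem_range] at hj
          rw [h _ (by omega), tailDigits', if_pos (by omega)]
        obtain ⟨c, hc⟩ := Nat.exists_eq_add_of_le' (h1 (l + 2) (by omega))
        have h3 : β (l + 1) = δ (l + 1) + 1 := by
          rw [h _ (by omega), tailDigits', if_neg (by omega), if_pos rfl]
        have h4 : β (l + 2) = c := by
          rw [h _ (by omega), tailDigits', if_neg (by omega), if_neg (by omega), if_pos rfl, hc,
            Nat.add_sub_cancel]
        rw [show l + 2 = l + 1 + 1 from rfl, t_succ, t_succ, show l + 1 + 1 = l + 2 from rfl, h2, h3,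
          h4]
        simp only [q, hc, add_mul, one_mul]
        omega
      · intro i
        constructor
        · rw [h _ (by omega), tailDigits', if_neg (by omega), if_neg (by omega), if_neg (by omega),
            if_neg]
          rw [show l + 2 + 2 * i + 1 - l = 2 * (i + 1) + 1 by omega, Nat.not_even_iff_odd]
          exact odd_two_mul_add_one _
        · rw [h _ (by omega), tailDigits', if_neg (by omega), if_neg (by omega), if_neg (by omega),
            if_pos]
          rw [show l + 2 + 2 * i + 2 - l = 2 * (i + 2) by omega]
          exact even_two_mul _
      · rcases hs with ⟨h, h'⟩ | ⟨h, h'⟩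
        · exact Or.inl ⟨h, h'.add even_two⟩
        · exact Or.inr ⟨h, h'.add_even even_two⟩
  · right
    refine ⟨1, 0, by rw [hρ]; simp, ?_⟩
    rcases h with ⟨hs, h⟩ | ⟨hs, h⟩
    · apply key 1 0 (by simp [t_zero, q]) _ (Or.inl ⟨hs, Even.zero⟩)
      intro i
      constructor
      · rw [h _ (by omega), zeroDigits', if_neg]
        rw [show 0 + 2 * i + 1 = 2 * i + 1 by ring, Nat.not_even_iff_odd]
        exact odd_two_mul_add_one _
      · rw [h _ (by omega), zeroDigits', if_pos]
        rw [show 0 + 2 * i + 2 = 2 * (i + 1) by ring]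
        exact even_two_mul _
    · apply key 1 1 _ _ (Or.inr ⟨hs, odd_one⟩)
      · have := h1 1 le_rfl
        rw [t_succ, t_zero, zero_add, zero_add, h 1 le_rfl]
        simp [zeroDigits, q]; omega
      intro i
      constructor
      · rw [h _ (by omega), zeroDigits, if_neg (by omega), if_neg]
        rw [show 1 + 2 * i + 1 = 2 * (i + 1) by ring, Nat.not_odd_iff_even]
        exact even_two_mul _
      · rw [h _ (by omega), zeroDigits, if_neg (by omega), if_pos]
        rw [show 1 + 2 * i + 2 = 2 * (i + 1) + 1 by ring]
        exact odd_two_mul_add_one _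

/-- Two consecutive digits are not both maximal. -/
theorem OstrowskiRules.lt_or_lt (h1 : ∀ k, 1 ≤ k → 1 ≤ a k) (hβ : OstrowskiRules a β) (k : ℕ) :
    β (k + 2) < a (k + 2) ∨ β (k + 3) < a (k + 3) := by
  rcases lt_or_eq_of_le (hβ.le (k + 2)) with h | h
  · exact Or.inr h
  · have := hβ.eq_zero (k := k + 1) h
    have := h1 (k + 2) (by omega)
    left
    rw [show k + 1 + 1 = k + 2 from rfl] at *
    omega

/-- The intercepts `(t_k + 1) θ mod 1` of suffixes of the characteristic word approach `ρ`, from the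
side on which the rounding function is continuous if some `n θ + ρ` is an integer. -/
theorem IsInterceptDigits.exists_approx (hθ : Irrational θ) (h0 : 0 ≤ θ) (hθ1 : θ < 1)
    (ha : a = partialQuotient θ) (h : IsInterceptDigits a s θ ρ β) {ε : ℝ} (hε : 0 < ε) (K : ℕ) :
    ∃ (k : ℕ) (z : ℤ), K ≤ k ∧ K ≤ r a β k ∧ |(t a β k + 1) * θ - z - ρ| < ε ∧
      ((∀ (n : ℕ) (z' : ℤ), n * θ + ρ ≠ z') ∨ (s = Side.lower ∧ ρ ≤ (t a β k + 1) * θ - z) ∨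
        (s = Side.upper ∧ (t a β k + 1) * θ - z ≤ ρ)) := by
  have h1 : ∀ k, 1 ≤ k → 1 ≤ a k := fun k hk => by rw [ha]; exact one_le_partialQuotient hθ k hk
  have hβ := h.ostrowskiRules h1
  rcases h.dichotomy h1 with ⟨hno, hsum⟩ | ⟨m, z, hz, hk⟩
  · have hT := hsum.tendsto_sum_nat
    rw [Metric.tendsto_atTop] at hT
    obtain ⟨k1, hk1⟩ := hT ε hε
    obtain ⟨j, hj, hgood⟩ : ∃ j, max K k1 ≤ j ∧ β (j + 2) < a (j + 2) := by
      rcases hβ.lt_or_lt h1 (max K k1) with h | h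
      · exact ⟨_, le_rfl, h⟩
      · exact ⟨max K k1 + 1, by omega, h⟩
    refine ⟨j + 2, ∑ i ∈ Finset.range (j + 2), (β (i + 1) : ℤ) * p a i, ?_, ?_, ?_, Or.inl ?_⟩
    · have := le_max_left K k1; omega
    · rw [r_add_two hβ hgood]
      have := le_max_left K k1
      have := le_q h1 j
      omega
    · have h2 := hk1 (j + 2) (by have := le_max_right K k1; omega)
      rw [Real.dist_eq] at h2
      convert h2 using 2
      have : ∑ i ∈ Finset.range (j + 2), (β (i + 1) : ℝ) * thetaDiff a θ i =
          t a β (j + 2) * θ - ∑ i ∈ Finset.range (j + 2), (β (i + 1) : ℝ) * p a i := by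
        rw [t]; push_cast
        rw [Finset.sum_mul, ← Finset.sum_sub_distrib]
        apply Finset.sum_congr rfl
        intro i _
        rw [thetaDiff]; ring
      rw [this]; push_cast; ring
    · intro n z' hn
      exact hno ⟨n + 1, z', by omega, by push_cast; linarith⟩
  · obtain ⟨N, hN⟩ := exists_nat_gt (1 / ε)
    obtain ⟨k, hk, ht, h00, hs⟩ := hk (max (K + 1) N)
    have hkK := le_max_left (K + 1) N
    have hkN := le_max_right (K + 1) N
    have hteq : t a β (k + 1) = t a β k := t_eq_of_eq_zero h00
    have htr : (t a β k : ℝ) + m = q a k := by exact_mod_cast ht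
    have hval : ((t a β (k + 1) : ℝ) + 1) * θ - ((p a k - z : ℤ) : ℝ) - ρ = thetaDiff a θ k := by
      rw [hteq, thetaDiff, ← htr]; push_cast; linarith
    have hsign := thetaDiff_sign hθ h0 hθ1 ha k
    refine ⟨k + 1, p a k - z, by omega, ?_, ?_, Or.inr ?_⟩
    · obtain ⟨j, rfl⟩ := Nat.exists_eq_add_of_le' (show 1 ≤ k by omega)
      have h2 := q_add_two_ge h1 j
      have h3 := le_q h1 j
      have h4 := t_add_r hβ (j + 1 + 1)
      have h5 : q a (j + 2) = q a (j + 1 + 1) := rfl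
      omega
    · rw [hval]
      have h2 := q_mul_abs_thetaDiff_le hθ h0 hθ1 ha k
      have h3 : (N : ℝ) ≤ q a (k + 1) := by
        have := le_q h1 (k + 1)
        exact_mod_cast (by omega : N ≤ q a (k + 1))
      by_contra hcon
      push Not at hcon
      rw [div_lt_iff₀ hε] at hN
      nlinarith [mul_le_mul h3 hcon hε.le (by positivity)]
    · rcases hs with ⟨hs, he⟩ | ⟨hs, ho⟩
      · left
        rw [he.neg_one_pow] at hsign
        exact ⟨hs, by linarith⟩
      · right
        rw [ho.neg_one_pow] at hsign
        exact ⟨hs, by linarith⟩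

/-! ### The Sturmian number as a limit -/

/-- Away from the integers, the two rounding functions differ from the floor by constants, which
disappear in the letters. -/
theorem Side.round_of_ne (s : Side) : ∃ c : ℤ, ∀ y : ℝ, (∀ z : ℤ, y ≠ z) → s.round y = ⌊y⌋ + c := by
  cases s with
  | lower => exact ⟨0, fun y _ => by simp [Side.round]⟩
  | upper =>
    refine ⟨1, fun y hy => ?_⟩
    rw [Side.round, Int.ceil_eq_iff]
    have := Int.floor_le y
    have := Int.lt_floor_add_one y
    push_cast
    refine ⟨?_, by linarith⟩
    have := lt_of_le_of_ne (Int.floor_le y) (Ne.symm (hy _))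
    linarith

/-- The rounding functions are locally constant away from the integers, and on one side of each
integer. -/
theorem Side.exists_round_eq (s : Side) (x : ℝ) : ∃ ε : ℝ, 0 < ε ∧ ∀ y : ℝ, |y - x| < ε →
    ((∀ z : ℤ, x ≠ z) ∨ (s = Side.lower ∧ x ≤ y) ∨ (s = Side.upper ∧ y ≤ x)) →
    s.round y = s.round x := by
  have hfl := Int.floor_le x
  have hfl' := Int.lt_floor_add_one x
  by_cases hx : ∃ z : ℤ, x = z
  · obtain ⟨z, rfl⟩ := hx
    refine ⟨1, one_pos, fun y hy hs => ?_⟩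
    rw [abs_lt] at hy
    rcases hs with h | ⟨rfl, h⟩ | ⟨rfl, h⟩
    · exact absurd rfl (h z)
    · simp only [Side.round, Int.floor_intCast]
      rw [Int.floor_eq_iff]
      exact ⟨h, by linarith⟩
    · simp only [Side.round, Int.ceil_intCast]
      rw [Int.ceil_eq_iff]
      exact ⟨by linarith, h⟩
  · push Not at hx
    have hlt : (⌊x⌋ : ℝ) < x := lt_of_le_of_ne hfl (Ne.symm (hx _))
    refine ⟨min (x - ⌊x⌋) (⌊x⌋ + 1 - x), lt_min (by linarith) (by linarith), fun y hy _ => ?_⟩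
    rw [lt_min_iff, abs_lt, abs_lt] at hy
    have hyfl : ⌊y⌋ = ⌊x⌋ := by
      rw [Int.floor_eq_iff]; constructor <;> linarith
    obtain ⟨c, hc⟩ := s.round_of_ne
    rw [hc x hx, hc y, hyfl]
    intro z hz
    have h2 : (⌊x⌋ : ℝ) < z := by linarith
    have h3 : (z : ℝ) < ⌊x⌋ + 1 := by linarith
    have h4 : ⌊x⌋ < z := by exact_mod_cast h2
    have h5 : z < ⌊x⌋ + 1 := by exact_mod_cast h3
    omega

/-- The Sturmian word and the word `R_k`, that is the characteristic word after its `t_k` first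
letters, have arbitrarily long common prefixes, for suitable `k`. -/
theorem IsInterceptDigits.exists_prefix (hθ : Irrational θ) (h0 : 0 ≤ θ) (hθ1 : θ < 1)
    (ha : a = partialQuotient θ) (h : IsInterceptDigits a s θ ρ β) (N : ℕ) :
    ∃ k : ℕ, N ≤ k ∧ N ≤ r a β k ∧
      ∀ n < N, letter s θ ρ (n + 1) = charLetter θ (t a β k + n + 1) := by
  choose e he he' using fun n : ℕ => s.exists_round_eq (n * θ + ρ)
  obtain ⟨n0, -, hmin⟩ := Finset.exists_min_image (Finset.range (N + 1)) e ⟨0, by simp⟩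
  obtain ⟨k, z, hk, hr, happ, hside⟩ := h.exists_approx hθ h0 hθ1 ha (he n0) N
  refine ⟨k, hk, hr, fun n hn => ?_⟩
  obtain ⟨c, hc⟩ := s.round_of_ne
  have key : ∀ n : ℕ, n < N + 1 →
      s.round (n * θ + ρ) = ⌊((t a β k + n + 1 : ℕ) : ℝ) * θ⌋ - z + c := by
    intro n hn
    have e1 : (n : ℝ) * θ + ((t a β k + 1) * θ - z) = ((t a β k + n + 1 : ℕ) : ℝ) * θ - z := by
      push_cast; ring
    rw [← he' n (n * θ + ((t a β k + 1) * θ - z)), hc, e1, Int.floor_sub_intCast]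
    · intro z' hz'
      rw [e1] at hz'
      exact mul_ne_intCast hθ (n := t a β k + n + 1) (by omega) (z' + z) (by push_cast at *; linarith)
    · calc _ = |(t a β k + 1) * θ - z - ρ| := by congr 1; ring
        _ < e n0 := happ
        _ ≤ e n := hmin n (Finset.mem_range.2 hn)
    · rcases hside with h | ⟨h, h'⟩ | ⟨h, h'⟩
      · exact Or.inl (h n)
      · exact Or.inr (Or.inl ⟨h, by linarith⟩)
      · exact Or.inr (Or.inr ⟨h, by linarith⟩)
  have k1 := key n (by omega)
  have k2 := key (n + 1) (by omega)
  rw [letter, show ((n + 1 : ℕ) : ℝ) - 1 = n by push_cast; ring, k1, k2, charLetter]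
  simp only [add_assoc]
  ring

theorem charLetter_mem (h0 : 0 ≤ θ) (hθ1 : θ < 1) (n : ℕ) :
    0 ≤ charLetter θ n ∧ charLetter θ n ≤ 1 := by
  have e : ((n + 1 : ℕ) : ℝ) * θ = n * θ + θ := by push_cast; ring
  rw [charLetter, e]
  constructor
  · have := Int.floor_mono (show (n : ℝ) * θ ≤ n * θ + θ by linarith)
    linarith
  · have h2 : ⌊(n : ℝ) * θ + θ⌋ ≤ ⌊(n : ℝ) * θ + 1⌋ := Int.floor_mono (by linarith)
    rw [Int.floor_add_one] at h2
    linarith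

theorem letter_mem (h0 : 0 ≤ θ) (hθ1 : θ < 1) (n : ℕ) :
    0 ≤ letter s θ ρ n ∧ letter s θ ρ n ≤ 1 := by
  rw [letter]
  have e : (n : ℝ) * θ + ρ = ((n : ℝ) - 1) * θ + ρ + θ := by ring
  cases s with
  | lower =>
    simp only [Side.round]
    rw [e]
    constructor
    · have := Int.floor_mono (show ((n : ℝ) - 1) * θ + ρ ≤ ((n : ℝ) - 1) * θ + ρ + θ by linarith)
      linarith
    · have h2 : ⌊((n : ℝ) - 1) * θ + ρ + θ⌋ ≤ ⌊((n : ℝ) - 1) * θ + ρ + 1⌋ :=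
        Int.floor_mono (by linarith)
      rw [Int.floor_add_one] at h2
      linarith
  | upper =>
    simp only [Side.round]
    rw [e]
    constructor
    · have := Int.ceil_mono (show ((n : ℝ) - 1) * θ + ρ ≤ ((n : ℝ) - 1) * θ + ρ + θ by linarith)
      linarith
    · have h2 : ⌈((n : ℝ) - 1) * θ + ρ + θ⌉ ≤ ⌈((n : ℝ) - 1) * θ + ρ + 1⌉ :=
        Int.ceil_mono (by linarith)
      rw [Int.ceil_add_one] at h2
      linarith

theorem sub_one_mul_toNat_lt (hb : 2 ≤ b) {c : ℤ} (h : 0 ≤ c ∧ c ≤ 1) : (b - 1) * c.toNat < b := by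
  have : c.toNat ≤ 1 := by omega
  have := Nat.mul_le_mul_left (b - 1) this
  omega

theorem charDigit_lt (hb : 2 ≤ b) (h0 : 0 ≤ θ) (hθ1 : θ < 1) (n : ℕ) : charDigit b θ n < b :=
  sub_one_mul_toNat_lt hb (charLetter_mem h0 hθ1 _)

theorem sturmianNumber_eq_ofDigits (hb : 2 ≤ b) (h0 : 0 ≤ θ) (hθ1 : θ < 1) :
    sturmianNumber b s θ ρ = Real.ofDigits (fun n : ℕ =>
      (⟨(b - 1) * (letter s θ ρ (n + 1)).toNat,
        sub_one_mul_toNat_lt hb (letter_mem h0 hθ1 _)⟩ : Fin b)) := by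
  rw [sturmianNumber, Real.ofDigits, ← tsum_mul_left]
  congr 1
  ext n
  rw [Real.ofDigitsTerm]
  have h := (letter_mem (s := s) (ρ := ρ) h0 hθ1 (n + 1)).1
  have h2 : ((letter s θ ρ (n + 1)).toNat : ℝ) = letter s θ ρ (n + 1) := by
    exact_mod_cast Int.toNat_of_nonneg h
  push_cast [show 1 ≤ b by omega]
  rw [h2]; ring

theorem wordValue_map_range (hb : 2 ≤ b) (f : ℕ → ℕ) (n : ℕ) :
    (wordValue b ((List.range n).map f) : ℝ) / b ^ n =
      ∑ i ∈ Finset.range n, (f i : ℝ) * ((b : ℝ) ^ (i + 1))⁻¹ := by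
  have hb0 : (b : ℝ) ≠ 0 := by exact_mod_cast (by omega : b ≠ 0)
  induction n with
  | zero => simp [wordValue]
  | succ n ih =>
    rw [Finset.sum_range_succ, ← ih, List.range_succ, List.map_append, wordValue,
      List.reverse_append, Nat.ofDigits_append, wordValue]
    simp only [List.map_cons, List.map_nil, List.reverse_cons, List.reverse_nil, List.nil_append,
      List.length_singleton, Nat.ofDigits_singleton]
    push_cast
    field_simp
    ring

theorem wordValue_div_eq_ofDigits (hb : 2 ≤ b) (f : ℕ → ℕ) (hf : ∀ i, f i < b) (n : ℕ) :
    (wordValue b ((List.range n).map f) : ℝ) / b ^ n =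
      Real.ofDigits (fun i => if i < n then (⟨f i, hf i⟩ : Fin b) else ⟨0, by omega⟩) := by
  rw [wordValue_map_range hb, Real.ofDigits_eq_sum_add_ofDigits _ n]
  have h : Real.ofDigits (fun i => if i + n < n then (⟨f (i + n), hf (i + n)⟩ : Fin b)
      else ⟨0, by omega⟩) = 0 := by
    rw [Real.ofDigits]
    simp [Real.ofDigitsTerm]
  rw [h, mul_zero, add_zero]
  apply Finset.sum_congr rfl
  intro i hi
  rw [Finset.mem_range] at hi
  simp [Real.ofDigitsTerm, hi]

/-- The Sturmian number is approached by the rationals `0.R_k`. -/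
theorem IsInterceptDigits.exists_abs_sub_le (hθ : Irrational θ) (h0 : 0 ≤ θ) (hθ1 : θ < 1)
    (ha : a = partialQuotient θ) (h : IsInterceptDigits a s θ ρ β) (hb : 2 ≤ b) (N : ℕ) :
    ∃ k : ℕ, N ≤ k ∧ N ≤ r a β (k + 1) ∧ |sturmianNumber b s θ ρ -
      (wordValue b (R b a β (k + 1)) : ℝ) / b ^ r a β (k + 1)| ≤ ((b : ℝ) ^ N)⁻¹ := by
  have h1 : ∀ k, 1 ≤ k → 1 ≤ a k := fun k hk => by rw [ha]; exact one_le_partialQuotient hθ k hk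
  have hβ := h.ostrowskiRules h1
  obtain ⟨k, hk, hr, hlet⟩ := h.exists_prefix hθ h0 hθ1 ha (N + 1)
  obtain ⟨k, rfl⟩ := Nat.exists_eq_add_of_le' (show 1 ≤ k by omega)
  refine ⟨k, by omega, by omega, ?_⟩
  have hR : R b a β (k + 1) =
      (List.range (r a β (k + 1))).map (fun i => charDigit b θ (t a β (k + 1) + i + 1)) := by
    rw [R, M_eq_map_charDigit hθ h0 hθ1 ha, ← t_add_r hβ, List.range_add, List.map_append,
      List.drop_left']
    · rw [List.map_map]; rfl
    · simp
  rw [hR, wordValue_div_eq_ofDigits hb _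
    (fun i => charDigit_lt hb h0 hθ1 _),
    sturmianNumber_eq_ofDigits hb h0 hθ1]
  apply Real.abs_ofDigits_sub_ofDigits_le
  intro i hi
  rw [if_pos (by omega)]
  simp only [hlet i (by omega)]
  rfl

theorem sturmianNumber_mem (hb : 2 ≤ b) (h0 : 0 ≤ θ) (hθ1 : θ < 1) :
    0 ≤ sturmianNumber b s θ ρ ∧ sturmianNumber b s θ ρ ≤ 1 := by
  rw [sturmianNumber_eq_ofDigits hb h0 hθ1]
  exact ⟨Real.ofDigits_nonneg _, Real.ofDigits_le_one _⟩

end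

/-! ### Nested cones -/

section

variable {b : ℕ} {a β : ℕ → ℕ} {ξ : ℝ}

/-- The vectors that are nonnegative integral combinations of the vectors of `(4)_k` and `(3)_k`. -/
def InCone (b : ℕ) (a β : ℕ → ℕ) (k : ℕ) (v : ℤ × ℤ) : Prop :=
  ∃ m n : ℤ, 0 ≤ m ∧ 0 ≤ n ∧ v = m • vec4 b a β k + n • vec3 b a β k

theorem inCone_vec4 (k : ℕ) : InCone b a β k (vec4 b a β k) := ⟨1, 0, by simp, by simp, by simp⟩

theorem inCone_vec3 (k : ℕ) : InCone b a β k (vec3 b a β k) := ⟨0, 1, by simp, by simp, by simp⟩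

theorem InCone.combine {k : ℕ} {v w : ℤ × ℤ} (hv : InCone b a β k v) (hw : InCone b a β k w)
    {m n : ℤ} (hm : 0 ≤ m) (hn : 0 ≤ n) : InCone b a β k (m • v + n • w) := by
  obtain ⟨m1, n1, h1, h2, rfl⟩ := hv
  obtain ⟨m2, n2, h3, h4, rfl⟩ := hw
  exact ⟨m * m1 + n * m2, m * n1 + n * n2, by positivity, by positivity, by module⟩

theorem InCone.trans {j k : ℕ} {v : ℤ × ℤ} (h4 : InCone b a β k (vec4 b a β j))
    (h3 : InCone b a β k (vec3 b a β j)) (hv : InCone b a β j v) : InCone b a β k v := by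
  obtain ⟨m, n, hm, hn, rfl⟩ := hv
  exact h4.combine h3 hm hn

theorem inCone_vec4_of (hβ : OstrowskiRules a β) {j k : ℕ} (h2 : InCone b a β k (vec2 b a β j))
    (h3 : InCone b a β k (vec3 b a β j)) : InCone b a β k (vec4 b a β j) := by
  rw [vec4_eq hβ, ← one_smul ℤ (vec2 b a β j)]
  exact h3.combine h2 (mul_nonneg (by positivity) (geom_nonneg _ _ _)) zero_le_one

theorem inCone_succ (hβ : OstrowskiRules a β) (hb : 2 ≤ b) {k : ℕ} (h : β (k + 2) < a (k + 2)) :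
    InCone b a β k (vec4 b a β (k + 1)) ∧ InCone b a β k (vec3 b a β (k + 1)) := by
  have h1 : InCone b a β k (vec1 b a β (k + 1)) := by
    rw [vec1_succ_eq hβ h, ← one_smul ℤ (vec3 b a β k)]
    exact (inCone_vec4 k).combine (inCone_vec3 k)
      (mul_nonneg (by positivity) (geom_nonneg _ _ _)) zero_le_one
  have h2 : InCone b a β k (vec2 b a β (k + 1)) := by
    rw [vec2_eq hβ, ← one_smul ℤ (vec4 b a β k)]
    exact h1.combine (inCone_vec4 k) (by positivity) zero_le_one
  have h3 : InCone b a β k (vec3 b a β (k + 1)) := by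
    rw [vec3_eq hβ]
    refine h1.combine (inCone_vec4 k) ?_ (by positivity)
    have : (1 : ℤ) ≤ (b : ℤ) ^ q a (k + 1) := one_le_pow₀ (by exact_mod_cast (by omega : 1 ≤ b))
    linarith
  exact ⟨inCone_vec4_of hβ h2 h3, h3⟩

theorem inCone_add_two (hβ : OstrowskiRules a β) {k : ℕ} (h : β (k + 3) = a (k + 3)) :
    InCone b a β k (vec4 b a β (k + 2)) ∧ InCone b a β k (vec3 b a β (k + 2)) := by
  have h2 : InCone b a β k (vec2 b a β (k + 2)) := by
    rw [vec2_of_eq hβ h]; exact inCone_vec4 k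
  have h3 : InCone b a β k (vec3 b a β (k + 2)) := by
    rw [vec3_of_eq hβ h, ← one_smul ℤ (vec3 b a β k)]
    refine (inCone_vec4 k).combine ?_ (mul_nonneg (by positivity) (geom_nonneg _ _ _)) zero_le_one
    exact inCone_vec3 k
  exact ⟨inCone_vec4_of hβ h2 h3, h3⟩

/-- When `b_{k+2}` is not maximal, the cone of index `k` contains all the later ones. -/
theorem inCone_of_le (hβ : OstrowskiRules a β) (hb : 2 ≤ b) {k : ℕ} (h : β (k + 2) < a (k + 2))
    (j : ℕ) : InCone b a β k (vec4 b a β (k + j)) ∧ InCone b a β k (vec3 b a β (k + j)) := by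
  induction j using Nat.twoStepInduction with
  | zero => exact ⟨inCone_vec4 k, inCone_vec3 k⟩
  | one => exact inCone_succ hβ hb h
  | more j ih1 ih2 =>
    rcases lt_or_eq_of_le (hβ.le (k + j + 2)) with hlt | heq
    · have := inCone_succ (k := k + (j + 1)) hβ hb hlt
      exact ⟨InCone.trans ih2.1 ih2.2 this.1, InCone.trans ih2.1 ih2.2 this.2⟩
    · have := inCone_add_two (b := b) (k := k + j) hβ heq
      exact ⟨InCone.trans ih1.1 ih1.2 this.1, InCone.trans ih1.1 ih1.2 this.2⟩

theorem le_of_mem_M (k : ℕ) : ∀ d ∈ M b a k, d ≤ b - 1 := by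
  induction k using Nat.twoStepInduction with
  | zero => simp [M]
  | one =>
    intro d hd
    simp only [M, List.mem_append, List.mem_replicate, List.mem_singleton] at hd
    rcases hd with ⟨-, rfl⟩ | rfl <;> simp
  | more k ih1 ih2 =>
    intro d hd
    simp only [M, wordPow, List.mem_append, List.mem_flatten, List.mem_replicate] at hd
    rcases hd with ⟨l, ⟨-, rfl⟩, hd⟩ | hd
    · exact ih2 d hd
    · exact ih1 d hd

theorem vec_fst_le_snd {W : List ℕ} (h : ∀ d ∈ W, d ≤ b - 1) : (vec b W).1 ≤ (vec b W).2 := by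
  induction W with
  | nil => simp [vec_nil]
  | cons d W ih =>
    have h1 : (vec b [d]).1 ≤ (vec b [d]).2 := by
      have := Nat.div_le_of_le_mul (show d ≤ (b - 1) * 1 by simpa using h d (by simp))
      simp only [vec, wordValue, repunit, List.map_cons, List.map_nil, List.reverse_singleton,
        Nat.ofDigits_singleton, List.length_singleton, Finset.sum_range_one, pow_zero]
      exact_mod_cast this
    rw [← List.singleton_append, vec_append]
    have h2 := ih (fun d hd => h d (by simp [hd]))
    simp only [Prod.fst_add, Prod.snd_add, Prod.smul_fst, Prod.smul_snd, smul_eq_mul]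
    have h3 : (0 : ℤ) ≤ (b : ℤ) ^ W.length := by positivity
    nlinarith

theorem vec_fst_nonneg (W : List ℕ) : 0 ≤ (vec b W).1 := by simp [vec]

theorem vec3_snd_pos (hβ : OstrowskiRules a β) (h1 : ∀ k, 1 ≤ k → 1 ≤ a k) (hb : 2 ≤ b) (k : ℕ) :
    0 < (vec3 b a β k).2 := by
  rw [vec3_snd hβ]
  have := repunit_pos hb (one_le_q h1 k)
  have hb' : (0 : ℤ) < b := by exact_mod_cast (by omega : 0 < b)
  positivity

/-- The base-`b` expansion of `(3)_k` is `R_{k+1}` followed by a periodic tail, so that it agrees with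
`0.R_{k+1}` up to `b^(-r_{k+1})`. -/
theorem abs_vec3_sub_le (hβ : OstrowskiRules a β) (h1 : ∀ k, 1 ≤ k → 1 ≤ a k) (hb : 2 ≤ b) (k : ℕ) :
    |((vec3 b a β k).1 : ℝ) / (vec3 b a β k).2 -
      (wordValue b (R b a β (k + 1)) : ℝ) / b ^ r a β (k + 1)| ≤ ((b : ℝ) ^ r a β (k + 1))⁻¹ := by
  have hb' : (0 : ℝ) < b := by exact_mod_cast (by omega : 0 < b)
  have hg : (0 : ℝ) < repunit b (q a k) := by exact_mod_cast repunit_pos hb (one_le_q h1 k)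
  have hM : (vec b (M b a k)).2 = repunit b (q a k) := by simp [vec, length_M (h1 1 le_rfl)]
  have hm0 : (0 : ℝ) ≤ (vec b (M b a k)).1 := by exact_mod_cast vec_fst_nonneg _
  have hm1 : ((vec b (M b a k)).1 : ℝ) ≤ repunit b (q a k) := by
    rw [← hM]; exact_mod_cast vec_fst_le_snd (le_of_mem_M k)
  have hR : (wordValue b (R b a β (k + 1)) : ℝ) = (b - 1) * ((vec b (R b a β (k + 1))).1 : ℝ) := by
    exact_mod_cast wordValue_eq hb (dvd_of_mem_R (β := β) (k + 1))
  have hP : ((vec3 b a β k).1 : ℝ) =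
      (b - 1) * repunit b (q a k) * (vec b (R b a β (k + 1))).1 + (vec b (M b a k)).1 := by
    have e : (vec3 b a β k).1 =
        ((b : ℤ) - 1) * repunit b (q a k) * (vec b (R b a β (k + 1))).1 + (vec b (M b a k)).1 := by
      rw [mul_repunit, vec3, vec_append, length_M (h1 1 le_rfl)]
      simp only [Prod.fst_sub, Prod.fst_add, Prod.smul_fst, smul_eq_mul]; ring
    exact_mod_cast e
  have hpow : (0 : ℝ) < (b : ℝ) ^ r a β (k + 1) := by positivity
  rw [vec3_snd hβ, hP, hR]
  push_cast
  have e : ((b - 1) * repunit b (q a k) * (vec b (R b a β (k + 1))).1 + (vec b (M b a k)).1 : ℝ) /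
      ((b : ℝ) ^ r a β (k + 1) * repunit b (q a k)) -
      (b - 1) * (vec b (R b a β (k + 1))).1 / (b : ℝ) ^ r a β (k + 1) =
      ((b : ℝ) ^ r a β (k + 1))⁻¹ * ((vec b (M b a k)).1 / repunit b (q a k)) := by
    field_simp; ring
  rw [e, abs_of_nonneg (by positivity)]
  exact mul_le_of_le_one_right (by positivity) (div_le_one_of_le₀ hm1 hg.le)

/-- If `b_{k+2}` is not maximal, then `ξ` lies between `(3)_k` and `(4)_k`. -/
theorem position {θ ρ : ℝ} {s : Side} (hθ : Irrational θ) (h0 : 0 ≤ θ) (hθ1 : θ < 1)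
    (ha : a = partialQuotient θ) (h : IsInterceptDigits a s θ ρ β) (hb : 2 ≤ b)
    (hξ : ξ = sturmianNumber b s θ ρ) {k : ℕ} (hk : β (k + 2) < a (k + 2)) :
    0 ≤ -((-1) ^ k * lin ξ (vec4 b a β k)) ∧ 0 ≤ (-1) ^ k * lin ξ (vec3 b a β k) := by
  have h1 : ∀ k, 1 ≤ k → 1 ≤ a k := fun k hk => by rw [ha]; exact one_le_partialQuotient hθ k hk
  have hβ := h.ostrowskiRules h1
  have hb1 : (1 : ℝ) < b := by exact_mod_cast (by omega : 1 < b)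
  -- rationals of the cone that are arbitrarily close to `ξ`
  have happ : ∀ ε : ℝ, 0 < ε → ∃ m n Q x : ℝ, 0 ≤ m ∧ 0 ≤ n ∧ 0 < Q ∧ |x| ≤ ε ∧
      ξ = (m * (vec4 b a β k).1 + n * (vec3 b a β k).1) / Q + x ∧
      Q = m * (vec4 b a β k).2 + n * (vec3 b a β k).2 := by
    intro ε hε
    obtain ⟨N, hN⟩ := exists_pow_lt_of_lt_one (show 0 < ε / 2 by linarith) (inv_lt_one_of_one_lt₀ hb1)
    obtain ⟨j, hj, hr, hle⟩ := h.exists_abs_sub_le hθ h0 hθ1 ha hb (max N k)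
    obtain ⟨i, rfl⟩ := Nat.exists_eq_add_of_le (le_trans (le_max_right N k) hj)
    obtain ⟨m, n, hm, hn, hv⟩ := (inCone_of_le hβ hb hk i).2
    have h2 := abs_vec3_sub_le hβ h1 hb (k + i)
    have hpos := vec3_snd_pos hβ h1 hb (k + i)
    have hN' : ((b : ℝ) ^ max N k)⁻¹ ≤ ε / 2 := by
      refine le_trans ?_ hN.le
      rw [inv_pow]
      exact inv_anti₀ (by positivity) (pow_le_pow_right₀ hb1.le (le_max_left _ _))
    have hr' : ((b : ℝ) ^ r a β (k + i + 1))⁻¹ ≤ ((b : ℝ) ^ max N k)⁻¹ :=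
      inv_anti₀ (by positivity) (pow_le_pow_right₀ hb1.le hr)
    rw [← hξ] at hle
    refine ⟨m, n, (vec3 b a β (k + i)).2,
      ξ - ((vec3 b a β (k + i)).1 : ℝ) / (vec3 b a β (k + i)).2,
      by exact_mod_cast hm, by exact_mod_cast hn, by exact_mod_cast hpos, ?_, ?_, ?_⟩
    · rw [abs_le] at *; constructor <;> linarith
    · have e : (m * (vec4 b a β k).1 + n * (vec3 b a β k).1 : ℝ) = ((vec3 b a β (k + i)).1 : ℝ) := by
        rw [hv]; simp
      rw [e]; ring
    · rw [hv]; simp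
  have hdet : ((vec4 b a β k).1 * (vec3 b a β k).2 - (vec4 b a β k).2 * (vec3 b a β k).1 : ℝ) =
      (-1) ^ k := by
    have := det_vec4_vec3 (b := b) hβ hb k
    rw [det] at this
    exact_mod_cast this
  have hQ4 : (0 : ℝ) < (vec4 b a β k).2 := by
    rw [vec4_snd hβ]; exact_mod_cast repunit_pos hb (one_le_q h1 _)
  have hQ3 : (0 : ℝ) < (vec3 b a β k).2 := by exact_mod_cast vec3_snd_pos hβ h1 hb k
  have hε : ((-1 : ℝ) ^ k) * (-1) ^ k = 1 := by rw [← mul_pow]; simp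
  have habs : |(-1 : ℝ) ^ k| = 1 := by rw [abs_pow]; simp
  -- each form vanishes at its own vector, so that only the coefficient of the other one contributes
  set e : ℝ := (-1) ^ k with he
  simp only [lin]
  generalize ((vec4 b a β k).1 : ℝ) = P4 at *
  generalize ((vec4 b a β k).2 : ℝ) = Q4 at *
  generalize ((vec3 b a β k).1 : ℝ) = P3 at *
  generalize ((vec3 b a β k).2 : ℝ) = Q3 at *
  constructor
  · apply le_of_forall_pos_le_add
    intro δ hδ
    obtain ⟨m, n, Q, x, hm, hn, hQ, hx, hξ', hQe⟩ := happ (δ / Q4) (by positivity)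
    have hx' : Q4 * |x| ≤ δ := by rwa [le_div_iff₀' hQ4] at hx
    have h3 : e * (Q4 * ξ - P4) = -(n / Q) + e * x * Q4 := by
      rw [hξ']; field_simp; rw [hQe]; linear_combination (-e * n) * hdet - n * hε
    have h4 : e * x * Q4 ≤ Q4 * |x| := by
      have : e * x ≤ |x| := by
        calc e * x ≤ |e * x| := le_abs_self _
          _ = |x| := by rw [abs_mul, habs, one_mul]
      nlinarith
    have h5 : 0 ≤ n / Q := by positivity
    linarith
  · apply le_of_forall_pos_le_add
    intro δ hδ
    obtain ⟨m, n, Q, x, hm, hn, hQ, hx, hξ', hQe⟩ := happ (δ / Q3) (by positivity)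
    have hx' : Q3 * |x| ≤ δ := by rwa [le_div_iff₀' hQ3] at hx
    have h3 : e * (Q3 * ξ - P3) = m / Q + e * x * Q3 := by
      rw [hξ']; field_simp; rw [hQe]; linear_combination (-e * -m) * hdet + m * hε
    have h4 : -(Q3 * |x|) ≤ e * x * Q3 := by
      have : -|x| ≤ e * x := by
        calc -|x| = -|e * x| := by rw [abs_mul, habs, one_mul]
          _ ≤ e * x := neg_abs_le _
      nlinarith
    have h5 : 0 ≤ m / Q := by positivity
    linarith

end

/-! ### Sizes of the linear forms -/

section

/-- The properties of the data on which the study of the four families rests. -/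
structure Setting (b : ℕ) (a β : ℕ → ℕ) (ξ : ℝ) : Prop where
  two_le : 2 ≤ b
  one_le_a : ∀ k, 1 ≤ k → 1 ≤ a k
  rules : OstrowskiRules a β
  nonneg : 0 ≤ ξ
  le_one : ξ ≤ 1
  position : ∀ k, β (k + 2) < a (k + 2) →
    0 ≤ -((-1) ^ k * lin ξ (vec4 b a β k)) ∧ 0 ≤ (-1) ^ k * lin ξ (vec3 b a β k)

/-- The linear form at the vector of `(4)_k`, with the sign that makes it nonnegative when `b_{k+2}`
is not maximal. -/
def form4 (b : ℕ) (a β : ℕ → ℕ) (ξ : ℝ) (k : ℕ) : ℝ := -((-1) ^ k * lin ξ (vec4 b a β k))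

/-- The linear form at the vector of `(3)_k`, with the sign that makes it nonnegative when `b_{k+2}`
is not maximal. -/
def form3 (b : ℕ) (a β : ℕ → ℕ) (ξ : ℝ) (k : ℕ) : ℝ := (-1) ^ k * lin ξ (vec3 b a β k)

/-- The linear form at the vector of `(2)_k`, with the sign that makes it nonnegative when `b_{k+2}`
is not maximal. -/
def form2 (b : ℕ) (a β : ℕ → ℕ) (ξ : ℝ) (k : ℕ) : ℝ := -((-1) ^ k * lin ξ (vec2 b a β k))

/-- The linear form at the vector of `(1)_{k+1}`, with the sign that makes it nonnegative when
`b_{k+3}` is not maximal. -/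
def form1 (b : ℕ) (a β : ℕ → ℕ) (ξ : ℝ) (k : ℕ) : ℝ := (-1) ^ k * lin ξ (vec1 b a β (k + 1))

variable {b : ℕ} {a β : ℕ → ℕ} {ξ : ℝ}

theorem neg_one_pow_mul_self (k : ℕ) : ((-1 : ℝ) ^ k) * (-1) ^ k = 1 := by rw [← mul_pow]; simp

theorem abs_neg_one_pow_mul (k : ℕ) (x : ℝ) : |(-1 : ℝ) ^ k * x| = |x| := by
  rw [abs_mul, abs_pow]; simp

theorem abs_form4 (k : ℕ) : |lin ξ (vec4 b a β k)| = |form4 b a β ξ k| := by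
  rw [form4, abs_neg, abs_neg_one_pow_mul]

theorem abs_form3 (k : ℕ) : |lin ξ (vec3 b a β k)| = |form3 b a β ξ k| := by
  rw [form3, abs_neg_one_pow_mul]

theorem abs_form2 (k : ℕ) : |lin ξ (vec2 b a β k)| = |form2 b a β ξ k| := by
  rw [form2, abs_neg, abs_neg_one_pow_mul]

theorem abs_form1 (k : ℕ) : |lin ξ (vec1 b a β (k + 1))| = |form1 b a β ξ k| := by
  rw [form1, abs_neg_one_pow_mul]

theorem neg_one_pow_mul_mul (k : ℕ) (x y : ℝ) : ((-1) ^ k * x) * ((-1) ^ k * y) = x * y := by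
  linear_combination x * y * neg_one_pow_mul_self k

namespace Setting

/-- The coefficient of `(3)_k` in `(4)_k`. -/
def coeff43 (b : ℕ) (a β : ℕ → ℕ) (k : ℕ) : ℤ := (b : ℤ) ^ t a β k * geom b (β (k + 1)) (q a k)

/-- The coefficient of `(4)_k` in `(1)_{k+1}`. -/
def coeff14 (b : ℕ) (a β : ℕ → ℕ) (k : ℕ) : ℤ :=
  (b : ℤ) ^ (r a β (k + 1) + q a k) * geom b (a (k + 2) - β (k + 2) - 1) (q a (k + 1))

/-- The coefficient of `(4)_k` in `(3)_{k+2}` when `b_{k+3}` is maximal. -/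
def coeff34 (b : ℕ) (a β : ℕ → ℕ) (k : ℕ) : ℤ :=
  (b : ℤ) ^ (r a β (k + 1) + q a k) * geom b (a (k + 2)) (q a (k + 1))

theorem coeff43_nonneg (b : ℕ) (a β : ℕ → ℕ) (k : ℕ) : (0 : ℝ) ≤ coeff43 b a β k := by
  have : 0 ≤ coeff43 b a β k := mul_nonneg (by positivity) (geom_nonneg _ _ _)
  exact_mod_cast this

theorem coeff14_nonneg (b : ℕ) (a β : ℕ → ℕ) (k : ℕ) : (0 : ℝ) ≤ coeff14 b a β k := by
  have : 0 ≤ coeff14 b a β k := mul_nonneg (by positivity) (geom_nonneg _ _ _)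
  exact_mod_cast this

variable (S : Setting b a β ξ)
include S

theorem form2_eq (k : ℕ) :
    form2 b a β ξ k = form4 b a β ξ k + coeff43 b a β k * form3 b a β ξ k := by
  rw [form2, form4, form3, vec4_eq S.rules, lin_add, lin_smul, coeff43]; ring

/-- The determinant of the vectors of `(2)_k` and `(3)_k`, expressed through the linear forms. When
both forms are nonnegative, both terms lie in `[0, 1]`. -/
theorem snd_vec3_mul_form2 (k : ℕ) :
    (vec3 b a β k).2 * form2 b a β ξ k + (vec2 b a β k).2 * form3 b a β ξ k = 1 := by
  have h := det_smul_eq ξ (vec2 b a β k) (vec3 b a β k)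
  rw [det_vec2_vec3 S.rules S.two_le] at h
  push_cast at h
  rw [form2, form3]
  linear_combination (-(-1) ^ k) * h + neg_one_pow_mul_self k

theorem snd_vec3_mul_form4 (k : ℕ) :
    (vec3 b a β k).2 * form4 b a β ξ k + (vec4 b a β k).2 * form3 b a β ξ k = 1 := by
  have h := det_smul_eq ξ (vec4 b a β k) (vec3 b a β k)
  rw [det_vec4_vec3 S.rules S.two_le] at h
  push_cast at h
  rw [form4, form3]
  linear_combination (-(-1) ^ k) * h + neg_one_pow_mul_self k

theorem pow_q_eq (k : ℕ) : (b : ℝ) ^ q a k = (b : ℝ) ^ t a β k * (b : ℝ) ^ r a β k := by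
  rw [← pow_add, t_add_r S.rules]

theorem form2_succ (k : ℕ) : form2 b a β ξ (k + 1) =
    (b : ℝ) ^ t a β (k + 1) * form1 b a β ξ k - form4 b a β ξ k := by
  rw [form2, form1, form4, vec2_eq S.rules, lin_add, lin_smul, pow_succ]; push_cast; ring

theorem form3_succ (k : ℕ) : form3 b a β ξ (k + 1) =
    (b : ℝ) ^ r a β (k + 1) * form4 b a β ξ k -
      ((b : ℝ) ^ q a (k + 1) - 1) * form1 b a β ξ k := by
  rw [form3, form1, form4, vec3_eq S.rules, lin_add, lin_smul, lin_smul, pow_succ]; push_cast; ring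

theorem form1_eq (k : ℕ) : form1 b a β ξ k =
    (b : ℝ) ^ r a β (k + 1) * form2 b a β ξ (k + 1) + form3 b a β ξ (k + 1) := by
  rw [S.form2_succ, S.form3_succ, S.pow_q_eq]; ring

theorem form4_eq (k : ℕ) : form4 b a β ξ k =
    ((b : ℝ) ^ q a (k + 1) - 1) * form2 b a β ξ (k + 1) +
      (b : ℝ) ^ t a β (k + 1) * form3 b a β ξ (k + 1) := by
  rw [S.form2_succ, S.form3_succ, S.pow_q_eq]; ring

theorem form3_eq {k : ℕ} (h : β (k + 2) < a (k + 2)) :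
    form3 b a β ξ k = form1 b a β ξ k + coeff14 b a β k * form4 b a β ξ k := by
  rw [form3, form1, form4, vec1_succ_eq S.rules h, lin_add, lin_smul, coeff14]; ring

theorem form4_eq_of_eq {k : ℕ} (h : β (k + 3) = a (k + 3)) :
    form4 b a β ξ k = form2 b a β ξ (k + 2) := by
  rw [form4, form2, vec2_of_eq S.rules h, pow_add]; ring

theorem form3_eq_of_eq {k : ℕ} (h : β (k + 3) = a (k + 3)) :
    form3 b a β ξ k = form3 b a β ξ (k + 2) + coeff34 b a β k * form4 b a β ξ k := by
  rw [form3, form3, form4, vec3_of_eq S.rules h, lin_add, lin_smul, pow_add, coeff34]; ring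

theorem cast_two_le : (2 : ℝ) ≤ b := by exact_mod_cast S.two_le

theorem one_le_pow (n : ℕ) : (1 : ℝ) ≤ (b : ℝ) ^ n :=
  one_le_pow₀ (by have := S.cast_two_le; linarith)

theorem two_le_pow {n : ℕ} (hn : 0 < n) : (2 : ℝ) ≤ (b : ℝ) ^ n :=
  S.cast_two_le.trans (le_self_pow₀ (by have := S.cast_two_le; linarith) hn.ne')

theorem int_one_le_pow (n : ℕ) : (1 : ℤ) ≤ (b : ℤ) ^ n :=
  one_le_pow₀ (by exact_mod_cast (by have := S.two_le; omega : 1 ≤ b))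

theorem one_le_coeff43 {k : ℕ} (h : 1 ≤ β (k + 1)) : (1 : ℝ) ≤ coeff43 b a β k := by
  have h1 := one_le_geom b (q a k) h
  have h2 := S.int_one_le_pow (t a β k)
  have : 1 ≤ coeff43 b a β k := by rw [coeff43]; nlinarith
  exact_mod_cast this

theorem two_le_coeff43 {k : ℕ} (h : 1 ≤ β (k + 1)) (ht : 0 < t a β k) :
    (2 : ℝ) ≤ coeff43 b a β k := by
  have h1 : (1 : ℝ) ≤ geom b (β (k + 1)) (q a k) := by exact_mod_cast one_le_geom b (q a k) h
  have h2 := S.two_le_pow ht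
  rw [coeff43]; push_cast; nlinarith

theorem one_le_coeff14 {k : ℕ} (h : β (k + 2) + 2 ≤ a (k + 2)) : (1 : ℝ) ≤ coeff14 b a β k := by
  have h1 := one_le_geom b (q a (k + 1)) (show 1 ≤ a (k + 2) - β (k + 2) - 1 by omega)
  have h2 := S.int_one_le_pow (r a β (k + 1) + q a k)
  have : 1 ≤ coeff14 b a β k := by rw [coeff14]; nlinarith
  exact_mod_cast this

theorem coeff14_add_one_le {k : ℕ} (h : β (k + 2) = 0) :
    (coeff14 b a β k : ℝ) + 1 ≤ coeff34 b a β k := by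
  obtain ⟨c, hc⟩ := Nat.exists_eq_add_of_le' (S.one_le_a (k + 2) (by omega))
  have h1 := S.int_one_le_pow (r a β (k + 1) + q a k)
  have h2 : (1 : ℤ) ≤ ((b : ℤ) ^ q a (k + 1)) ^ c := one_le_pow₀ (S.int_one_le_pow _)
  have : coeff14 b a β k + 1 ≤ coeff34 b a β k := by
    rw [coeff14, coeff34, h, hc, Nat.sub_zero, Nat.add_sub_cancel, geom_succ]; nlinarith
  exact_mod_cast this

theorem one_le_coeff34 (k : ℕ) : (1 : ℝ) ≤ coeff34 b a β k := by
  have h1 := one_le_geom b (q a (k + 1)) (S.one_le_a (k + 2) (by omega))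
  have h2 := S.int_one_le_pow (r a β (k + 1) + q a k)
  have : 1 ≤ coeff34 b a β k := by rw [coeff34]; nlinarith
  exact_mod_cast this

/-- Two consecutive digits are not both maximal. -/
theorem lt_of_eq {k : ℕ} (h : β (k + 3) = a (k + 3)) :
    β (k + 2) = 0 ∧ β (k + 2) < a (k + 2) ∧ β (k + 4) < a (k + 4) := by
  have h0 := S.rules.eq_zero (k := k + 1) h
  have h1 := S.one_le_a (k + 2) (by omega)
  have h2 := S.one_le_a (k + 3) (by omega)
  rw [show k + 1 + 1 = k + 2 from rfl] at h0
  refine ⟨h0, by omega, ?_⟩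
  rcases lt_or_eq_of_le (S.rules.le (k + 3)) with h3 | h3
  · exact h3
  · have := S.rules.eq_zero (k := k + 2) h3
    rw [show k + 2 + 1 = k + 3 from rfl] at this
    omega

theorem form4_nonneg {k : ℕ} (h : β (k + 2) < a (k + 2)) : 0 ≤ form4 b a β ξ k := (S.position k h).1

theorem form3_nonneg {k : ℕ} (h : β (k + 2) < a (k + 2)) : 0 ≤ form3 b a β ξ k := (S.position k h).2

theorem form2_nonneg {k : ℕ} (h : β (k + 2) < a (k + 2)) : 0 ≤ form2 b a β ξ k := by
  rw [S.form2_eq]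
  have := S.form4_nonneg h
  have := mul_nonneg (coeff43_nonneg b a β k) (S.form3_nonneg h)
  linarith

theorem form2_pos_or {k : ℕ} (h : β (k + 2) < a (k + 2)) :
    0 < form2 b a β ξ k ∨ 0 < form3 b a β ξ k := by
  by_contra hcon
  push Not at hcon
  have h1 := le_antisymm hcon.1 (S.form2_nonneg h)
  have h2 := le_antisymm hcon.2 (S.form3_nonneg h)
  have := S.snd_vec3_mul_form2 k
  rw [h1, h2] at this
  simp at this

theorem form1_pos {k : ℕ} (h : β (k + 3) < a (k + 3)) : 0 < form1 b a β ξ k := by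
  rw [S.form1_eq]
  have h1 := S.form2_nonneg (k := k + 1) h
  have h2 := S.form3_nonneg (k := k + 1) h
  have h3 := S.one_le_pow (r a β (k + 1))
  rcases S.form2_pos_or (k := k + 1) h with h4 | h4 <;> nlinarith

theorem two_le_q (k : ℕ) : 2 ≤ q a (k + 2) := by
  have := q_add_two_ge S.one_le_a k
  have := one_le_q S.one_le_a k
  have := one_le_q S.one_le_a (k + 1)
  omega

/-- When `t_{k+1} > 0`, the number `(1)_{k+1}` is a better approximation than `(4)_k`. -/
theorem form1_lt_form4 {k : ℕ} (h : β (k + 3) < a (k + 3)) (ht : 0 < t a β (k + 1)) :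
    form1 b a β ξ k < form4 b a β ξ k := by
  rw [S.form1_eq, S.form4_eq, S.pow_q_eq]
  have h1 := S.form2_nonneg (k := k + 1) h
  have h2 := S.form3_nonneg (k := k + 1) h
  have h3 := S.two_le_pow (r_pos S.rules (k + 1))
  have h5 := S.two_le_pow ht
  have e1 : 0 < (b : ℝ) ^ t a β (k + 1) * (b : ℝ) ^ r a β (k + 1) - 1 -
    (b : ℝ) ^ r a β (k + 1) := by nlinarith
  have e2 : 0 < (b : ℝ) ^ t a β (k + 1) - 1 := by linarith
  rcases S.form2_pos_or (k := k + 1) h with h4 | h4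
  · nlinarith [mul_pos e1 h4, mul_nonneg e2.le h2]
  · nlinarith [mul_nonneg e1.le h1, mul_pos e2 h4]

theorem form4_pos (k : ℕ) : 0 < form4 b a β ξ k := by
  rcases lt_or_eq_of_le (S.rules.le (k + 2)) with hlt | heq
  · rw [S.form4_eq]
    have h1 := S.form2_nonneg (k := k + 1) hlt
    have h2 := S.form3_nonneg (k := k + 1) hlt
    have h3 := S.two_le_pow (one_le_q S.one_le_a (k + 1))
    have h5 := S.one_le_pow (t a β (k + 1))
    rcases S.form2_pos_or (k := k + 1) hlt with h4 | h4 <;> nlinarith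
  · rw [show k + 2 + 1 = k + 3 from rfl] at heq
    have hg := (S.lt_of_eq heq).2.2
    rw [S.form4_eq_of_eq heq, S.form2_eq]
    have h1 := S.form4_nonneg (k := k + 2) hg
    have h2 := S.form3_nonneg (k := k + 2) hg
    have h3 := S.one_le_coeff43 (k := k + 2) (by
      have := S.one_le_a (k + 3) (by omega)
      rw [show k + 2 + 1 = k + 3 from rfl, heq]; exact this)
    by_contra hcon
    have h4 : form3 b a β ξ (k + 2) = 0 := by nlinarith
    have h5 := S.form2_eq (k + 2)
    rcases S.form2_pos_or (k := k + 2) hg with h6 | h6 <;> linarith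

/-- When the next step is not `b_{k+2} = a_{k+2} - 1`, `(4)_k` is a better approximation
than `(3)_k`. -/
theorem form4_lt_form3 {k : ℕ} (h : β (k + 2) < a (k + 2))
    (h' : β (k + 3) = a (k + 3) ∨ β (k + 2) + 2 ≤ a (k + 2)) :
    form4 b a β ξ k < form3 b a β ξ k := by
  have h4 := S.form4_pos k
  have hbad : β (k + 3) = a (k + 3) → form4 b a β ξ k < form3 b a β ξ k := by
    intro heq
    have hg := (S.lt_of_eq heq).2.2
    rw [S.form3_eq_of_eq heq]
    have h1 := S.one_le_coeff34 k
    have h2 : 0 < form3 b a β ξ (k + 2) := by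
      have hp := S.form4_pos (k + 2)
      have := S.form3_nonneg (k := k + 2) hg
      rcases lt_or_eq_of_le (S.rules.le (k + 4)) with hlt | heq'
      · rw [S.form3_eq hg]
        have := S.form1_pos (k := k + 2) hlt
        have := mul_nonneg (coeff14_nonneg b a β (k + 2)) hp.le
        linarith
      · rw [S.form3_eq_of_eq heq']
        have h5 := S.form3_nonneg (k := k + 2 + 2) (S.lt_of_eq (k := k + 2) heq').2.2
        have h6 := S.one_le_coeff34 (k + 2)
        nlinarith
    nlinarith
  rcases lt_or_eq_of_le (S.rules.le (k + 2)) with hlt | heq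
  · rcases h' with h' | h'
    · exact hbad h'
    · rw [S.form3_eq h]
      have h1 := S.form1_pos (k := k) hlt
      have h2 := S.one_le_coeff14 h'
      nlinarith
  · exact hbad heq

theorem form3_pos {k : ℕ} (h : β (k + 2) < a (k + 2)) : 0 < form3 b a β ξ k := by
  rcases lt_or_eq_of_le (S.rules.le (k + 2)) with hlt | heq
  · rw [S.form3_eq h]
    have h1 := S.form1_pos (k := k) hlt
    have h2 := mul_nonneg (coeff14_nonneg b a β k) (S.form4_pos k).le
    linarith
  · exact (S.form4_pos k).trans (S.form4_lt_form3 h (Or.inl heq))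

theorem form2_pos {k : ℕ} (h : β (k + 2) < a (k + 2)) : 0 < form2 b a β ξ k := by
  rw [S.form2_eq]
  have := S.form4_pos k
  have := mul_nonneg (coeff43_nonneg b a β k) (S.form3_pos h).le
  linarith

/-! ### Sizes of the denominators -/

/-- The repunit of length `n` lies between `b^(n-1)` and `b^n`. -/
theorem repunit_bounds {n : ℕ} (hn : 0 < n) :
    (repunit b n : ℝ) ≤ (b : ℝ) ^ n ∧ (b : ℝ) ^ n ≤ b * repunit b n := by
  obtain ⟨n, rfl⟩ := Nat.exists_eq_add_of_le' hn
  constructor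
  · have := repunit_le S.two_le (n + 1)
    exact_mod_cast (by linarith : repunit b (n + 1) ≤ (b : ℤ) ^ (n + 1))
  · have h : (b : ℝ) ^ n ≤ repunit b (n + 1) := by exact_mod_cast le_repunit_succ b n
    rw [pow_succ]
    have := S.cast_two_le
    nlinarith

theorem vec2_snd_bounds (k : ℕ) :
    ((vec2 b a β k).2 : ℝ) ≤ (b : ℝ) ^ (r a β (k + 1) + t a β k) ∧
      (b : ℝ) ^ (r a β (k + 1) + t a β k) ≤ b * (vec2 b a β k).2 := by
  rw [vec2_snd S.rules]
  exact S.repunit_bounds (by have := r_pos S.rules (k + 1); omega)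

theorem vec4_snd_bounds (k : ℕ) :
    ((vec4 b a β k).2 : ℝ) ≤ (b : ℝ) ^ q a (k + 1) ∧
      (b : ℝ) ^ q a (k + 1) ≤ b * (vec4 b a β k).2 := by
  rw [vec4_snd S.rules]
  exact S.repunit_bounds (one_le_q S.one_le_a _)

theorem vec3_snd_bounds (k : ℕ) :
    ((vec3 b a β k).2 : ℝ) ≤ (b : ℝ) ^ (r a β (k + 1) + q a k) ∧
      (b : ℝ) ^ (r a β (k + 1) + q a k) ≤ b * (vec3 b a β k).2 := by
  rw [vec3_snd S.rules]
  have h := S.repunit_bounds (one_le_q S.one_le_a k)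
  have h2 := S.one_le_pow (r a β (k + 1))
  push_cast
  rw [pow_add]
  constructor
  · nlinarith [h.1]
  · nlinarith [h.2]

theorem vec1_snd_bounds {k : ℕ} (h : r a β k < r a β (k + 1)) :
    ((vec1 b a β k).2 : ℝ) ≤ (b : ℝ) ^ r a β (k + 1) ∧
      (b : ℝ) ^ r a β (k + 1) ≤ b * (vec1 b a β k).2 := by
  rw [vec1_snd S.rules]
  obtain ⟨d, hd⟩ := Nat.exists_eq_add_of_lt h
  have h1 := S.repunit_bounds (n := r a β (k + 1)) (by omega)
  have h0 : (0 : ℝ) ≤ repunit b (r a β k) := by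
    have : 0 ≤ repunit b (r a β k) := by unfold repunit; positivity
    exact_mod_cast this
  push_cast
  refine ⟨by linarith [h1.1], ?_⟩
  have h2 : (repunit b (r a β k) : ℝ) ≤ repunit b (r a β k + d) := by
    rcases Nat.eq_zero_or_pos d with rfl | hd0
    · simp
    · exact_mod_cast (repunit_lt S.two_le (by omega)).le
  have h3 : repunit b (r a β k + d + 1) = (b : ℤ) ^ (r a β k + d) + repunit b (r a β k + d) := by
    rw [repunit, Finset.sum_range_succ, add_comm, repunit]
  have h4 : (repunit b (r a β k + d + 1) : ℝ) =
      (b : ℝ) ^ (r a β k + d) + repunit b (r a β k + d) := by exact_mod_cast h3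
  rw [hd, h4, pow_succ]
  have := S.cast_two_le
  nlinarith

theorem vec4_snd_pos (k : ℕ) : 0 < (vec4 b a β k).2 := by
  rw [vec4_snd S.rules]; exact repunit_pos S.two_le (one_le_q S.one_le_a _)

theorem vec2_snd_pos (k : ℕ) : 0 < (vec2 b a β k).2 := by
  rw [vec2_snd S.rules]
  exact repunit_pos S.two_le (by have := r_pos S.rules (k + 1); omega)

theorem vec2_snd_lt_vec3_snd (k : ℕ) : (vec2 b a β k).2 < (vec3 b a β k).2 := by
  rw [vec2_snd S.rules, vec3_snd S.rules]
  have h : repunit b (r a β (k + 1) + q a k) =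
      (b : ℤ) ^ r a β (k + 1) * repunit b (q a k) + repunit b (r a β (k + 1)) := by
    rw [add_comm, repunit_add]
  have h1 : repunit b (r a β (k + 1) + t a β k) ≤ (b : ℤ) ^ (r a β (k + 1) + t a β k) - 1 :=
    repunit_le S.two_le _
  obtain ⟨d, hd⟩ := Nat.exists_eq_add_of_lt (t_lt_q S.rules k)
  have h2 := le_repunit_succ b (t a β k + d)
  rw [hd]
  have h3 : (b : ℤ) ^ (r a β (k + 1) + t a β k) ≤
      (b : ℤ) ^ r a β (k + 1) * (b : ℤ) ^ (t a β k + d) := by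
    rw [← pow_add]
    exact pow_le_pow_right₀ (by exact_mod_cast (by have := S.two_le; omega : 1 ≤ b)) (by omega)
  have h4 : (b : ℤ) ^ r a β (k + 1) * (b : ℤ) ^ (t a β k + d) ≤
      (b : ℤ) ^ r a β (k + 1) * repunit b (t a β k + d + 1) :=
    mul_le_mul_of_nonneg_left h2 (by positivity)
  linarith

theorem vec3_snd_lt_vec4_snd {k : ℕ} (h : 1 ≤ β (k + 1)) : (vec3 b a β k).2 < (vec4 b a β k).2 := by
  rw [vec4_eq S.rules]
  have h1 := one_le_geom b (q a k) h
  have h2 := S.int_one_le_pow (t a β k)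
  have h3 := vec3_snd_pos S.rules S.one_le_a S.two_le k
  have h4 := S.vec2_snd_pos k
  simp only [Prod.snd_add, Prod.smul_snd, smul_eq_mul]
  nlinarith [mul_pos (by linarith : (0 : ℤ) < (b : ℤ) ^ t a β k)
    (by linarith : 0 < geom b (β (k + 1)) (q a k)),
    show 1 ≤ (b : ℤ) ^ t a β k * geom b (β (k + 1)) (q a k) by nlinarith]

theorem vec4_eq_vec2 {k : ℕ} (h : β (k + 1) = 0) : vec4 b a β k = vec2 b a β k := by
  rw [vec4_eq S.rules, h, geom_zero]; simp

theorem vec1_succ_eq_vec3 {k : ℕ} (h : a (k + 2) = β (k + 2) + 1) :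
    vec1 b a β (k + 1) = vec3 b a β k := by
  rw [vec1_succ_eq S.rules (by omega), h, Nat.add_sub_cancel_left, Nat.sub_self, geom_zero]; simp

theorem r_lt_r {k : ℕ} (h : β (k + 2) < a (k + 2)) : r a β (k + 1) < r a β (k + 2) := by
  rw [r_add_two S.rules h]
  have := one_le_q S.one_le_a k
  omega

theorem r_le_r {k : ℕ} (h : β (k + 2) = a (k + 2)) : r a β (k + 2) ≤ r a β (k + 1) := by
  rw [r_add_two_of_eq S.rules h]
  have h1 := t_add_r S.rules k
  have h2 := t_add_r S.rules (k + 1)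
  rw [t_eq_of_eq_zero (S.rules.eq_zero h)] at h2
  have := q_le_succ S.one_le_a k
  omega

theorem vec3_snd_le_vec1_snd {k : ℕ} (h : β (k + 2) < a (k + 2)) :
    (vec3 b a β k).2 ≤ (vec1 b a β (k + 1)).2 := by
  rw [vec1_succ_eq S.rules h]
  simp only [Prod.snd_add, Prod.smul_snd, smul_eq_mul]
  have := mul_nonneg (mul_nonneg (show (0 : ℤ) ≤ (b : ℤ) ^ (r a β (k + 1) + q a k) by positivity)
    (geom_nonneg b (a (k + 2) - β (k + 2) - 1) (q a (k + 1)))) (S.vec4_snd_pos k).le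
  linarith

theorem vec1_snd_pos {k : ℕ} (h : β (k + 2) < a (k + 2)) : 0 < (vec1 b a β (k + 1)).2 :=
  (vec3_snd_pos S.rules S.one_le_a S.two_le k).trans_le (S.vec3_snd_le_vec1_snd h)

theorem vec4_snd_lt_vec2_snd {k : ℕ} (h : β (k + 2) < a (k + 2)) :
    (vec4 b a β k).2 < (vec2 b a β (k + 1)).2 := by
  rw [vec2_eq S.rules]
  simp only [Prod.snd_add, Prod.smul_snd, smul_eq_mul]
  have := mul_pos (show (0 : ℤ) < (b : ℤ) ^ t a β (k + 1) by
    have := S.int_one_le_pow (t a β (k + 1)); linarith) (S.vec1_snd_pos h)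
  linarith

end Setting

end

/-! ### From linear forms to exponents -/

section

variable {b : ℕ} {a β : ℕ → ℕ} {ξ : ℝ}

namespace Setting

variable (S : Setting b a β ξ)
include S

/-- A vector of denominator about `b^h` whose linear form has size about `b^(-h')` has
exponent `(h + h') / h`. The two-sided bounds in the hypotheses are those available for all four
families, and the constants are what they give for the height and the distance to `ξ`; the
determinant serves to ensure that the fraction is in lowest terms. -/
theorem hasExponent {v w : ℤ × ℤ} (hdet : |det v w| = 1) {h h' : ℕ} {μ : ℝ}
    (hμ : (h : ℝ) * μ = h + h') (hQ : 0 < v.2)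
    (hv : (v.2 : ℝ) ≤ (b : ℝ) ^ h ∧ (b : ℝ) ^ h ≤ b * v.2)
    (hL : 1 / 2 ≤ (b : ℝ) ^ h' * |lin ξ v| ∧ (b : ℝ) ^ h' * |lin ξ v| ≤ 2 * b) :
    HasExponent (1 / (2 * b)) (4 * b ^ 2) b ξ (toRat v) h μ := by
  obtain ⟨hn, hd⟩ := toRat_num_den hQ hdet
  have hb := S.cast_two_le
  have hb0 : (0 : ℝ) < b := by linarith
  have hQ1 : (1 : ℝ) ≤ v.2 := by exact_mod_cast hQ
  have hQ0 : (0 : ℝ) < v.2 := by linarith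
  have hB : (0 : ℝ) < (b : ℝ) ^ h := by positivity
  have hB' := S.one_le_pow h'
  have hB'0 : (0 : ℝ) < (b : ℝ) ^ h' := by positivity
  obtain ⟨hv1, hv2⟩ := hv
  obtain ⟨hL1, hL2⟩ := hL
  have hden : ((toRat v).den : ℝ) = v.2 := by exact_mod_cast congrArg (Int.cast (R := ℝ)) hd
  have hnum : ((toRat v).num.natAbs : ℝ) = |(v.1 : ℝ)| := by
    rw [hn, Nat.cast_natAbs]; push_cast; rfl
  have hLle : |lin ξ v| ≤ 2 * b := by
    have := abs_nonneg (lin ξ v)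
    nlinarith
  have hP : |(v.1 : ℝ)| ≤ (1 + 2 * b) * v.2 := by
    have e : (v.1 : ℝ) = v.2 * ξ - lin ξ v := by simp [lin]
    have h1 : |(v.1 : ℝ)| ≤ |v.2 * ξ| + |lin ξ v| := by rw [e]; exact abs_sub _ _
    have h2 : |v.2 * ξ| ≤ v.2 := by
      rw [abs_of_nonneg (mul_nonneg hQ0.le S.nonneg)]
      exact mul_le_of_le_one_right hQ0.le S.le_one
    nlinarith
  have hheight : (height (toRat v) : ℝ) = max |(v.1 : ℝ)| v.2 := by
    rw [height]; push_cast [hden]; rw [← hnum]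
  have hx : |ξ - (toRat v : ℝ)| = |lin ξ v| / v.2 := by
    have : ξ - (toRat v : ℝ) = lin ξ v / v.2 := by
      simp only [toRat, lin]; push_cast; field_simp
    rw [this, abs_div, abs_of_pos hQ0]
  have hpow : (b : ℝ) ^ (-((h : ℝ) * μ)) = ((b : ℝ) ^ h * (b : ℝ) ^ h')⁻¹ := by
    rw [hμ, Real.rpow_neg hb0.le, Real.rpow_add hb0, Real.rpow_natCast, Real.rpow_natCast]
  refine ⟨⟨?_, ?_⟩, ?_, ?_⟩
  · rw [hheight]
    refine le_trans ?_ (le_max_right _ _)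
    rw [div_mul_eq_mul_div, one_mul, div_le_iff₀ (by positivity)]
    nlinarith
  · rw [hheight]
    apply max_le
    · refine hP.trans ?_
      refine mul_le_mul ?_ hv1 hQ0.le (by positivity)
      nlinarith
    · have : (1 : ℝ) ≤ 4 * b ^ 2 := by nlinarith
      nlinarith
  · rw [hx, hpow, div_mul_eq_mul_div, one_mul, inv_eq_one_div, div_div, div_le_div_iff₀ (by positivity) hQ0]
    have h1 : (b : ℝ) ^ h ≤ (b : ℝ) ^ h * (2 * ((b : ℝ) ^ h' * |lin ξ v|)) := by nlinarith
    nlinarith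
  · rw [hx, hpow, ← div_eq_mul_inv, div_le_div_iff₀ hQ0 (by positivity)]
    have h1 : |lin ξ v| * ((b : ℝ) ^ h * (b : ℝ) ^ h') ≤ 2 * b * (b : ℝ) ^ h := by nlinarith
    nlinarith

theorem mul_nu1 (k : ℕ) : (r a β (k + 1) : ℝ) * nu1 a β k =
    (r a β (k + 1) : ℕ) + ((r a β (k + 1) + t a β k : ℕ) : ℝ) := by
  have h : (0 : ℝ) < r a β (k + 1) := by exact_mod_cast r_pos S.rules (k + 1)
  rw [nu1]; push_cast; field_simp

theorem mul_nu2 (k : ℕ) : ((r a β (k + 1) + t a β k : ℕ) : ℝ) * nu2 a β k =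
    ((r a β (k + 1) + t a β k : ℕ) : ℝ) + ((r a β (k + 1) + q a k : ℕ) : ℝ) := by
  have h : (0 : ℝ) < r a β (k + 1) := by exact_mod_cast r_pos S.rules (k + 1)
  rw [nu2]; push_cast; field_simp

theorem mul_nu3 (k : ℕ) : ((r a β (k + 1) + q a k : ℕ) : ℝ) * nu3 a β k =
    ((r a β (k + 1) + q a k : ℕ) : ℝ) + (q a (k + 1) : ℝ) := by
  have h : (0 : ℝ) < r a β (k + 1) := by exact_mod_cast r_pos S.rules (k + 1)
  rw [nu3]; push_cast; field_simp

theorem mul_nu4 (k : ℕ) : (q a (k + 1) : ℝ) * nu4 a β k =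
    (q a (k + 1) : ℝ) + (r a β (k + 2) : ℝ) := by
  have h : (0 : ℝ) < q a (k + 1) := by exact_mod_cast one_le_q S.one_le_a (k + 1)
  rw [nu4]; field_simp

theorem abs_det_vec4_vec3 (k : ℕ) : |det (vec4 b a β k) (vec3 b a β k)| = 1 := by
  rw [det_vec4_vec3 S.rules S.two_le, abs_pow]; simp

theorem abs_det_vec3_vec4 (k : ℕ) : |det (vec3 b a β k) (vec4 b a β k)| = 1 := by
  rw [← S.abs_det_vec4_vec3 k, ← abs_neg]; congr 1; simp only [det]; ring

theorem abs_det_vec2_vec3 (k : ℕ) : |det (vec2 b a β k) (vec3 b a β k)| = 1 := by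
  rw [det_vec2_vec3 S.rules S.two_le, abs_pow]; simp

theorem abs_det_vec3_vec2 (k : ℕ) : |det (vec3 b a β k) (vec2 b a β k)| = 1 := by
  rw [← S.abs_det_vec2_vec3 k, ← abs_neg]; congr 1; simp only [det]; ring

theorem abs_det_vec1_vec4 {k : ℕ} (h : β (k + 2) < a (k + 2)) :
    |det (vec1 b a β (k + 1)) (vec4 b a β k)| = 1 := by
  have := det_vec4_vec1 (b := b) S.rules S.two_le h
  have e : det (vec1 b a β (k + 1)) (vec4 b a β k) = -(-1) ^ k := by
    rw [← this]; simp only [det]; ring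
  rw [e, abs_neg, abs_pow]; simp

theorem form2_mul_le (k : ℕ) (h : β (k + 2) < a (k + 2)) :
    ((vec3 b a β k).2 : ℝ) * form2 b a β ξ k ≤ 1 := by
  have h1 := S.snd_vec3_mul_form2 k
  have h2 : (0 : ℝ) < (vec2 b a β k).2 := by exact_mod_cast S.vec2_snd_pos k
  have := mul_nonneg h2.le (S.form3_nonneg h)
  linarith

/-! ### The first family -/

theorem isConvergent_vec1 {k : ℕ} (h : β (k + 2) < a (k + 2)) (h' : β (k + 3) < a (k + 3))
    (ht : 0 < t a β (k + 1)) : IsConvergent ξ (toRat (vec1 b a β (k + 1))) := by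
  have hlt := S.form1_lt_form4 h' ht
  have hpos := S.form1_pos h'
  refine isConvergent_of_unimodular (w := vec4 b a β k) ?_ (S.vec4_snd_pos k).le
    (S.abs_det_vec1_vec4 h) ?_ ?_
  · refine le_trans ?_ (S.vec3_snd_le_vec1_snd h)
    have h1 := S.vec2_snd_lt_vec3_snd k
    have h2 := S.vec2_snd_pos k
    omega
  · have : lin ξ (vec1 b a β (k + 1)) * lin ξ (vec4 b a β k) =
        -(form1 b a β ξ k * form4 b a β ξ k) := by
      rw [form1, form4, mul_neg, neg_neg, neg_one_pow_mul_mul]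
    rw [this]
    have := mul_pos hpos (hpos.trans hlt)
    linarith
  · rw [abs_form1, abs_form4, abs_of_pos hpos, abs_of_pos (hpos.trans hlt)]
    exact hlt

theorem hasExponent_vec1 {k : ℕ} (h : β (k + 2) < a (k + 2)) (h' : β (k + 3) < a (k + 3)) :
    HasExponent (1 / (2 * b)) (4 * b ^ 2) b ξ (toRat (vec1 b a β (k + 1)))
      (r a β (k + 2)) (nu1 a β (k + 1)) := by
  refine S.hasExponent (S.abs_det_vec1_vec4 h) (S.mul_nu1 (k + 1)) (S.vec1_snd_pos h)
    (S.vec1_snd_bounds (S.r_lt_r h)) ?_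
  rw [abs_form1, abs_of_pos (S.form1_pos h')]
  have hb := S.cast_two_le
  have hbd := S.vec2_snd_bounds (k + 1)
  have h2 := S.form2_nonneg (k := k + 1) h'
  have h3 := S.form3_nonneg (k := k + 1) h'
  have h1 := S.snd_vec3_mul_form2 (k + 1)
  have hle := S.form2_mul_le (k + 1) h'
  -- `Q₃ = b^r Q₂ - Q₁` and `Q₁ ≤ Q₂`
  have hrel : ((vec3 b a β (k + 1)).2 : ℝ) =
      (b : ℝ) ^ r a β (k + 1) * (vec2 b a β (k + 1)).2 - (vec1 b a β (k + 1)).2 := by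
    have e : (vec3 b a β (k + 1)).2 =
        (b : ℤ) ^ r a β (k + 1) * (vec2 b a β (k + 1)).2 - (vec1 b a β (k + 1)).2 := by
      rw [vec3_eq S.rules, vec2_eq S.rules, ← t_add_r S.rules, pow_add]
      simp only [Prod.snd_add, Prod.smul_snd, smul_eq_mul]; ring
    exact_mod_cast e
  have hQ1 : (0 : ℝ) < (vec1 b a β (k + 1)).2 := by exact_mod_cast S.vec1_snd_pos h
  have hQ4 : (0 : ℝ) < (vec4 b a β k).2 := by exact_mod_cast S.vec4_snd_pos k
  have hQ12 : ((vec1 b a β (k + 1)).2 : ℝ) ≤ (vec2 b a β (k + 1)).2 := by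
    rw [vec2_eq S.rules]
    simp only [Prod.snd_add, Prod.smul_snd, smul_eq_mul]
    have := S.one_le_pow (t a β (k + 1))
    push_cast; nlinarith
  have hpr := S.two_le_pow (r_pos S.rules (k + 1))
  have e : ((vec2 b a β (k + 1)).2 : ℝ) * form1 b a β ξ k =
      1 + (vec1 b a β (k + 1)).2 * form2 b a β ξ (k + 1) := by
    rw [S.form1_eq]; linear_combination h1 - form2 b a β ξ (k + 1) * hrel
  have hx : ((vec1 b a β (k + 1)).2 : ℝ) * form2 b a β ξ (k + 1) ≤ 1 := by
    have : ((vec1 b a β (k + 1)).2 : ℝ) ≤ (vec3 b a β (k + 1)).2 := by rw [hrel]; nlinarith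
    nlinarith
  have hx0 : 0 ≤ ((vec1 b a β (k + 1)).2 : ℝ) * form2 b a β ξ (k + 1) := mul_nonneg hQ1.le h2
  have hf := S.form1_pos h'
  rw [show k + 1 + 1 = k + 2 from rfl] at hbd
  constructor
  · nlinarith [mul_le_mul_of_nonneg_right hbd.1 hf.le]
  · nlinarith [mul_le_mul_of_nonneg_right hbd.2 hf.le]

/-- When `b_{k+3}` is maximal, `(4)_k` is at least as good an approximation as `(1)_{k+1}`: `(3)_k` is
`(1)_{k+1}` plus a multiple of `(4)_k`, and also `(3)_{k+2}` plus a strictly larger multiple of it. -/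
theorem form4_le_form1 {k : ℕ} (h' : β (k + 3) = a (k + 3)) :
    form4 b a β ξ k ≤ form1 b a β ξ k := by
  obtain ⟨h0, hk, hk2⟩ := S.lt_of_eq h'
  have e1 := S.form3_eq hk
  have e2 := S.form3_eq_of_eq h'
  have h1 := S.coeff14_add_one_le h0
  have h2 := S.form4_pos k
  have h3 := S.form3_pos (k := k + 2) hk2
  nlinarith

theorem not_isConvergent_vec1 {k : ℕ} (h' : β (k + 3) = a (k + 3))
    (hor : 2 ≤ a (k + 2) ∨ β (k + 1) = 0) :
    ¬ IsConvergent ξ (toRat (vec1 b a β (k + 1))) := by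
  obtain ⟨h0, hk, hk2⟩ := S.lt_of_eq h'
  have hle := S.form4_le_form1 h'
  have hp := S.form4_pos k
  refine not_isConvergent_of_abs_lin_le S.nonneg (S.abs_det_vec1_vec4 hk) (S.vec4_snd_pos k) ?_ ?_
  · rcases hor with h | h
    · rw [vec1_succ_eq S.rules hk]
      have h1 := one_le_geom b (q a (k + 1)) (show 1 ≤ a (k + 2) - β (k + 2) - 1 by omega)
      have h2 := S.int_one_le_pow (r a β (k + 1) + q a k)
      have h3 := S.vec4_snd_pos k
      have h4 := vec3_snd_pos S.rules S.one_le_a S.two_le k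
      simp only [Prod.snd_add, Prod.smul_snd, smul_eq_mul]
      nlinarith [show 1 ≤ (b : ℤ) ^ (r a β (k + 1) + q a k) *
        geom b (a (k + 2) - β (k + 2) - 1) (q a (k + 1)) by nlinarith]
    · rw [S.vec4_eq_vec2 h]
      exact (S.vec2_snd_lt_vec3_snd k).trans_le (S.vec3_snd_le_vec1_snd hk)
  · rw [abs_form1, abs_form4, abs_of_pos hp, abs_of_pos (hp.trans_le hle)]
    exact hle

/-! ### The second family -/

theorem isConvergent_vec2 {k : ℕ} (h : β (k + 2) < a (k + 2)) (ht : 0 < t a β k) :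
    IsConvergent ξ (toRat (vec2 b a β k)) := by
  have h2 := S.form2_pos h
  have h3 := S.form3_pos h
  have e : (-1) ^ k * lin ξ (vec3 b a β k - vec2 b a β k) =
      form3 b a β ξ k + form2 b a β ξ k := by
    rw [lin_sub, form3, form2]; ring
  -- `(3)_k - (2)_k` lies on the other side of `ξ`
  refine isConvergent_of_unimodular (w := vec3 b a β k - vec2 b a β k) ?_ ?_ ?_ ?_ ?_
  · rw [vec2_snd S.rules]
    have := r_pos S.rules (k + 1)
    have h5 := repunit_lt S.two_le (show 1 < r a β (k + 1) + t a β k by omega)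
    have h6 := repunit_pos S.two_le (show 0 < 1 by omega)
    omega
  · have := S.vec2_snd_lt_vec3_snd k
    simp only [Prod.snd_sub]; omega
  · rw [← S.abs_det_vec2_vec3 k]; congr 1
    simp only [det, Prod.fst_sub, Prod.snd_sub]; ring
  · have : lin ξ (vec2 b a β k) * lin ξ (vec3 b a β k - vec2 b a β k) =
        -(form2 b a β ξ k * (form3 b a β ξ k + form2 b a β ξ k)) := by
      rw [← e, form2, neg_mul, neg_neg, neg_one_pow_mul_mul]
    rw [this]
    have := mul_pos h2 (add_pos h3 h2)
    linarith
  · rw [abs_form2, abs_of_pos h2, ← abs_neg_one_pow_mul k (lin ξ (vec3 b a β k - vec2 b a β k)), e,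
      abs_of_pos (add_pos h3 h2)]
    linarith

theorem hasExponent_vec2 {k : ℕ} (h : β (k + 2) < a (k + 2)) (h1 : 1 ≤ β (k + 1)) :
    HasExponent (1 / (2 * b)) (4 * b ^ 2) b ξ (toRat (vec2 b a β k))
      (r a β (k + 1) + t a β k) (nu2 a β k) := by
  refine S.hasExponent (S.abs_det_vec2_vec3 k) (S.mul_nu2 k) (S.vec2_snd_pos k)
    (S.vec2_snd_bounds k) ?_
  have h2 := S.form2_pos h
  have h3 := S.form3_pos h
  rw [abs_form2, abs_of_pos h2]
  have hb := S.cast_two_le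
  have hbd := S.vec3_snd_bounds k
  have e := S.snd_vec3_mul_form2 k
  have hle := S.form2_mul_le k h
  have h4 := S.form2_eq k
  have h5 := S.one_le_coeff43 h1
  have h6 := S.form4_pos k
  have h32 : form3 b a β ξ k ≤ form2 b a β ξ k := by nlinarith
  have hQ : ((vec2 b a β k).2 : ℝ) < (vec3 b a β k).2 := by exact_mod_cast S.vec2_snd_lt_vec3_snd k
  have hQ2 : (0 : ℝ) < (vec2 b a β k).2 := by exact_mod_cast S.vec2_snd_pos k
  have hlow : 1 ≤ 2 * ((vec3 b a β k).2 * form2 b a β ξ k) := by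
    have : ((vec2 b a β k).2 : ℝ) * form3 b a β ξ k ≤ (vec3 b a β k).2 * form2 b a β ξ k :=
      mul_le_mul hQ.le h32 h3.le (by linarith)
    linarith
  constructor
  · nlinarith [mul_le_mul_of_nonneg_right hbd.1 h2.le]
  · nlinarith [mul_le_mul_of_nonneg_right hbd.2 h2.le]

theorem not_isConvergent_vec2 {k : ℕ} (h' : β (k + 3) = a (k + 3)) (ht : 0 < t a β (k + 1)) :
    ¬ IsConvergent ξ (toRat (vec2 b a β (k + 1))) := by
  obtain ⟨h0, hk, hk2⟩ := S.lt_of_eq h'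
  have hle := S.form4_le_form1 h'
  have hp := S.form4_pos k
  refine not_isConvergent_of_abs_lin_le S.nonneg (S.abs_det_vec2_vec3 _) (S.vec4_snd_pos k)
    (S.vec4_snd_lt_vec2_snd hk) ?_
  rw [abs_form2, abs_form4, S.form2_succ, abs_of_pos hp]
  refine le_trans ?_ (le_abs_self _)
  have := S.two_le_pow ht
  nlinarith

/-! ### The third family -/

theorem isConvergent_vec3 {k : ℕ} (h : β (k + 2) < a (k + 2)) (h1 : 1 ≤ β (k + 1))
    (ht : 0 < t a β k) : IsConvergent ξ (toRat (vec3 b a β k)) := by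
  have h2 := S.form2_pos h
  have h3 := S.form3_pos h
  refine isConvergent_of_unimodular (w := vec2 b a β k) ?_ (S.vec2_snd_pos k).le
    (S.abs_det_vec3_vec2 k) ?_ ?_
  · have := S.vec2_snd_lt_vec3_snd k
    have := S.vec2_snd_pos k
    omega
  · have : lin ξ (vec3 b a β k) * lin ξ (vec2 b a β k) =
        -(form3 b a β ξ k * form2 b a β ξ k) := by
      rw [form3, form2, mul_neg, neg_neg, neg_one_pow_mul_mul]
    rw [this]
    have := mul_pos h3 h2
    linarith
  · rw [abs_form2, abs_form3, abs_of_pos h2, abs_of_pos h3, S.form2_eq]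
    have := S.two_le_coeff43 h1 ht
    have := S.form4_pos k
    nlinarith

theorem hasExponent_vec3 {k : ℕ} (h : β (k + 2) < a (k + 2)) (h1 : 1 ≤ β (k + 1))
    (h' : β (k + 3) = a (k + 3) ∨ β (k + 2) + 2 ≤ a (k + 2)) :
    HasExponent (1 / (2 * b)) (4 * b ^ 2) b ξ (toRat (vec3 b a β k))
      (r a β (k + 1) + q a k) (nu3 a β k) := by
  refine S.hasExponent (S.abs_det_vec3_vec4 k) (S.mul_nu3 k)
    (vec3_snd_pos S.rules S.one_le_a S.two_le k) (S.vec3_snd_bounds k) ?_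
  have h3 := S.form3_pos h
  have h4 := S.form4_pos k
  have h43 := S.form4_lt_form3 h h'
  rw [abs_form3, abs_of_pos h3]
  have hb := S.cast_two_le
  have hbd := S.vec4_snd_bounds k
  have e := S.snd_vec3_mul_form4 k
  have hQ : ((vec3 b a β k).2 : ℝ) < (vec4 b a β k).2 := by exact_mod_cast S.vec3_snd_lt_vec4_snd h1
  have hQ3 : (0 : ℝ) < (vec3 b a β k).2 := by
    exact_mod_cast vec3_snd_pos S.rules S.one_le_a S.two_le k
  have hlow : 1 ≤ 2 * ((vec4 b a β k).2 * form3 b a β ξ k) := by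
    have : ((vec3 b a β k).2 : ℝ) * form4 b a β ξ k ≤ (vec4 b a β k).2 * form3 b a β ξ k :=
      mul_le_mul hQ.le h43.le h4.le (by linarith)
    linarith
  have hup : ((vec4 b a β k).2 : ℝ) * form3 b a β ξ k ≤ 1 := by
    have := mul_nonneg hQ3.le h4.le
    linarith
  constructor
  · nlinarith [mul_le_mul_of_nonneg_right hbd.1 h3.le]
  · nlinarith [mul_le_mul_of_nonneg_right hbd.2 h3.le]

theorem not_isConvergent_vec3_of_eq {k : ℕ} (h' : β (k + 3) = a (k + 3)) (ht : 0 < t a β (k + 1)) :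
    ¬ IsConvergent ξ (toRat (vec3 b a β (k + 1))) := by
  obtain ⟨h0, hk, hk2⟩ := S.lt_of_eq h'
  have hle := S.form4_le_form1 h'
  have hp := S.form4_pos k
  refine not_isConvergent_of_abs_lin_le S.nonneg (S.abs_det_vec3_vec2 _) (S.vec4_snd_pos k)
    ((S.vec4_snd_lt_vec2_snd hk).trans (S.vec2_snd_lt_vec3_snd _)) ?_
  rw [abs_form3, abs_form4, S.form3_succ, abs_of_pos hp, S.pow_q_eq]
  refine le_trans ?_ (neg_le_abs _)
  have h1 := S.two_le_pow ht
  have h2 := S.two_le_pow (r_pos S.rules (k + 1))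
  have h3 : (b : ℝ) ^ r a β (k + 1) + 1 ≤
    (b : ℝ) ^ t a β (k + 1) * (b : ℝ) ^ r a β (k + 1) - 1 := by nlinarith
  nlinarith [mul_le_mul h3 hle hp.le (by linarith)]

theorem not_isConvergent_vec3 {k : ℕ} (h : β (k + 2) < a (k + 2)) (h0 : β (k + 1) = 0)
    (h' : β (k + 3) = a (k + 3) ∨ β (k + 2) + 2 ≤ a (k + 2)) :
    ¬ IsConvergent ξ (toRat (vec3 b a β k)) := by
  have h4 := S.form4_pos k
  have h43 := S.form4_lt_form3 h h'
  refine not_isConvergent_of_abs_lin_le S.nonneg (S.abs_det_vec3_vec2 _) (S.vec4_snd_pos k)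
    (by rw [S.vec4_eq_vec2 h0]; exact S.vec2_snd_lt_vec3_snd k) ?_
  rw [abs_form3, abs_form4, abs_of_pos h4, abs_of_pos (h4.trans h43)]
  exact h43.le

/-! ### The fourth family -/

theorem isConvergent_vec4 {k : ℕ} (h : β (k + 3) < a (k + 3)) (h2 : β (k + 2) + 2 ≤ a (k + 2))
    (hk : 1 ≤ k) : IsConvergent ξ (toRat (vec4 b a β k)) := by
  have hg : β (k + 2) < a (k + 2) := by omega
  have h4 := S.form4_pos k
  have h43 := S.form4_lt_form3 hg (Or.inr h2)
  refine isConvergent_of_unimodular (w := vec3 b a β k) ?_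
    (vec3_snd_pos S.rules S.one_le_a S.two_le k).le (S.abs_det_vec4_vec3 k) ?_ ?_
  · rw [vec4_snd S.rules]
    obtain ⟨k, rfl⟩ := Nat.exists_eq_add_of_le' hk
    have := S.two_le_q k
    have h5 := repunit_lt S.two_le (show 1 < q a (k + 1 + 1) from this)
    have h6 := repunit_pos S.two_le (show 0 < 1 by omega)
    omega
  · have : lin ξ (vec4 b a β k) * lin ξ (vec3 b a β k) =
        -(form4 b a β ξ k * form3 b a β ξ k) := by
      rw [form3, form4, neg_mul, neg_neg, neg_one_pow_mul_mul]
    rw [this]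
    have := mul_pos h4 (h4.trans h43)
    linarith
  · rw [abs_form3, abs_form4, abs_of_pos h4, abs_of_pos (h4.trans h43)]
    exact h43

theorem hasExponent_vec4 {k : ℕ} (h' : β (k + 3) < a (k + 3)) :
    HasExponent (1 / (2 * b)) (4 * b ^ 2) b ξ (toRat (vec4 b a β k))
      (q a (k + 1)) (nu4 a β k) := by
  refine S.hasExponent (S.abs_det_vec4_vec3 k) (S.mul_nu4 k) (S.vec4_snd_pos k)
    (S.vec4_snd_bounds k) ?_
  rw [abs_form4, abs_of_pos (S.form4_pos k), S.form4_eq]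
  have hb := S.cast_two_le
  have h2 := S.form2_nonneg (k := k + 1) h'
  have h3 := S.form3_nonneg (k := k + 1) h'
  have e := S.snd_vec3_mul_form2 (k + 1)
  have m3 : ((b : ℝ) - 1) * repunit b (q a (k + 1)) = (b : ℝ) ^ q a (k + 1) - 1 := by
    exact_mod_cast mul_repunit b (q a (k + 1))
  have hbd := S.vec2_snd_bounds (k + 1)
  rw [show k + 1 + 1 = k + 2 from rfl, pow_add] at hbd
  rw [vec3_snd S.rules] at e
  push_cast at e
  rw [show k + 1 + 1 = k + 2 from rfl] at e
  rw [← m3]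
  have hnn : 0 ≤ (b : ℝ) ^ r a β (k + 2) * repunit b (q a (k + 1)) * form2 b a β ξ (k + 1) := by
    have : (0 : ℝ) ≤ repunit b (q a (k + 1)) := by
      exact_mod_cast (repunit_pos S.two_le (one_le_q S.one_le_a (k + 1))).le
    positivity
  have l1 := mul_le_mul_of_nonneg_right hbd.1 h3
  have l2 := mul_le_mul_of_nonneg_right hbd.2 h3
  constructor
  · nlinarith
  · nlinarith

theorem not_isConvergent_vec4 {k : ℕ} (h : a (k + 2) = β (k + 2) + 1) (h1 : 1 ≤ β (k + 1))
    (h' : β (k + 3) < a (k + 3)) (ht : 0 < t a β (k + 1)) :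
    ¬ IsConvergent ξ (toRat (vec4 b a β k)) := by
  have hlt := S.form1_lt_form4 h' ht
  have hpos := S.form1_pos h'
  have e : lin ξ (vec3 b a β k) = lin ξ (vec1 b a β (k + 1)) := by rw [S.vec1_succ_eq_vec3 h]
  refine not_isConvergent_of_abs_lin_le S.nonneg (S.abs_det_vec4_vec3 _)
    (vec3_snd_pos S.rules S.one_le_a S.two_le k) (S.vec3_snd_lt_vec4_snd h1) ?_
  rw [e, abs_form1, abs_form4, abs_of_pos hpos, abs_of_pos (hpos.trans hlt)]
  exact hlt.le

end Setting

end

/-! ### The list of convergents -/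

section

/-- The data of a Sturmian number satisfy the properties gathered in `Setting`. -/
theorem setting_of_isInterceptDigits {b : ℕ} (hb : 2 ≤ b) {θ ρ : ℝ} (hθ : Irrational θ)
    (hθ0 : 0 ≤ θ) (hθ1 : θ < 1) {s : Side} {a : ℕ → ℕ} (ha : a = partialQuotient θ)
    {β : ℕ → ℕ} (hβ : IsInterceptDigits a s θ ρ β) {ξ : ℝ} (hξ : ξ = sturmianNumber b s θ ρ) :
    Setting b a β ξ := by
  have h1 : ∀ k, 1 ≤ k → 1 ≤ a k := fun k hk => by rw [ha]; exact one_le_partialQuotient hθ k hk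
  have hmem := sturmianNumber_mem (s := s) (ρ := ρ) hb hθ0 hθ1
  exact
    { two_le := hb
      one_le_a := h1
      rules := hβ.ostrowskiRules h1
      nonneg := by rw [hξ]; exact hmem.1
      le_one := by rw [hξ]; exact hmem.2
      position := fun k hk => position hθ hθ0 hθ1 ha hβ hb hξ hk }

namespace Setting

variable {b : ℕ} {a β : ℕ → ℕ} {ξ : ℝ} (S : Setting b a β ξ)
include S

/-- When `b_{k+3}` is maximal, `(1)_{k+1}` can only be a convergent by coinciding with `(3)_k`. -/
theorem isConvergent_frac1_iff {k : ℕ} (ht : 0 < t a β k) :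
    (r a β (k + 1) < r a β (k + 2) ∧ IsConvergent ξ (frac1 b a β (k + 1))) ↔
      (β (k + 2) + 1 ≤ a (k + 2) ∧ β (k + 3) + 1 ≤ a (k + 3)) ∨
      (1 ≤ β (k + 1) ∧ a (k + 2) = 1 ∧ β (k + 2) = 0 ∧ a (k + 3) = β (k + 3)) := by
  have ht' : 0 < t a β (k + 1) := ht.trans_le (t_mono (by omega))
  constructor
  · rintro ⟨hr, hc⟩
    have hg : β (k + 2) < a (k + 2) := by
      rcases lt_or_eq_of_le (S.rules.le (k + 1)) with h | h
      · exact h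
      · have := S.r_le_r h; omega
    rcases lt_or_eq_of_le (S.rules.le (k + 2)) with h | h
    · exact Or.inl ⟨hg, h⟩
    · right
      have h0 := (S.lt_of_eq h).1
      rw [frac1_eq S.rules S.two_le hr] at hc
      by_contra hcon
      refine S.not_isConvergent_vec1 h ?_ hc
      by_contra hcon2
      apply hcon
      exact ⟨by omega, by omega, h0, h.symm⟩
  · rintro (⟨h, h'⟩ | ⟨h1, h2, h3, h4⟩)
    · have hr := S.r_lt_r (k := k) h
      refine ⟨hr, ?_⟩
      rw [frac1_eq S.rules S.two_le hr]
      exact S.isConvergent_vec1 h h' ht'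
    · have hg : β (k + 2) < a (k + 2) := by omega
      have hr := S.r_lt_r hg
      refine ⟨hr, ?_⟩
      rw [frac1_eq S.rules S.two_le hr, S.vec1_succ_eq_vec3 (by omega)]
      exact S.isConvergent_vec3 hg h1 ht

theorem hasExponent_frac1 {k : ℕ} (h : β (k + 2) + 1 ≤ a (k + 2)) (h' : β (k + 3) + 1 ≤ a (k + 3)) :
    HasExponent (1 / (2 * b)) (4 * b ^ 2) b ξ (frac1 b a β (k + 1))
      (r a β (k + 2)) (nu1 a β (k + 1)) := by
  rw [frac1_eq S.rules S.two_le (S.r_lt_r h)]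
  exact S.hasExponent_vec1 h h'

/-- In this case `(1)_{k+1}` and `(3)_k` are the same rational number. -/
theorem hasExponent_frac1_of_eq {k : ℕ} (h1 : 1 ≤ β (k + 1)) (h2 : a (k + 2) = 1)
    (h3 : β (k + 2) = 0) (h4 : a (k + 3) = β (k + 3)) :
    HasExponent (1 / (2 * b)) (4 * b ^ 2) b ξ (frac1 b a β (k + 1))
      (r a β (k + 2)) (nu3 a β k) := by
  have hg : β (k + 2) < a (k + 2) := by omega
  rw [frac1_eq S.rules S.two_le (S.r_lt_r hg), S.vec1_succ_eq_vec3 (by omega), r_add_two S.rules hg,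
    h2, h3]
  simpa using S.hasExponent_vec3 hg h1 (Or.inl h4.symm)

theorem r_add_t_eq_q {k : ℕ} (h : β (k + 1) = 0) : r a β (k + 1) + t a β k = q a (k + 1) := by
  rw [← t_add_r S.rules (k + 1), t_eq_of_eq_zero h, add_comm]

theorem isConvergent_frac2_iff {k : ℕ} (ht : 0 < t a β (k + 1)) :
    IsConvergent ξ (frac2 b a β (k + 1)) ↔ β (k + 3) + 1 ≤ a (k + 3) := by
  rw [frac2_eq S.rules S.two_le]
  constructor
  · intro hc
    rcases lt_or_eq_of_le (S.rules.le (k + 2)) with h | h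
    · exact h
    · exact absurd hc (S.not_isConvergent_vec2 h ht)
  · intro h
    exact S.isConvergent_vec2 h ht

/-- When `b_{k+3}` is maximal, `(4)_k` and `(2)_{k+2}` are the same rational number. -/
theorem hasExponent_vec4_of_eq {k : ℕ} (h : a (k + 3) = β (k + 3)) :
    HasExponent (1 / (2 * b)) (4 * b ^ 2) b ξ (toRat (vec4 b a β k))
      (q a (k + 1)) (nu2 a β (k + 2)) := by
  have hl := S.lt_of_eq h.symm
  have h1 := S.one_le_a (k + 3) (by omega)
  have := S.hasExponent_vec2 (k := k + 2) hl.2.2 (h ▸ h1)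
  rwa [vec2_of_eq S.rules h.symm, r_add_two_of_eq S.rules (k := k + 1) h.symm,
    t_eq_of_eq_zero (k := k + 1) hl.1, add_comm, t_add_r S.rules] at this

/-- When `b_{k+1} = 0`, `(2)_k` and `(4)_k` are the same rational number. -/
theorem hasExponent_frac2_of_lt {k : ℕ} (h0 : β (k + 1) = 0) (h' : β (k + 3) + 1 ≤ a (k + 3)) :
    HasExponent (1 / (2 * b)) (4 * b ^ 2) b ξ (frac2 b a β k)
      (r a β (k + 1) + t a β k) (nu4 a β k) := by
  rw [frac2_eq S.rules S.two_le, ← S.vec4_eq_vec2 h0, S.r_add_t_eq_q h0]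
  exact S.hasExponent_vec4 h'

theorem hasExponent_frac2_of_eq {k : ℕ} (h0 : β (k + 1) = 0) (h' : a (k + 3) = β (k + 3)) :
    HasExponent (1 / (2 * b)) (4 * b ^ 2) b ξ (frac2 b a β k)
      (r a β (k + 1) + t a β k) (nu2 a β (k + 2)) := by
  rw [frac2_eq S.rules S.two_le, ← S.vec4_eq_vec2 h0, S.r_add_t_eq_q h0]
  exact S.hasExponent_vec4_of_eq h'

theorem isConvergent_frac3_iff {k : ℕ} (ht : 0 < t a β (k + 1)) :
    IsConvergent ξ (frac3 b a β (k + 1)) ↔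
      (1 ≤ β (k + 2) ∧ β (k + 3) + 2 ≤ a (k + 3)) ∨
      (a (k + 3) = β (k + 3) + 1 ∧ β (k + 4) + 1 ≤ a (k + 4)) ∨
      (1 ≤ β (k + 2) ∧ a (k + 3) = 1 ∧ β (k + 3) = 0 ∧ a (k + 4) = β (k + 4)) := by
  rw [frac3_eq S.rules S.two_le]
  constructor
  · intro hc
    rcases lt_or_eq_of_le (S.rules.le (k + 2)) with h | h
    · have hcase : ∀ h' : β (k + 4) = a (k + 4) ∨ β (k + 3) + 2 ≤ a (k + 3), 1 ≤ β (k + 2) := by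
        intro h'
        by_contra h0
        exact S.not_isConvergent_vec3 (k := k + 1) h (show β (k + 2) = 0 by omega) h' hc
      rcases lt_or_eq_of_le (S.rules.le (k + 3)) with h2 | h2
      · simp only [show k + 3 + 1 = k + 4 from rfl, show k + 2 + 1 = k + 3 from rfl] at h h2
        by_cases h3 : β (k + 3) + 2 ≤ a (k + 3)
        · exact Or.inl ⟨hcase (Or.inr h3), h3⟩
        · exact Or.inr (Or.inl ⟨by omega, h2⟩)
      · have h3 := (S.lt_of_eq (k := k + 1) h2).1
        simp only [show k + 3 + 1 = k + 4 from rfl, show k + 2 + 1 = k + 3 from rfl] at h h2 h3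
        by_cases h4 : β (k + 3) + 2 ≤ a (k + 3)
        · exact Or.inl ⟨hcase (Or.inr h4), h4⟩
        · exact Or.inr (Or.inr ⟨hcase (Or.inl h2), by omega, h3, h2.symm⟩)
    · exact absurd hc (S.not_isConvergent_vec3_of_eq h ht)
  · rintro (⟨h1, h2⟩ | ⟨h1, h2⟩ | ⟨h1, h2, h3, h4⟩)
    · exact S.isConvergent_vec3 (k := k + 1) (show β (k + 3) < a (k + 3) by omega) h1 ht
    · rw [← S.vec1_succ_eq_vec3 (k := k + 1) h1]
      exact S.isConvergent_vec1 (k := k + 1) (show β (k + 3) < a (k + 3) by omega) h2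
        (ht.trans_le (t_mono (by omega)))
    · exact S.isConvergent_vec3 (k := k + 1) (show β (k + 3) < a (k + 3) by omega) h1 ht

theorem hasExponent_frac3 {k : ℕ} (h : β (k + 2) < a (k + 2)) (h1 : 1 ≤ β (k + 1))
    (h' : β (k + 3) = a (k + 3) ∨ β (k + 2) + 2 ≤ a (k + 2)) :
    HasExponent (1 / (2 * b)) (4 * b ^ 2) b ξ (frac3 b a β k)
      (r a β (k + 1) + q a k) (nu3 a β k) := by
  rw [frac3_eq S.rules S.two_le]
  exact S.hasExponent_vec3 h h1 h'

/-- In this case `(3)_k` and `(1)_{k+1}` are the same rational number. -/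
theorem hasExponent_frac3_of_lt {k : ℕ} (h : a (k + 2) = β (k + 2) + 1)
    (h' : β (k + 3) + 1 ≤ a (k + 3)) :
    HasExponent (1 / (2 * b)) (4 * b ^ 2) b ξ (frac3 b a β k)
      (r a β (k + 1) + q a k) (nu1 a β (k + 1)) := by
  have hg : β (k + 2) < a (k + 2) := by omega
  have := S.hasExponent_vec1 hg h'
  rw [S.vec1_succ_eq_vec3 h, r_add_two S.rules hg, h] at this
  rw [frac3_eq S.rules S.two_le]
  simpa using this

theorem isConvergent_frac4_iff {k : ℕ} (ht : 0 < t a β (k + 1)) :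
    IsConvergent ξ (frac4 b a β (k + 1)) ↔
      (β (k + 3) + 2 ≤ a (k + 3) ∧ β (k + 4) + 1 ≤ a (k + 4)) ∨
      (β (k + 2) = 0 ∧ a (k + 3) = β (k + 3) + 1 ∧ β (k + 4) + 1 ≤ a (k + 4)) ∨
      a (k + 4) = β (k + 4) := by
  have ht2 : 0 < t a β (k + 2) := ht.trans_le (t_mono (by omega))
  have ht3 : 0 < t a β (k + 3) := ht.trans_le (t_mono (by omega))
  rw [frac4_eq S.rules S.two_le]
  constructor
  · intro hc
    rcases lt_or_eq_of_le (S.rules.le (k + 3)) with h2 | h2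
    · rcases lt_or_eq_of_le (S.rules.le (k + 2)) with h | h
      · simp only [show k + 3 + 1 = k + 4 from rfl, show k + 2 + 1 = k + 3 from rfl] at h h2
        by_cases h3 : β (k + 3) + 2 ≤ a (k + 3)
        · exact Or.inl ⟨h3, h2⟩
        · refine Or.inr (Or.inl ⟨?_, by omega, h2⟩)
          by_contra h0
          exact S.not_isConvergent_vec4 (k := k + 1) (show a (k + 3) = β (k + 3) + 1 by omega)
            (show 1 ≤ β (k + 2) by omega) h2 ht2 hc
      · rw [S.vec4_eq_vec2 (S.lt_of_eq h).1] at hc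
        exact absurd hc (S.not_isConvergent_vec2 h ht)
    · exact Or.inr (Or.inr h2.symm)
  · rintro (⟨h1, h2⟩ | ⟨h1, h2, h3⟩ | h)
    · exact S.isConvergent_vec4 (k := k + 1) h2 h1 (by omega)
    · rw [S.vec4_eq_vec2 (k := k + 1) h1]
      exact S.isConvergent_vec2 (k := k + 1) (show β (k + 3) < a (k + 3) by omega) ht
    · rw [← vec2_of_eq S.rules (k := k + 1) h.symm]
      exact S.isConvergent_vec2 (k := k + 3) (S.lt_of_eq (k := k + 1) h.symm).2.2 ht3

theorem nu2_eq_nu4 {k : ℕ} (h0 : β (k + 1) = 0) (h : a (k + 2) = β (k + 2) + 1) :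
    nu2 a β k = nu4 a β k := by
  have e1 : (r a β (k + 1) : ℝ) + t a β k = q a (k + 1) := by exact_mod_cast S.r_add_t_eq_q h0
  have e2 : (r a β (k + 2) : ℝ) = r a β (k + 1) + q a k := by
    rw [r_add_two S.rules (by omega), h]; simp
  rw [nu2, nu4, e1, e2]

theorem nu2_add_two_eq {k : ℕ} (h : a (k + 3) = β (k + 3)) :
    nu2 a β (k + 2) = 1 + nu4 a β k := by
  have hl := S.lt_of_eq h.symm
  have e1 : r a β (k + 3) = r a β (k + 1) := r_add_two_of_eq S.rules (k := k + 1) h.symm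
  have e2 : t a β (k + 2) = t a β (k + 1) := t_eq_of_eq_zero (k := k + 1) hl.1
  have e3 : (t a β (k + 1) : ℝ) + r a β (k + 1) = q a (k + 1) := by
    exact_mod_cast t_add_r S.rules (k + 1)
  have e4 : (t a β (k + 1) : ℝ) + r a β (k + 2) = q a (k + 2) := by
    rw [← e2]; exact_mod_cast t_add_r S.rules (k + 2)
  have hq : (0 : ℝ) < q a (k + 1) := by exact_mod_cast one_le_q S.one_le_a (k + 1)
  rw [nu2, nu4, show k + 2 + 1 = k + 3 from rfl, e1, e2, ← e4,
    show (r a β (k + 1) : ℝ) + t a β (k + 1) = q a (k + 1) by linarith]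
  field_simp
  linarith

end Setting

end

end

end Sturmian

/-- Conditions such as `a_{k+1} - b_{k+1} ≥ 1` are written `β (k + 1) + 1 ≤ a (k + 1)`, where
`β` is the sequence of digits; the constants `c` and `C` do not depend on `k`. -/
theorem proposition6p1 (b : ℕ) (hb : 2 ≤ b) (θ ρ : ℝ) (hθ : Irrational θ)
    (hθ0 : 0 ≤ θ) (hθ1 : θ < 1) (hρ0 : 0 ≤ ρ) (hρ1 : ρ < 1) (s : Sturmian.Side)
    (a : ℕ → ℕ) (ha : a = Sturmian.partialQuotient θ)
    (β : ℕ → ℕ) (hβ : Sturmian.IsInterceptDigits a s θ ρ β)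
    (ξ : ℝ) (hξ : ξ = Sturmian.sturmianNumber b s θ ρ) :
    ∃ c C : ℝ, 0 < c ∧ 0 < C ∧ ∀ k : ℕ, 2 ≤ k → 0 < Sturmian.t a β (k - 1) →
      -- the rational (1)_k
      (((Sturmian.r a β k < Sturmian.r a β (k + 1) ∧
          Sturmian.IsConvergent ξ (Sturmian.frac1 b a β k)) ↔
        (β (k + 1) + 1 ≤ a (k + 1) ∧ β (k + 2) + 1 ≤ a (k + 2)) ∨
        (1 ≤ β k ∧ a (k + 1) = 1 ∧ β (k + 1) = 0 ∧ a (k + 2) = β (k + 2))) ∧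
      ((β (k + 1) + 1 ≤ a (k + 1) ∧ β (k + 2) + 1 ≤ a (k + 2)) →
        Sturmian.HasExponent c C b ξ (Sturmian.frac1 b a β k) (Sturmian.r a β (k + 1))
          (Sturmian.nu1 a β k)) ∧
      ((1 ≤ β k ∧ a (k + 1) = 1 ∧ β (k + 1) = 0 ∧ a (k + 2) = β (k + 2)) →
        Sturmian.HasExponent c C b ξ (Sturmian.frac1 b a β k) (Sturmian.r a β (k + 1))
          (Sturmian.nu3 a β (k - 1)))) ∧
      -- the rational (2)_k
      ((Sturmian.IsConvergent ξ (Sturmian.frac2 b a β k) ↔ β (k + 2) + 1 ≤ a (k + 2)) ∧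
      (β (k + 2) + 1 ≤ a (k + 2) → 1 ≤ β (k + 1) →
        Sturmian.HasExponent c C b ξ (Sturmian.frac2 b a β k)
          (Sturmian.r a β (k + 1) + Sturmian.t a β k) (Sturmian.nu2 a β k)) ∧
      (β (k + 2) + 1 ≤ a (k + 2) → β (k + 1) = 0 → β (k + 3) + 1 ≤ a (k + 3) →
        Sturmian.HasExponent c C b ξ (Sturmian.frac2 b a β k)
          (Sturmian.r a β (k + 1) + Sturmian.t a β k) (Sturmian.nu4 a β k)) ∧
      (β (k + 2) + 1 ≤ a (k + 2) → β (k + 1) = 0 → a (k + 3) = β (k + 3) →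
        Sturmian.HasExponent c C b ξ (Sturmian.frac2 b a β k)
          (Sturmian.r a β (k + 1) + Sturmian.t a β k) (Sturmian.nu2 a β (k + 2)))) ∧
      -- the rational (3)_k
      ((Sturmian.IsConvergent ξ (Sturmian.frac3 b a β k) ↔
        (1 ≤ β (k + 1) ∧ β (k + 2) + 2 ≤ a (k + 2)) ∨
        (a (k + 2) = β (k + 2) + 1 ∧ β (k + 3) + 1 ≤ a (k + 3)) ∨
        (1 ≤ β (k + 1) ∧ a (k + 2) = 1 ∧ β (k + 2) = 0 ∧ a (k + 3) = β (k + 3))) ∧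
      ((1 ≤ β (k + 1) ∧ β (k + 2) + 2 ≤ a (k + 2)) →
        Sturmian.HasExponent c C b ξ (Sturmian.frac3 b a β k)
          (Sturmian.r a β (k + 1) + Sturmian.q a k) (Sturmian.nu3 a β k)) ∧
      ((a (k + 2) = β (k + 2) + 1 ∧ β (k + 3) + 1 ≤ a (k + 3)) →
        Sturmian.HasExponent c C b ξ (Sturmian.frac3 b a β k)
          (Sturmian.r a β (k + 1) + Sturmian.q a k) (Sturmian.nu1 a β (k + 1))) ∧
      ((1 ≤ β (k + 1) ∧ a (k + 2) = 1 ∧ β (k + 2) = 0 ∧ a (k + 3) = β (k + 3)) →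
        Sturmian.HasExponent c C b ξ (Sturmian.frac3 b a β k)
          (Sturmian.r a β (k + 1) + Sturmian.q a k) (Sturmian.nu3 a β k))) ∧
      -- the rational (4)_k
      ((Sturmian.IsConvergent ξ (Sturmian.frac4 b a β k) ↔
        (β (k + 2) + 2 ≤ a (k + 2) ∧ β (k + 3) + 1 ≤ a (k + 3)) ∨
        (β (k + 1) = 0 ∧ a (k + 2) = β (k + 2) + 1 ∧ β (k + 3) + 1 ≤ a (k + 3)) ∨
        a (k + 3) = β (k + 3)) ∧
      ((β (k + 2) + 2 ≤ a (k + 2) ∧ β (k + 3) + 1 ≤ a (k + 3)) →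
        Sturmian.HasExponent c C b ξ (Sturmian.frac4 b a β k)
          (Sturmian.q a (k + 1)) (Sturmian.nu4 a β k)) ∧
      ((β (k + 1) = 0 ∧ a (k + 2) = β (k + 2) + 1 ∧ β (k + 3) + 1 ≤ a (k + 3)) →
        Sturmian.HasExponent c C b ξ (Sturmian.frac4 b a β k)
          (Sturmian.q a (k + 1)) (Sturmian.nu2 a β k) ∧
        Sturmian.nu2 a β k = Sturmian.nu4 a β k) ∧
      (a (k + 3) = β (k + 3) →
        Sturmian.HasExponent c C b ξ (Sturmian.frac4 b a β k)
          (Sturmian.q a (k + 1)) (Sturmian.nu2 a β (k + 2)) ∧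
        Sturmian.nu2 a β (k + 2) = 1 + Sturmian.nu4 a β k)) := by
  have S := Sturmian.setting_of_isInterceptDigits hb hθ hθ0 hθ1 ha hβ hξ
  have hb0 : (0 : ℝ) < b := by exact_mod_cast (by omega : 0 < b)
  refine ⟨1 / (2 * b), 4 * b ^ 2, by positivity, by positivity, ?_⟩
  intro k hk ht
  obtain ⟨k, rfl⟩ := Nat.exists_eq_add_of_le' (show 1 ≤ k by omega)
  rw [Nat.add_sub_cancel] at ht ⊢
  have ht1 : 0 < Sturmian.t a β (k + 1) := ht.trans_le (Sturmian.t_mono (by omega))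
  refine ⟨⟨S.isConvergent_frac1_iff ht, fun h => S.hasExponent_frac1 h.1 h.2,
      fun h => S.hasExponent_frac1_of_eq h.1 h.2.1 h.2.2.1 h.2.2.2⟩,
    ⟨S.isConvergent_frac2_iff ht1, fun h h1 => ?_,
      fun _ h0 h' => S.hasExponent_frac2_of_lt h0 h',
      fun _ h0 h' => S.hasExponent_frac2_of_eq h0 h'⟩,
    ⟨S.isConvergent_frac3_iff ht1,
      fun h => S.hasExponent_frac3 (k := k + 1) (lt_of_lt_of_le (by omega) h.2) h.1 (Or.inr h.2),
      fun h => S.hasExponent_frac3_of_lt h.1 h.2,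
      fun h => S.hasExponent_frac3 (k := k + 1) ?_ h.1 (Or.inl h.2.2.2.symm)⟩,
    ⟨S.isConvergent_frac4_iff ht1, fun h => ?_, fun h => ⟨?_, S.nu2_eq_nu4 h.1 h.2.1⟩,
      fun h => ⟨?_, S.nu2_add_two_eq h⟩⟩⟩
  · rw [Sturmian.frac2_eq S.rules S.two_le]
    exact S.hasExponent_vec2 h h1
  · have h2 : a (k + 3) = 1 := h.2.1
    have h3 : β (k + 3) = 0 := h.2.2.1
    exact show β (k + 3) < a (k + 3) by omega
  · rw [Sturmian.frac4_eq S.rules S.two_le]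
    exact S.hasExponent_vec4 h.2
  · rw [Sturmian.frac4_eq S.rules S.two_le, S.nu2_eq_nu4 h.1 h.2.1]
    exact S.hasExponent_vec4 h.2.2
  · rw [Sturmian.frac4_eq S.rules S.two_le]
    exact S.hasExponent_vec4_of_eq h
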